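/- **Setting.** Let $\mathcal X$ be an instance space, $\mathcal Y$ a label space, $c:\mathcal X\to\mathcal Y$ a concept and $\mathcal U:\mathcal X\to 2^{\mathcal X}$ a perturbation set. Put $\mathcal U^{-1}(z)=\{x: z\in\mathcal U(x)\}$ and $\mathcal U^{-1}(\mathcal U)(x)=\bigcup_{z\in\mathcal U(x)}\mathcal U^{-1}(z)$. A distribution $D$ on $\mathcal X$ is *robustly realizable* if $\Pr_{x\sim D}[\exists z\in\mathcal U(x): c(z)\ne c(x)]=0$. A (possibly randomized) learner maps a finite labelled sample to a predictor $\mathcal X\to\mathcal Y$; all randomness of different runs is independent, and the events whose probabilities are taken are assumed to be jointly measurable in the seeds, the samples and the test point. * $\mathbb A$ *$(\beta,\epsilon,\delta)$-barely-robustly-learns $c$ w.r.t. $\mathcal U^{-1}(\mathcal U)$ with sample size $m_{\mathbb A}$* if for every robustly realizable $D$, with probability at least $1-\delta$ over $m_{\mathbb A}$ i.i.d. examples $(x_i,c(x_i))$, $x_i\sim D$, and over the randomness of $\mathbb A$, the output $\hat h$ satisfies $\Pr_{x\sim D}[\forall\tilde x\in\mathcal U^{-1}(\mathcal U)(x):\hat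 h(\tilde x)=\hat h(x)]\ge\beta$ and $\Pr_{x\sim D}[\hat h(x)\neq c(x)]\le\epsilon$. * $\mathbb B$ *$(\epsilon,\delta)$-robustly-learns $c$ w.r.t. $\mathcal U$ with sample size $m$* if for every robustly realizable $D$, with probability at least $1-\delta$ over $m$ such examples and the randomness of $\mathbb B$, the output $\hat h$ satisfies $\Pr_{x\sim D}[\exists z\in\mathcal U(x):\hat h(z)\ne c(x)]\le\epsilon$. **$\beta$-RoBoost with target $(\epsilon_0,\delta_0)$.** Let $T_0=\ln(2/\epsilon_0)/\beta$ and $m'=\max\{m_{\mathbb A},\lceil 4\ln(2T_0/\delta_0)\rceil\}$. For a predictor $h$ let $G_h(z)=y$ if $h$ is constantly $y$ on $\mathcal U^{-1}(z)$, and $G_h(z)=\perp$ if there is no such $y$. In round $t=1,2,\dots\le T_0$, draw examples until $m'$ examples $(x,y)$ have been found such that every $G_{h_{s}}$, $s<t$, takes the value $\perp$ somewhere on $\mathcal U(x)$; if $\lfloor 4m'/\epsilon_0\rfloor$ draws do not suffice, stop all rounds. Otherwise call $\mathbb A$ on the first $m_{\mathbb A}$ of these examples to get $h_t$. Output the cascade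 $z\mapsto G_{h_s}(z)$ with the least $s$ such that $G_{h_s}(z)\neq\perp$ (an arbitrary fixed label if there is none). As a learner it has sample size $k=\lfloor T_0\rfloor\lfloor 4m'/\epsilon_0\rfloor$, each round reading its own $\lfloor 4m'/\epsilon_0\rfloor$ examples of its sample. **$\alpha$-Boost on a weak learner $\mathbb B$ of sample size $k$.** Given $m$ examples $S$, let $D_1$ be uniform on $S$, $T=\lfloor 1+48\ln m\rfloor$, $\alpha=1/8$. In round $t\le T$, draw $k$ examples from $D_t$ and call $\mathbb B$ on them, repeating this up to $\lceil\ln(2T/\delta)\rceil$ times until the output $h_t$ satisfies $\Pr_{(x,y)\sim D_t}[\exists z\in\mathcal U(x): h_t(z)\ne y]\le 1/3$ (if this never happens, keep the last output). Obtain $D_{t+1}$ from $D_t$ by multiplying the weight of each $(x,y)$ with $h_t(z)=y$ for all $z\in\mathcal U(x)$ by $e^{-2\alpha}$ and normalizing. Output the majority vote of $h_1,\dots,h_T$ (an arbitrary fixed label where no label has more than half of the votes). **Corollary.** There is an absolute constant $C>0$ such that for all $\beta\in(0,1]$, $\epsilon,\delta\in(0,1)$ and $m_{\mathbb A}\in\mathbb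 N$, with $$m_0=\max\Big\{m_{\mathbb A},\,4\ln\Big(\frac{6\ln 6}{\beta}\Big)\Big\},$$ there is a sample size $$m\le C\left(\frac{m_0}{\beta\epsilon}\log^2\Big(\frac{m_0}{\beta\epsilon}\Big)+\frac{\log(1/\delta)}{\epsilon}\right)$$ for which the following holds for all $\mathcal X,\mathcal Y,\mathcal U,c$ and every learner $\mathbb A$ that $(\beta,\frac{\beta}{6},\frac{\beta}{6\ln 6})$-barely-robustly-learns $c$ w.r.t. $\mathcal U^{-1}(\mathcal U)$ with sample size $m_{\mathbb A}$: $\alpha$-Boost, run on $m$ examples with confidence $\delta$ on top of $\beta$-RoBoost with target $(\frac13,\frac13)$ on top of $\mathbb A$, $(\epsilon,\delta)$-robustly-learns $c$ w.r.t. $\mathcal U$ with sample size $m$, and every run on $m$ examples makes at most $$C\cdot\log m\,\big(\log(1/\delta)+\log\log m\big)\cdot\frac1\beta$$ calls to $\mathbb A$. -/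

import Mathlib

open MeasureTheory

universe u v w

namespace RobustBoost

/-! ### Perturbation sets and robustness -/

section Basic

variable {X : Type u} {Y : Type v}

/-- The inverse image `U⁻¹(z) = {x | z ∈ U(x)}` of a perturbation set. -/
def inv (U : X → Set X) (z : X) : Set X := {x | z ∈ U x}

/-- The enlarged perturbation set `U⁻¹(U)(x) = ⋃_{z ∈ U(x)} U⁻¹(z)`. -/
def invComp (U : X → Set X) (x : X) : Set X := ⋃ z ∈ U x, inv U z

/-- The robust region `Rob_V(h)` of a predictor `h` with respect to `V`. -/
def robustRegion (V : X → Set X) (h : X → Y) : Set X := {x | ∀ z ∈ V x, h z = h x}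

/-- The points on which `h` is not robustly correct for the concept `c`:
some perturbation `z ∈ U(x)` has `h(z) ≠ c(x)`. -/
def robustErrorSet (U : X → Set X) (c h : X → Y) : Set X := {x | ∃ z ∈ U x, h z ≠ c x}

/-- The sample `(x₁, c(x₁)), …, (x_m, c(x_m))`. -/
def labelled (c : X → Y) {m : ℕ} (x : Fin m → X) : List (X × Y) :=
  List.ofFn fun i => (x i, c (x i))

/-- `D` is robustly realizable by `c`: `Pr_{x ∼ D}[∃ z ∈ U(x), c(z) ≠ c(x)] = 0`. -/
def Realizable [MeasurableSpace X] (U : X → Set X) (c : X → Y) (D : Measure X) : Prop :=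
  D (robustErrorSet U c c) = 0

end Basic

/-! ### Learners -/

/-- A (possibly randomized) learner: it maps a random seed and a finite labelled sample to a
predictor.  Every run uses a fresh independent seed; a deterministic learner has a one-point
seed space. -/
structure Learner (X : Type u) (Y : Type v) where
  /-- the space of seeds -/
  Seed : Type w
  /-- the events of the seed space -/
  [measurableSpace : MeasurableSpace Seed]
  /-- the law of the seed -/
  law : Measure Seed
  [isProbabilityMeasure : IsProbabilityMeasure law]
  /-- the predictor that is returned on a given seed and sample -/
  run : Seed → List (X × Y) → X → Y

attribute [instance] Learner.measurableSpace Learner.isProbabilityMeasure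

/-- A learner built on a black-box learner, together with the number of calls to the black box
that it makes on a given seed and sample. -/
structure OracleLearner (X : Type u) (Y : Type v) extends Learner.{u, v, w} X Y where
  /-- number of calls to the black box -/
  calls : Seed → List (X × Y) → ℕ

section Learning

variable {X : Type u} {Y : Type v} [MeasurableSpace X]

/-- `A` `(β, ε, δ)`-barely-robustly-learns `c` with respect to `U⁻¹(U)`, with sample size `m`:
for every robustly realizable `D`, with probability at least `1 - δ` over the sample and the seed,
the predictor `h` has `D(Rob_{U⁻¹(U)}(h)) ≥ β` and `D{h ≠ c} ≤ ε`. -/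
def BarelyRobustlyLearns (A : Learner.{u, v, w} X Y) (U : X → Set X) (c : X → Y)
    (β ε δ : ℝ) (m : ℕ) : Prop :=
  ∀ (D : Measure X) [IsProbabilityMeasure D], Realizable U c D →
    (A.law.prod (Measure.pi fun _ : Fin m => D))
      {p | ¬ (ENNReal.ofReal β ≤ D (robustRegion (invComp U) (A.run p.1 (labelled c p.2))) ∧
              D {x | A.run p.1 (labelled c p.2) x ≠ c x} ≤ ENNReal.ofReal ε)}
      ≤ ENNReal.ofReal δ

/-- `B` `(ε, δ)`-robustly-learns `c` with respect to `U`, with sample size `m`: for every robustly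
realizable `D`, with probability at least `1 - δ` over the sample and the seed, the predictor has
robust risk at most `ε`. -/
def RobustlyLearns (B : Learner.{u, v, w} X Y) (U : X → Set X) (c : X → Y)
    (ε δ : ℝ) (m : ℕ) : Prop :=
  ∀ (D : Measure X) [IsProbabilityMeasure D], Realizable U c D →
    (B.law.prod (Measure.pi fun _ : Fin m => D))
      {p | ¬ (D (robustErrorSet U c (B.run p.1 (labelled c p.2))) ≤ ENNReal.ofReal ε)}
      ≤ ENNReal.ofReal δ

end Learning

/-! ### `β`-RoBoost -/

section RoBoost

variable {X : Type u} {Y : Type v}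

open Classical in
/-- The selective classifier `G_h`: it predicts `y` at `z` if `h` is constantly `y` on `U⁻¹(z)`,
and abstains (`none`) if there is no such `y`. -/
noncomputable def selective (U : X → Set X) (h : X → Y) (z : X) : Option Y :=
  if hz : ∃ y, ∀ x ∈ inv U z, h x = y then some hz.choose else none

/-- The cascade predictor `CAS(h₁, …, h_T)`: the prediction of the first selective classifier that
does not abstain (and the arbitrary label `y₀` if all abstain). -/
noncomputable def cascade (y₀ : Y) (U : X → Set X) (hs : List (X → Y)) (z : X) : Y :=
  (hs.findSome? fun h => selective U h z).getD y₀

open Classical in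
/-- Rejection sampling served from a finite stream of draws (the draws that the round may use at
most): collect the first `m` examples at which each of the predictors `hs` can be forced to abstain;
return the empty dataset if the stream is used up before `m` examples are found. -/
noncomputable def rejectionSampling (U : X → Set X) (hs : List (X → Y)) (m : ℕ)
    (stream : List (X × Y)) : List (X × Y) :=
  let accepted := stream.filter fun p => decide (∀ h ∈ hs, ∃ z ∈ U p.1, selective U h z = none)
  if m ≤ accepted.length then accepted.take m else []

open Classical in
/-- The rounds of `β`-RoBoost, one for each seed in the list; the predictors found so far are `hs`,
each round may use up to `b` fresh draws, and the black box is called on `mA` examples.  Each call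
to the black box adds exactly one predictor to the result. -/
noncomputable def roBoostRounds (A : Learner.{u, v, w} X Y) (U : X → Set X) (mA m b : ℕ) :
    List A.Seed → List (X × Y) → List (X → Y) → List (X → Y)
  | [], _, hs => hs
  | ω :: ωs, S, hs =>
    let S' := rejectionSampling U hs m (S.take b)
    if S' = [] then hs
    else roBoostRounds A U mA m b ωs (S.drop b) (hs ++ [A.run ω (S'.take mA)])

/-- The (real) round bound `T = ln(2/ε)/β` of `β`-RoBoost. -/
noncomputable def roBoostT (β ε : ℝ) : ℝ := Real.log (2 / ε) / β

/-- The size `m = max{m_A, 4 ln(2T/δ)}` of the dataset that each round collects. -/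
noncomputable def roBoostM (β ε δ : ℝ) (mA : ℕ) : ℕ :=
  max mA ⌈4 * Real.log (2 * roBoostT β ε / δ)⌉₊

/-- The number `4m/ε` of draws after which a round is aborted. -/
noncomputable def roBoostBudget (β ε δ : ℝ) (mA : ℕ) : ℕ :=
  ⌊4 * (roBoostM β ε δ mA : ℝ) / ε⌋₊

/-- The total sample size `4Tm/ε` of `β`-RoBoost. -/
noncomputable def roBoostSampleSize (β ε δ : ℝ) (mA : ℕ) : ℕ :=
  ⌊roBoostT β ε⌋₊ * roBoostBudget β ε δ mA

/-- `β`-RoBoost with target `(ε, δ)` on top of the black-box learner `A` of sample size `mA`: rounds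
`t = 1, 2, … ≤ T`, each with a fresh seed for `A`, and the cascade of the predictors as output. -/
noncomputable def roBoost (y₀ : Y) (U : X → Set X) (β ε δ : ℝ) (mA : ℕ)
    (A : Learner.{u, v, w} X Y) : OracleLearner.{u, v, w} X Y where
  Seed := Fin ⌊roBoostT β ε⌋₊ → A.Seed
  law := Measure.pi fun _ => A.law
  run := fun ω S => cascade y₀ U
    (roBoostRounds A U mA (roBoostM β ε δ mA) (roBoostBudget β ε δ mA) (List.ofFn ω) S [])
  calls := fun ω S =>
    (roBoostRounds A U mA (roBoostM β ε δ mA) (roBoostBudget β ε δ mA) (List.ofFn ω) S []).length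

end RoBoost

/-! ### `α`-Boost -/

section AlphaBoost

variable {X : Type u} {Y : Type v}

open Classical in
/-- The majority vote: the label predicted by more than half of the predictors
(and the arbitrary label `y₀` if there is none). -/
noncomputable def majority (y₀ : Y) (hs : List (X → Y)) (z : X) : Y :=
  if hy : ∃ y, hs.length < 2 * hs.countP fun h => decide (h z = y) then hy.choose else y₀

open Classical in
/-- The example of `S` drawn from the distribution with weights `w` by a uniform `r ∈ [0,1]`:
the first one whose cumulative weight exceeds `r` (`none` only if there is no such example, which
for a probability vector happens only at `r = 1`). -/
noncomputable def draw (S : List (X × Y)) (w : Fin S.length → ℝ) (r : ℝ) : Option (X × Y) :=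
  ((List.finRange S.length).find? fun i => decide (r < ∑ j ∈ Finset.univ.filter (· ≤ i), w j)).map
    S.get

/-- `h` is robustly correct on the labelled example `p`. -/
def RobustlyCorrect (U : X → Set X) (h : X → Y) (p : X × Y) : Prop := ∀ z ∈ U p.1, h z = p.2

open Classical in
/-- The robust risk of `h` under the distribution on `S` with weights `w`. -/
noncomputable def weightedRisk (U : X → Set X) (S : List (X × Y)) (w : Fin S.length → ℝ)
    (h : X → Y) : ℝ :=
  ∑ i, if RobustlyCorrect U h (S.get i) then 0 else w i

open Classical in
/-- The reweighting step: multiply by `e^{-2α}`, `α = 1/8`, where `h` is robustly correct, and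
normalize. -/
noncomputable def reweight (U : X → Set X) (S : List (X × Y)) (w : Fin S.length → ℝ)
    (h : X → Y) : Fin S.length → ℝ :=
  let v : Fin S.length → ℝ := fun i =>
    w i * if RobustlyCorrect U h (S.get i) then Real.exp (-2 * (1 / 8)) else 1
  fun i => v i / ∑ j, v j

open Classical in
/-- One round of `α`-Boost: draw `k` examples from the distribution with weights `w`, call `B` on
them, and repeat until the returned predictor has weighted robust risk at most `1/3` or the list of
seeds is used up.  The result is the last predictor (`h₀` if there is none), with the number of
calls made. -/
noncomputable def alphaRound (B : OracleLearner.{u, v, w} X Y) (U : X → Set X) {k : ℕ}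
    (S : List (X × Y)) (w : Fin S.length → ℝ) :
    (X → Y) → List ((Fin k → unitInterval) × B.Seed) → (X → Y) × ℕ
  | h₀, [] => (h₀, 0)
  | _, s :: ss =>
    let S' := (List.ofFn s.1).filterMap fun r => draw S w (r : ℝ)
    let h := B.run s.2 S'
    if weightedRisk U S w h ≤ 1 / 3 then (h, B.calls s.2 S')
    else
      let rest := alphaRound B U S w h ss
      (rest.1, B.calls s.2 S' + rest.2)

/-- The rounds of `α`-Boost, one for each entry of the list, started with the weights `w`: the list
of predictors, with the total number of calls made. -/
noncomputable def alphaRounds (y₀ : Y) (B : OracleLearner.{u, v, w} X Y) (U : X → Set X) {k : ℕ}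
    (S : List (X × Y)) :
    (Fin S.length → ℝ) → List (List ((Fin k → unitInterval) × B.Seed)) → List (X → Y) × ℕ
  | _, [] => ([], 0)
  | w, s :: ss =>
    let r := alphaRound B U S w (fun _ => y₀) s
    let rest := alphaRounds y₀ B U S (reweight U S w r.1) ss
    (r.1 :: rest.1, r.2 + rest.2)

/-- The number `T = 1 + 48 ln m` of rounds of `α`-Boost on `m` examples. -/
noncomputable def alphaT (m : ℕ) : ℕ := ⌊1 + 48 * Real.log m⌋₊

/-- The largest number `⌈ln(2T/δ)⌉` of repetitions within a round. -/
noncomputable def alphaN (m : ℕ) (δ : ℝ) : ℕ := ⌈Real.log (2 * alphaT m / δ)⌉₊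

/-- `α`-Boost on `m` examples with confidence `δ`, on top of a weak robust learner `B` of sample
size `k`: start with the uniform weights and output the majority vote.  The seeds for drawing
examples and for `B` are fresh in every repetition. -/
noncomputable def alphaBoost (y₀ : Y) (U : X → Set X) (δ : ℝ) (m k : ℕ)
    (B : OracleLearner.{u, v, w} X Y) : OracleLearner.{u, v, w} X Y where
  Seed := Fin (alphaT m) → Fin (alphaN m δ) → (Fin k → unitInterval) × B.Seed
  law := Measure.pi fun _ => Measure.pi fun _ => (Measure.pi fun _ => volume).prod B.law
  run := fun s S => majority y₀
    (alphaRounds y₀ B U S (fun _ => 1 / (S.length : ℝ)) (List.ofFn fun t => List.ofFn (s t))).1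
  calls := fun s S =>
    (alphaRounds y₀ B U S (fun _ => 1 / (S.length : ℝ)) (List.ofFn fun t => List.ofFn (s t))).2

end AlphaBoost

/-! ### The combined algorithm -/

section Combined

variable {X : Type u} {Y : Type v}

/-- `α`-Boost, with confidence `δ` and sample size `m`, on top of `β`-RoBoost with target
`(1/3, 1/3)`, on top of the black-box learner `A` of sample size `mA`. -/
noncomputable def boosted (y₀ : Y) (U : X → Set X) (β δ : ℝ) (mA m : ℕ)
    (A : Learner.{u, v, w} X Y) : OracleLearner.{u, v, w} X Y :=
  alphaBoost y₀ U δ m (roBoostSampleSize β (1 / 3) (1 / 3) mA)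
    (roBoost y₀ U β (1 / 3) (1 / 3) mA A)

/-- `m₀ = max{m_A, 4 ln(6 ln(6)/β)}`. -/
noncomputable def baseSize (β : ℝ) (mA : ℕ) : ℝ :=
  max (mA : ℝ) (4 * Real.log (6 * Real.log 6 / β))

/-- Measurability of the events that the risks refer to, jointly in the seeds, the samples and
the test point: the error and robustness of a predictor learned by `A` from `m` examples, and the
robust error of majority votes of cascades of such predictors.  (All of them are automatic when
`X` and the seed space are countable and discrete.) -/
structure MeasurableEvents [MeasurableSpace X] (A : Learner.{u, v, w} X Y) (U : X → Set X)
    (c : X → Y) (y₀ : Y) (m : ℕ) : Prop where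
  error : MeasurableSet {p : (A.Seed × (Fin m → X)) × X |
    A.run p.1.1 (labelled c p.1.2) p.2 ≠ c p.2}
  robust : MeasurableSet {p : (A.Seed × (Fin m → X)) × X |
    p.2 ∈ robustRegion (invComp U) (A.run p.1.1 (labelled c p.1.2))}
  vote : ∀ (r : ℕ) (l : Fin r → ℕ),
    MeasurableSet {p : ((i : Fin r) → Fin (l i) → A.Seed × (Fin m → X)) × X |
      p.2 ∈ robustErrorSet U c (majority y₀ (List.ofFn fun i => cascade y₀ U
        (List.ofFn fun j => A.run (p.1 i j).1 (labelled c (p.1 i j).2))))}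

end Combined

end RobustBoost

/-!
Boosting a barely robust learner to a robust learner.

**`β`-RoBoost is a weak robust learner.**  If the selective classifier `G_h` answers at some
`z ∈ U(x)`, then `h` is constant on `U⁻¹(z)`, which contains `x`; the answer is therefore `h(x)`,
and a robust error of a cascade at `x` means that some member errs at the clean point `x`, unless all
members can be forced to abstain on `U(x)` (`robustErrorSet_cascade_subset`).  The points where `h`
can be forced to abstain are those outside its robust region with respect to `U⁻¹(U)`, so a
successful call of the black box on the conditional distribution on the current abstention region
shrinks this region by the factor `1 - β`, at the price of an error of at most `β/6` of its mass
(`measure_badNext_le`).  Rejection sampling provides independent examples from this conditional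
distribution as long as the region has mass at least `1/6`: given which draws are accepted, the
accepted ones are independent with the conditional law, and too few are accepted only with the
probability that Chernoff's bound allows (`measure_round_le`).  After `⌊ln 6 / β⌋` rounds the region
has mass at most `1/5` and the errors add up to at most `4/5 · 1/6` (`measureReal_history_le`).

**`α`-Boost fits the sample.**  Every repetition within a round is a run of `β`-RoBoost on the
weighted sample, which is a robustly realizable distribution almost surely, so a round fails with
probability at most `3^{-N}` (`measure_failedRound_le`).  If no round fails, the usual potential
argument shows that the majority vote is robustly correct on all of the sample
(`robustlyCorrect_majority`).

**Generalization.**  The vote is determined by the seeds and by the positions in the sample of the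
examples on which the black box was called, `m_A` examples for each of at most `T · ⌊ln 6 / β⌋`
calls.  For fixed positions the remaining sample points are independent of the vote, so a vote of
robust risk more than `ε` is correct on all of them with probability at most
`(1 - ε)^(m - T ⌊ln 6 / β⌋ m_A)` (`measure_codedVote_le`), and a union bound over the choices of
seeds and positions finishes the proof (`robustlyLearns_boosted`).  The condition on `m` that comes
out is solved in `exists_sampleSize`.

**Measurability.**  The hypotheses only speak of predictors learned from fixed seeds and sample
points, and of votes of cascades of such predictors.  The algorithms reach the rest by finitely many
decisions, so every predictor that occurs is described by a random code with values in a countable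
set, which says where its seeds and examples are found.  That these codes are measurable is proved
along with their existence (`exists_codes_roBoostRounds`, `exists_codes_alphaHistory`), and an event
about a coded predictor is a countable union over the values of the code
(`DMeasurable.measurableSet_bind`).
-/

namespace RobustBoost

/-! ### Product measures -/

section ProductMeasure

open Function ENNReal

variable {ι : Type*} [Fintype ι] [DecidableEq ι] {Z : ι → Type*} [∀ i, MeasurableSpace (Z i)]
  {μ : ∀ i, Measure (Z i)} [∀ i, IsProbabilityMeasure (μ i)]

/-- Fubini for a block `s` of coordinates: if, whatever the values of the other coordinates, a
fresh draw of the block lands in `E` with probability at most `q`, then `E` has probability at most `q`. -/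
theorem pi_le_of_updateFinset (s : Finset ι) {E : Set (∀ i, Z i)} (hE : MeasurableSet E)
    {q : ℝ≥0∞}
    (h : ∀ z, Measure.pi (fun i : s => μ i) {y | updateFinset z s y ∈ E} ≤ q) :
    Measure.pi μ E ≤ q := by
  rcases isEmpty_or_nonempty (∀ i, Z i) with hne | ⟨⟨z₀⟩⟩
  · simp [Set.eq_empty_of_isEmpty E]
  have hf : Measurable (E.indicator (fun _ => (1 : ℝ≥0∞))) := measurable_const.indicator hE
  rw [← lintegral_indicator_one hE]
  change ∫⁻ z, E.indicator (fun _ => (1 : ℝ≥0∞)) z ∂Measure.pi μ ≤ q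
  rw [lintegral_eq_lmarginal_univ z₀]
  have hu : (Finset.univ : Finset ι) = sᶜ ∪ s := (compl_sup_eq_top (x := s)).symm
  rw [hu, lmarginal_union μ _ hf disjoint_compl_left]
  have hs : (∫⋯∫⁻_s, E.indicator (fun _ => (1 : ℝ≥0∞)) ∂μ) ≤ fun _ => q := by
    intro z
    refine le_trans (le_of_eq ?_) (h z)
    exact lintegral_indicator_one (measurable_updateFinset hE)
  refine (lmarginal_mono hs z₀).trans ?_
  simp [lmarginal]

/-- Fubini for one coordinate. -/
theorem pi_le_of_update (t : ι) {E : Set (∀ i, Z i)} (hE : MeasurableSet E) {q : ℝ≥0∞}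
    (h : ∀ z, μ t {y | update z t y ∈ E} ≤ q) : Measure.pi μ E ≤ q := by
  refine pi_le_of_updateFinset {t} hE fun z => ?_
  have h1 := (measurePreserving_piUnique (fun i : ({t} : Finset ι) => μ i)).measure_preimage_equiv
    {y | update z t y ∈ E}
  refine le_trans (le_of_eq ?_) (h z)
  refine Eq.trans ?_ h1
  congr 1
  ext y
  simp only [Set.mem_ofPred_eq, Set.mem_preimage]
  rw [updateFinset_singleton]
  rfl

omit [DecidableEq ι] in
/-- Distinct coordinates of a product probability measure are again independent. -/
theorem measurePreserving_comp_injective {κ : Type*} [Fintype κ] {X : Type*} [MeasurableSpace X]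
    (ν : ι → Measure X) [∀ i, IsProbabilityMeasure (ν i)] {f : κ → ι} (hf : Injective f) :
    MeasurePreserving (fun (x : ι → X) k => x (f k)) (Measure.pi ν)
      (Measure.pi fun k => ν (f k)) := by
  refine ⟨by fun_prop, ?_⟩
  have h := (ProbabilityTheory.iIndepFun_pi (μ := ν) (X := fun _ x => x)
    fun i => aemeasurable_id).precomp hf
  rw [ProbabilityTheory.iIndepFun_iff_map_fun_eq_pi_map
    (fun k => (measurable_pi_apply (f k)).aemeasurable)] at h
  refine h.trans ?_
  congr 1
  ext1 k
  exact (measurePreserving_eval ν (f k)).map_eq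

/-- A product of `n * b` copies of `D` is a product of `n` blocks of `b` copies. -/
theorem measurePreserving_blocks {X : Type*} [MeasurableSpace X] (D : Measure X)
    [IsProbabilityMeasure D] (n b : ℕ) :
    MeasurePreserving (fun (x : Fin n → Fin b → X) (p : Fin (n * b)) => x p.divNat p.modNat)
      (Measure.pi fun _ => Measure.pi fun _ => D) (Measure.pi fun _ => D) := by
  refine ⟨by fun_prop, ?_⟩
  symm
  refine Measure.pi_eq fun s hs => ?_
  rw [Measure.map_apply (by fun_prop) (MeasurableSet.univ_pi hs)]
  have : (fun (x : Fin n → Fin b → X) (p : Fin (n * b)) => x p.divNat p.modNat) ⁻¹'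
      Set.univ.pi s = Set.univ.pi fun t => Set.univ.pi fun q => s (finProdFinEquiv (t, q)) := by
    ext x
    simp only [Set.mem_preimage, Set.mem_pi, Set.mem_univ, true_implies]
    constructor
    · intro h t q
      have := h (finProdFinEquiv (t, q))
      have h2 := finProdFinEquiv.symm_apply_apply (t, q)
      rw [finProdFinEquiv_symm_apply, Prod.mk.injEq] at h2
      rwa [h2.1, h2.2] at this
    · intro h p
      have := h p.divNat p.modNat
      have h2 := finProdFinEquiv.apply_symm_apply p
      rw [finProdFinEquiv_symm_apply] at h2
      rwa [h2] at this
  rw [this, Measure.pi_pi]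
  simp_rw [Measure.pi_pi]
  rw [← Fintype.prod_prod_type', ← finProdFinEquiv.prod_comp]

end ProductMeasure

/-! ### Discrete-valued measurable maps -/

section Discrete

variable {Ω α γ : Type*} [MeasurableSpace Ω]

/-- Measurability of a map into a discrete space: every preimage is an event.  The codomain needs no
`MeasurableSpace` instance, which types of codes such as lists of tuples do not have. -/
def DMeasurable (f : Ω → α) : Prop := ∀ s : Set α, MeasurableSet (f ⁻¹' s)

theorem DMeasurable.const (a : α) : DMeasurable fun _ : Ω => a :=
  fun s => MeasurableSet.const (a ∈ s)

theorem DMeasurable.bind [Countable α] {f : Ω → α} (hf : DMeasurable f) {g : α → Ω → γ}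
    (hg : ∀ a, DMeasurable (g a)) : DMeasurable fun ω => g (f ω) ω := by
  intro s
  have : (fun ω => g (f ω) ω) ⁻¹' s = ⋃ a, (f ⁻¹' {a} ∩ g a ⁻¹' s) := by
    ext ω; simp
  rw [this]
  exact MeasurableSet.iUnion fun a => (hf _).inter (hg a s)

theorem DMeasurable.map {f : Ω → α} (hf : DMeasurable f) (φ : α → γ) :
    DMeasurable fun ω => φ (f ω) := fun s => hf (φ ⁻¹' s)

theorem DMeasurable.ite {p : Ω → Prop} [DecidablePred p] (hp : MeasurableSet {ω | p ω})
    {f g : Ω → α} (hf : DMeasurable f) (hg : DMeasurable g) :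
    DMeasurable fun ω => if p ω then f ω else g ω := by
  intro s
  have : (fun ω => if p ω then f ω else g ω) ⁻¹' s =
      ({ω | p ω} ∩ f ⁻¹' s) ∪ ({ω | p ω}ᶜ ∩ g ⁻¹' s) := by
    ext ω
    by_cases h : p ω <;> simp [h]
  rw [this]
  exact (hp.inter (hf s)).union (hp.compl.inter (hg s))

theorem DMeasurable.pi {ι : Type*} [Countable α] [Finite ι] {f : Ω → ι → α}
    (hf : ∀ i, DMeasurable fun ω => f ω i) : DMeasurable f := by
  intro s
  have : f ⁻¹' s = ⋃ a ∈ s, ⋂ i, (fun ω => f ω i) ⁻¹' {a i} := by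
    ext ω
    simp only [Set.mem_preimage, Set.mem_iUnion, Set.mem_iInter, Set.mem_singleton_iff,
      exists_prop]
    constructor
    · exact fun h => ⟨_, h, fun i => rfl⟩
    · rintro ⟨a, ha, h⟩
      rwa [show f ω = a from funext h]
  rw [this]
  exact MeasurableSet.biUnion s.to_countable fun a _ => MeasurableSet.iInter fun i => hf i _

/-- Filtering a discrete random list by random events. -/
theorem DMeasurable.filter [Countable α] {f : Ω → List α} (hf : DMeasurable f)
    {p : Ω → α → Bool} (hp : ∀ a, MeasurableSet {ω | p ω a = true}) :
    DMeasurable fun ω => (f ω).filter (p ω) := by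
  refine hf.bind (g := fun l ω => l.filter (p ω)) fun l => ?_
  induction l with
  | nil => exact DMeasurable.const _
  | cons a l ih =>
    have := DMeasurable.ite (hp a) (ih.map (a :: ·)) ih
    convert this using 2 with ω
    rw [List.filter_cons]

theorem DMeasurable.list_map [Countable γ] {g : α → Ω → γ} (hg : ∀ a, DMeasurable (g a))
    {l : List α} : DMeasurable fun ω => l.map fun a => g a ω := by
  induction l with
  | nil => exact DMeasurable.const _
  | cons a l ih =>
    exact (hg a).bind (g := fun b ω => b :: l.map fun a => g a ω) fun b => ih.map (b :: ·)

theorem DMeasurable.measurableSet_bind [Countable α] {f : Ω → α} (hf : DMeasurable f)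
    {p : α → Ω → Prop} (hp : ∀ a, MeasurableSet {ω | p a ω}) : MeasurableSet {ω | p (f ω) ω} := by
  have : {ω | p (f ω) ω} = ⋃ a, (f ⁻¹' {a} ∩ {ω | p a ω}) := by
    ext ω; simp
  rw [this]
  exact MeasurableSet.iUnion fun a => (hf _).inter (hp a)

theorem dmeasurable_decide {p : Ω → Prop} [DecidablePred p] (hp : MeasurableSet {ω | p ω}) :
    DMeasurable fun ω => decide (p ω) := by
  simpa using DMeasurable.ite hp (DMeasurable.const true) (DMeasurable.const false)

end Discrete

/-! ### Cascades of selective classifiers -/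

section Cascade

variable {X : Type u} {Y : Type v} {U : X → Set X}

/-- The points at which every predictor of the list can be forced to abstain. -/
def abstainRegion (U : X → Set X) (hs : List (X → Y)) : Set X :=
  {x | ∀ h ∈ hs, ∃ z ∈ U x, selective U h z = none}

/-- The points at which some predictor of the list errs although all earlier ones can be forced to
abstain there. -/
def firstErrors (U : X → Set X) (c : X → Y) (hs : List (X → Y)) : Set X :=
  {x | ∃ l h r, hs = l ++ h :: r ∧ x ∈ abstainRegion U l ∧ h x ≠ c x}

theorem eq_of_selective_eq_some {h : X → Y} {z x : X} {y : Y} (hz : selective U h z = some y)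
    (hx : z ∈ U x) : h x = y := by
  unfold selective at hz
  split_ifs at hz with hy
  rw [Option.some.injEq] at hz
  exact hz ▸ hy.choose_spec x hx

/-- `h` never abstains on `U(x)` exactly at the points of its robust region with respect to
`U⁻¹(U)`. -/
theorem exists_selective_eq_none_iff {h : X → Y} {x : X} :
    (∃ z ∈ U x, selective U h z = none) ↔ x ∉ robustRegion (invComp U) h := by
  have hs : ∀ z, selective U h z = none ↔ ¬ ∃ y, ∀ x ∈ inv U z, h x = y := fun z => by
    unfold selective
    split_ifs with hz <;> simp [hz]
  simp only [hs, robustRegion, invComp, inv, Set.mem_ofPred_eq, Set.mem_iUnion, not_exists,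
    not_forall, exists_prop]
  constructor
  · rintro ⟨z, hz, hn⟩
    obtain ⟨x', hx', hne⟩ := hn (h x)
    exact ⟨x', ⟨z, hz, hx'⟩, hne⟩
  · rintro ⟨x', ⟨z, hz, hx'⟩, hne⟩
    refine ⟨z, hz, fun y => ?_⟩
    by_cases hy : h x = y
    · exact ⟨x', hx', hy ▸ hne⟩
    · exact ⟨x, hz, hy⟩

theorem mem_abstainRegion {hs : List (X → Y)} {x : X} :
    x ∈ abstainRegion U hs ↔ ∀ h ∈ hs, x ∉ robustRegion (invComp U) h := by
  simp only [abstainRegion, Set.mem_ofPred_eq, exists_selective_eq_none_iff]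

theorem abstainRegion_concat (hs : List (X → Y)) (h : X → Y) :
    abstainRegion U (hs ++ [h]) = abstainRegion U hs ∩ (robustRegion (invComp U) h)ᶜ := by
  ext x
  simp only [mem_abstainRegion, List.mem_append, List.mem_singleton, Set.mem_inter_iff,
    Set.mem_compl_iff]
  constructor
  · exact fun hx => ⟨fun g hg => hx g (Or.inl hg), hx h (Or.inr rfl)⟩
  · rintro ⟨h1, h2⟩ g (hg | rfl)
    exacts [h1 g hg, h2]

theorem firstErrors_concat_subset (c : X → Y) (hs : List (X → Y)) (h : X → Y) :
    firstErrors U c (hs ++ [h]) ⊆ firstErrors U c hs ∪ (abstainRegion U hs ∩ {x | h x ≠ c x}) := by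
  rintro x ⟨l, g, r, he, hx, hg⟩
  rcases List.eq_nil_or_concat r with rfl | ⟨r', g', rfl⟩
  · obtain ⟨rfl, h2⟩ := List.append_inj' he rfl
    rw [List.cons.injEq] at h2
    exact Or.inr ⟨hx, h2.1 ▸ hg⟩
  · rw [List.concat_eq_append, ← List.cons_append, ← List.append_assoc] at he
    obtain ⟨rfl, -⟩ := List.append_inj' he rfl
    exact Or.inl ⟨l, g, r', rfl, hx, hg⟩

/-- The points that are abstained from or misclassified can only become fewer when the cascade is
prolonged. -/
theorem abstain_union_firstErrors_concat_subset (c : X → Y) (hs : List (X → Y)) (h : X → Y) :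
    abstainRegion U (hs ++ [h]) ∪ firstErrors U c (hs ++ [h]) ⊆
      abstainRegion U hs ∪ firstErrors U c hs := by
  rw [abstainRegion_concat]
  rintro x (hx | hx)
  · exact Or.inl hx.1
  · rcases firstErrors_concat_subset c hs h hx with hx | hx
    exacts [Or.inr hx, Or.inl hx.1]

/-- A robust error of a cascade at `x` comes from a member that errs at the clean point `x`: the
member that answers at `z ∈ U(x)` is constant on `U⁻¹(z)`, which contains `x`. -/
theorem robustErrorSet_cascade_subset (y₀ : Y) (c : X → Y) (hs : List (X → Y)) :
    robustErrorSet U c (cascade y₀ U hs) ⊆ abstainRegion U hs ∪ firstErrors U c hs := by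
  rintro x ⟨z, hz, hne⟩
  by_cases hx : x ∈ abstainRegion U hs
  · exact Or.inl hx
  right
  simp only [abstainRegion, Set.mem_ofPred_eq, not_forall, not_exists, not_and] at hx
  obtain ⟨h, hh, hn⟩ := hx
  cases hf : hs.findSome? fun h => selective U h z with
  | none => exact absurd (List.findSome?_eq_none_iff.1 hf h hh) (hn z hz)
  | some y =>
    obtain ⟨l, g, r, he, hg, hl⟩ := List.findSome?_eq_some_iff.1 hf
    refine ⟨l, g, r, he, fun h' hh' => ⟨z, hz, hl h' hh'⟩, ?_⟩
    rw [eq_of_selective_eq_some hg hz]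
    simpa [cascade, hf] using hne

open Classical in
theorem rejectionSampling_eq (hs : List (X → Y)) (m : ℕ) (S : List (X × Y)) :
    rejectionSampling U hs m S =
      if m ≤ (S.filter fun p => decide (p.1 ∈ abstainRegion U hs)).length then
        (S.filter fun p => decide (p.1 ∈ abstainRegion U hs)).take m else [] := by
  have : (fun p : X × Y => decide (∀ h ∈ hs, ∃ z ∈ U p.1, selective U h z = none)) =
      fun p => decide (p.1 ∈ abstainRegion U hs) := funext fun p => decide_eq_decide.2 Iff.rfl
  unfold rejectionSampling
  rw [this]

open Classical in
/-- The majority label is the label with more than half of the votes, if there is one. -/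
theorem majority_eq (y₀ : Y) {hs : List (X → Y)} {z : X} {y : Y}
    (hy : hs.length < 2 * hs.countP fun h => decide (h z = y)) : majority y₀ hs z = y := by
  have hex : ∃ y, hs.length < 2 * hs.countP fun h => decide (h z = y) := ⟨y, hy⟩
  unfold majority
  rw [dif_pos hex]
  by_contra hne
  have h1 := hex.choose_spec
  have h2 : (hs.countP fun h => decide (h z = y)) ≤
      hs.countP fun h => ! decide (h z = hex.choose) := by
    refine List.countP_mono_left fun h _ hh => ?_
    simp only [decide_eq_true_eq] at hh
    simpa [hh] using fun h => hne h.symm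
  have h3 := hs.length_eq_countP_add_countP fun h => decide (h z = hex.choose)
  simp only [Bool.not_eq_true, Bool.decide_eq_false] at h3
  omega

/-- A one-member vote is won by its member. -/
theorem majority_singleton (y₀ : Y) (h : X → Y) : majority y₀ [h] = h := by
  funext z
  exact majority_eq y₀ (by simp)

end Cascade

/-! ### Predictors described by discrete codes -/

theorem ofFn_get_eq_map {α γ : Type*} (f : α → γ) (l : List α) :
    (List.ofFn fun i => f (l.get i)) = l.map f := by
  conv_rhs => rw [← List.ofFn_get l]
  rw [List.map_ofFn]
  rfl

section Codes

variable {X : Type u} {Y : Type v}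

/-- The predictor that `A` returns on the seed `p.1` and the sample `p.2` labelled by `c`. -/
def learned (A : Learner.{u, v, w} X Y) (c : X → Y) {k : ℕ} (p : A.Seed × (Fin k → X)) : X → Y :=
  A.run p.1 (labelled c p.2)

/-- The predictors learned from a list of codes, each of which stands (through `dec`) for a seed of
`A` and a sample that depend on the outcome `ω`. -/
def decoded {Ω κ : Type*} (A : Learner.{u, v, w} X Y) (c : X → Y) {k : ℕ}
    (dec : κ → Ω → A.Seed × (Fin k → X)) (L : List κ) (ω : Ω) : List (X → Y) :=
  L.map fun a => learned A c (dec a ω)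

variable [MeasurableSpace X] {A : Learner.{u, v, w} X Y} {U : X → Set X} {c : X → Y} {y₀ : Y}
  {mA : ℕ} {Ω : Type*} [MeasurableSpace Ω]

section Events

variable {κ : Type*} {dec : κ → Ω → A.Seed × (Fin mA → X)}

theorem MeasurableEvents.learned_ne (hM : MeasurableEvents A U c y₀ mA)
    {p : Ω → A.Seed × (Fin mA → X)} (hp : Measurable p) {x : Ω → X} (hx : Measurable x) :
    MeasurableSet {ω | learned A c (p ω) (x ω) ≠ c (x ω)} :=
  (hp.prodMk hx) hM.error

theorem MeasurableEvents.mem_robustRegion (hM : MeasurableEvents A U c y₀ mA)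
    {p : Ω → A.Seed × (Fin mA → X)} (hp : Measurable p) {x : Ω → X} (hx : Measurable x) :
    MeasurableSet {ω | x ω ∈ robustRegion (invComp U) (learned A c (p ω))} :=
  (hp.prodMk hx) hM.robust

theorem MeasurableEvents.mem_abstainRegion (hM : MeasurableEvents A U c y₀ mA)
    (hdec : ∀ a, Measurable (dec a)) {x : Ω → X} (hx : Measurable x) (L : List κ) :
    MeasurableSet {ω | x ω ∈ abstainRegion U (decoded A c dec L ω)} := by
  have : {ω | x ω ∈ abstainRegion U (decoded A c dec L ω)} =
      ⋂ a ∈ {a | a ∈ L}, {ω | x ω ∈ robustRegion (invComp U) (learned A c (dec a ω))}ᶜ := by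
    ext ω
    simp [RobustBoost.mem_abstainRegion, decoded]
  rw [this]
  exact MeasurableSet.biInter (List.finite_toSet L).countable
    fun a _ => (hM.mem_robustRegion (hdec a) hx).compl

theorem MeasurableEvents.mem_robustErrorSet_majority (hM : MeasurableEvents A U c y₀ mA)
    (hdec : ∀ a, Measurable (dec a)) {x : Ω → X} (hx : Measurable x) (Ls : List (List κ)) :
    MeasurableSet {ω | x ω ∈ robustErrorSet U c
      (majority y₀ (Ls.map fun L => cascade y₀ U (decoded A c dec L ω)))} := by
  have h := hM.vote Ls.length fun i => (Ls.get i).length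
  have hf : Measurable fun ω => ((fun i j => dec ((Ls.get i).get j) ω :
      (i : Fin Ls.length) → Fin (Ls.get i).length → A.Seed × (Fin mA → X)), x ω) := by
    refine Measurable.prodMk (measurable_pi_lambda _ fun i => measurable_pi_lambda _ fun j => ?_) hx
    exact hdec _
  convert hf h using 1
  ext ω
  simp only [Set.mem_ofPred_eq, Set.mem_preimage]
  have h1 : ∀ L : List κ, (List.ofFn fun j : Fin L.length =>
      A.run (dec (L.get j) ω).1 (labelled c (dec (L.get j) ω).2)) = decoded A c dec L ω := by
    exact fun L => ofFn_get_eq_map (fun a => learned A c (dec a ω)) L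
  simp only [h1]
  rw [ofFn_get_eq_map fun L => cascade y₀ U (decoded A c dec L ω)]

theorem MeasurableEvents.mem_robustErrorSet_cascade (hM : MeasurableEvents A U c y₀ mA)
    (hdec : ∀ a, Measurable (dec a)) {x : Ω → X} (hx : Measurable x) (L : List κ) :
    MeasurableSet {ω | x ω ∈ robustErrorSet U c (cascade y₀ U (decoded A c dec L ω))} := by
  simpa [majority_singleton] using hM.mem_robustErrorSet_majority hdec hx [L]

end Events

section Rounds

variable {τ ι : Type*}

/-- A code `(t, J)` stands for the seed number `t` and the sample of the points numbered `J`. -/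
def seedSample (sd : τ → Ω → A.Seed) (pt : ι → Ω → X) {k : ℕ} (a : τ × (Fin k → ι)) (ω : Ω) :
    A.Seed × (Fin k → X) :=
  (sd a.1 ω, fun q => pt (a.2 q) ω)

theorem measurable_seedSample {sd : τ → Ω → A.Seed} {pt : ι → Ω → X}
    (hsd : ∀ t, Measurable (sd t)) (hpt : ∀ i, Measurable (pt i)) {k : ℕ}
    (a : τ × (Fin k → ι)) : Measurable (seedSample sd pt a) :=
  (hsd _).prodMk (measurable_pi_lambda _ fun _ => hpt _)

open Classical in
/-- The code of the predictor learned from the seed `t` and the points in the list `l`, as a list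
with one member; it is empty if `l` does not consist of `k` points. -/
noncomputable def codeOf (k : ℕ) (t : τ) (l : List ι) : List (τ × (Fin k → ι)) :=
  if h : l.length = k then [(t, fun q => l.get (q.cast h.symm))] else []

omit [MeasurableSpace X] [MeasurableSpace Ω] in
theorem decoded_codeOf (c : X → Y) (sd : τ → Ω → A.Seed) (pt : ι → Ω → X) (t : τ)
    {k : ℕ} {l : List ι} (h : l.length = k) (ω : Ω) :
    decoded A c (seedSample sd pt) (codeOf k t l) ω =
      [A.run (sd t ω) (l.map fun i => (pt i ω, c (pt i ω)))] := by
  subst h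
  simp only [decoded, codeOf, dif_pos, List.map_cons, List.map_nil, learned, seedSample, labelled]
  congr 2
  exact ofFn_get_eq_map (fun i => (pt i ω, c (pt i ω))) l

omit [MeasurableSpace X] [MeasurableSpace Ω] in
theorem decoded_append {κ : Type*} (c : X → Y) {k : ℕ} (dec : κ → Ω → A.Seed × (Fin k → X))
    (L L' : List κ) (ω : Ω) :
    decoded A c dec (L ++ L') ω = decoded A c dec L ω ++ decoded A c dec L' ω :=
  List.map_append

open Classical in
omit [MeasurableSpace X] [MeasurableSpace Ω] in
theorem rejectionSampling_map (hs : List (X → Y)) (m : ℕ) (l : List ι) (pt : ι → X) :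
    rejectionSampling U hs m (l.map fun i => (pt i, c (pt i))) =
      (if m ≤ (l.filter fun i => decide (pt i ∈ abstainRegion U hs)).length then
        (l.filter fun i => decide (pt i ∈ abstainRegion U hs)).take m else []).map
          fun i => (pt i, c (pt i)) := by
  rw [rejectionSampling_eq, List.filter_map, List.length_map,
    show ((fun p : X × Y => decide (p.1 ∈ abstainRegion U hs)) ∘ fun i => (pt i, c (pt i))) =
      fun i => decide (pt i ∈ abstainRegion U hs) from rfl]
  split_ifs
  · rw [List.map_take]
  · rfl

/-- The predictors of `β`-RoBoost on a random sample are learned from random codes, and these codes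
are measurable.  The draws are the points numbered by the random list `I`, and `L` lists the codes
of the predictors that are already there. -/
theorem exists_codes_roBoostRounds [Countable τ] [Countable ι]
    (hM : MeasurableEvents A U c y₀ mA) {sd : τ → Ω → A.Seed} {pt : ι → Ω → X}
    (hsd : ∀ t, Measurable (sd t)) (hpt : ∀ i, Measurable (pt i)) {m : ℕ}
    (hmA : mA ≤ m) (b : ℕ) (ts : List τ) {I : Ω → List ι} (hI : DMeasurable I)
    {L : Ω → List (τ × (Fin mA → ι))} (hL : DMeasurable L) :
    ∃ L' : Ω → List (τ × (Fin mA → ι)), DMeasurable L' ∧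
      (∀ ω, (L' ω).length ≤ (L ω).length + ts.length) ∧
      ∀ ω, roBoostRounds A U mA m b (ts.map fun t => sd t ω)
        ((I ω).map fun i => (pt i ω, c (pt i ω))) (decoded A c (seedSample sd pt) (L ω) ω) =
          decoded A c (seedSample sd pt) (L' ω) ω := by
  classical
  induction ts generalizing I L with
  | nil => exact ⟨L, hL, fun ω => by simp, fun ω => rfl⟩
  | cons t ts ih =>
    set F : Ω → List ι := fun ω => ((I ω).take b).filter
      fun i => decide (pt i ω ∈ abstainRegion U (decoded A c (seedSample sd pt) (L ω) ω)) with hFdef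
    have hF : DMeasurable F := (hI.map (List.take b)).filter fun i => by
      simp only [decide_eq_true_eq]
      exact hL.measurableSet_bind (p := fun l ω => pt i ω ∈ abstainRegion U
        (decoded A c (seedSample sd pt) l ω)) fun l =>
          hM.mem_abstainRegion (measurable_seedSample hsd hpt) (hpt i) l
    set G : Ω → List ι := fun ω => if m ≤ (F ω).length then (F ω).take m else [] with hGdef
    have hG : DMeasurable G := hF.map fun l => if m ≤ l.length then l.take m else []
    have hL1 : DMeasurable fun ω => L ω ++ codeOf mA t ((G ω).take mA) :=
      hL.bind (g := fun l ω => l ++ codeOf mA t ((G ω).take mA)) fun l =>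
        hG.map fun g => l ++ codeOf mA t (g.take mA)
    obtain ⟨L', hL', hlen, hL'eq⟩ := ih (hI.map (List.drop b)) hL1
    have hlen1 : ∀ l : List ι, (codeOf mA t l).length ≤ 1 := fun l => by
      unfold codeOf; split_ifs <;> simp
    refine ⟨fun ω => if G ω = [] then L ω else L' ω, ?_, fun ω => ?_, fun ω => ?_⟩
    · exact DMeasurable.ite (hG {[]}) hL hL'
    · dsimp only
      have h1 := hlen ω
      have h2 := hlen1 ((G ω).take mA)
      split_ifs
      · simp
      · simp only [List.length_append, List.length_cons] at h1 ⊢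
        omega
    · rw [List.map_cons, roBoostRounds, ← List.map_take, ← List.map_drop, rejectionSampling_map]
      change (if (G ω).map _ = [] then _ else _) =
        decoded A c (seedSample sd pt) (if G ω = [] then L ω else L' ω) ω
      by_cases hg : G ω = []
      · simp [hg]
      · rw [if_neg (by simpa using hg), if_neg hg, ← hL'eq ω, decoded_append, decoded_codeOf]
        · rw [List.map_take]
        · have : m ≤ (F ω).length := by
            by_contra h
            exact hg (by simp [hGdef, h])
          have h2 : (G ω).length = m := by simp [hGdef, this]
          rw [List.length_take, h2]
          omega

end Rounds

end Codes

section RoundsRecursion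

variable {X : Type u} {Y : Type v} {A : Learner.{u, v, w} X Y} {U : X → Set X} {mA m b : ℕ}

theorem length_roBoostRounds_le (ts : List A.Seed) (S : List (X × Y)) (hs : List (X → Y)) :
    (roBoostRounds A U mA m b ts S hs).length ≤ hs.length + ts.length := by
  classical
  induction ts generalizing S hs with
  | nil => simp [roBoostRounds]
  | cons t ts ih =>
    rw [roBoostRounds]
    split_ifs
    · simp
    · refine (ih _ _).trans ?_
      simp only [List.length_append, List.length_cons, List.length_nil]
      omega

open Classical in
/-- The last round of `β`-RoBoost: it takes place if no earlier round was stopped, that is, if each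
of them has contributed a predictor. -/
theorem roBoostRounds_concat (ts : List A.Seed) (t : A.Seed) (S S' : List (X × Y))
    (hS : S.length = ts.length * b) (hS' : S'.length = b) (hs : List (X → Y)) :
    roBoostRounds A U mA m b (ts ++ [t]) (S ++ S') hs =
      let H := roBoostRounds A U mA m b ts S hs
      if H.length = hs.length + ts.length ∧ rejectionSampling U H m S' ≠ [] then
        H ++ [A.run t ((rejectionSampling U H m S').take mA)]
      else H := by
  induction ts generalizing S hs with
  | nil =>
    have : S = [] := List.length_eq_zero_iff.1 (by simpa using hS)
    subst this
    by_cases h : rejectionSampling U hs m S' = []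
    · simp [roBoostRounds, ← hS', h]
    · simp [roBoostRounds, ← hS', h]
  | cons s ts ih =>
    have hb : b ≤ S.length := by rw [hS, List.length_cons, Nat.add_mul, one_mul]; omega
    rw [List.cons_append, roBoostRounds, roBoostRounds, List.take_append_of_le_length hb,
      List.drop_append_of_le_length hb]
    by_cases h : rejectionSampling U hs m (S.take b) = []
    · rw [if_pos h, if_pos h, if_neg]
      simp
    · rw [if_neg h, if_neg h, ih]
      · simp only [List.length_append, List.length_cons, List.length_nil]
        rw [show hs.length + (0 + 1) + ts.length = hs.length + (ts.length + 1) by omega]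
      · rw [List.length_drop, hS, List.length_cons, Nat.add_mul, one_mul, Nat.add_sub_cancel]

end RoundsRecursion

/-! ### Rejection sampling -/

section Rejection

open ProbabilityTheory ENNReal

variable {X : Type u} [MeasurableSpace X] {D : Measure X} [IsProbabilityMeasure D] {R : Set X}
  {b : ℕ}

/-- The streams whose draws in `R` are exactly those numbered `P`. -/
def pattern (R : Set X) (P : Finset (Fin b)) : Set (Fin b → X) := {x | ∀ i, x i ∈ R ↔ i ∈ P}

omit [MeasurableSpace X] in
open Classical in
theorem pattern_eq_pi (R : Set X) (P : Finset (Fin b)) :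
    pattern R P = Set.univ.pi fun i => if i ∈ P then R else Rᶜ := by
  ext x
  simp only [pattern, Set.mem_ofPred_eq, Set.mem_pi, Set.mem_univ, true_implies]
  refine forall_congr' fun i => ?_
  by_cases h : i ∈ P <;> simp [h]

theorem measurableSet_pattern (hR : MeasurableSet R) (P : Finset (Fin b)) :
    MeasurableSet (pattern R P) := by
  classical
  rw [pattern_eq_pi]
  refine MeasurableSet.univ_pi fun i => ?_
  split_ifs
  exacts [hR, hR.compl]

theorem measure_pattern (P : Finset (Fin b)) :
    Measure.pi (fun _ => D) (pattern R P) = D R ^ P.card * D Rᶜ ^ (b - P.card) := by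
  classical
  rw [pattern_eq_pi, Measure.pi_pi]
  simp_rw [apply_ite (fun s => D s)]
  rw [Finset.prod_ite]
  simp [Finset.filter_not, Finset.card_sdiff]

theorem sum_measure_pattern (hR : MeasurableSet R) :
    ∑ P : Finset (Fin b), Measure.pi (fun _ => D) (pattern R P) = 1 := by
  simp_rw [measure_pattern]
  have := Fintype.sum_pow_mul_eq_add_pow (Fin b) (D R) (D Rᶜ)
  rw [Fintype.card_fin] at this
  rw [this, prob_add_prob_compl hR, one_pow]

/-- Given the pattern of acceptance, accepted draws are independent with the conditional law. -/
theorem measure_pattern_inter_le {Ω : Type*} [MeasurableSpace Ω] (ρ : Measure Ω)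
    [IsProbabilityMeasure ρ] (hR : MeasurableSet R) (P : Finset (Fin b)) {k : ℕ}
    {f : Fin k → Fin b} (hf : Function.Injective f) (hfP : ∀ q, f q ∈ P)
    (B : Set (Ω × (Fin k → X))) :
    ρ.prod (Measure.pi fun _ => D) {p | p.2 ∈ pattern R P ∧ (p.1, fun q => p.2 (f q)) ∈ B} ≤
      Measure.pi (fun _ => D) (pattern R P) * ρ.prod (Measure.pi fun _ => D[|R]) B := by
  classical
  set s : Fin b → Set X := fun i => if i ∈ P then R else Rᶜ with hs
  have hsm : ∀ i, MeasurableSet (s i) := fun i => by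
    simp only [hs]; split_ifs; exacts [hR, hR.compl]
  by_cases h0 : ∃ i, D (s i) = 0
  · obtain ⟨i, hi⟩ := h0
    have hz : Measure.pi (fun _ => D) (pattern R P) = 0 := by
      rw [pattern_eq_pi, Measure.pi_pi]
      exact Finset.prod_eq_zero (Finset.mem_univ i) hi
    rw [hz, zero_mul]
    refine le_trans (measure_mono (t := Set.univ ×ˢ pattern R P) fun p hp => ⟨trivial, hp.1⟩) ?_
    rw [Measure.prod_prod, hz, mul_zero]
  push Not at h0
  have hprob : ∀ i, IsProbabilityMeasure (D[|s i]) := fun i => cond_isProbabilityMeasure (h0 i)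
  have hmeas : (Measure.pi fun _ => D).restrict (pattern R P) =
      (Measure.pi (fun _ => D) (pattern R P)) • Measure.pi fun i => D[|s i] := by
    rw [pattern_eq_pi, Measure.restrict_pi_pi]
    refine Measure.pi_eq fun t ht => ?_
    rw [Measure.smul_apply, Measure.pi_pi, Measure.pi_pi, smul_eq_mul, ← Finset.prod_mul_distrib]
    refine Finset.prod_congr rfl fun i _ => ?_
    rw [Measure.restrict_apply (ht i), mul_comm, cond_mul_eq_inter (hsm i), Set.inter_comm]
  have hmp : MeasurePreserving (Prod.map id fun (x : Fin b → X) (q : Fin k) => x (f q))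
      (ρ.prod (Measure.pi fun i => D[|s i])) (ρ.prod (Measure.pi fun _ => D[|R])) := by
    have := measurePreserving_comp_injective (fun i => D[|s i]) hf
    have h2 : (fun q => D[|s (f q)]) = fun _ : Fin k => D[|R] := by
      funext q; simp [hs, hfP q]
    rw [h2] at this
    have hsf : SFinite (Measure.pi fun _ : Fin k => D[|R]) := by rw [← h2]; infer_instance
    exact (MeasurePreserving.id ρ).prod this
  have hset : {p : Ω × (Fin b → X) | p.2 ∈ pattern R P ∧ (p.1, fun q => p.2 (f q)) ∈ B} =
      (Prod.map id fun (x : Fin b → X) (q : Fin k) => x (f q)) ⁻¹' B ∩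
        Set.univ ×ˢ pattern R P := by
    ext p
    simp only [Set.mem_ofPred_eq, Set.mem_inter_iff, Set.mem_preimage, Set.mem_prod, Set.mem_univ,
      true_and]
    exact and_comm
  rw [hset, ← Measure.restrict_apply' (MeasurableSet.univ.prod (measurableSet_pattern hR P)),
    ← Measure.prod_restrict, Measure.restrict_univ, hmeas, Measure.prod_smul_right,
    Measure.smul_apply, smul_eq_mul]
  gcongr
  rw [← hmp.map_eq]
  exact Measure.le_map_apply hmp.measurable.aemeasurable B

/-- Chernoff's bound for the lower tail: if `R` has mass at least `1/6`, then `12 M` draws contain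
fewer than `M` points of `R` with probability at most `exp(-M/4)`. -/
theorem sum_measure_pattern_card_lt_le (hR : MeasurableSet R) (hp : ENNReal.ofReal (1 / 6) ≤ D R)
    (M : ℕ) : ∑ P : Finset (Fin (12 * M)) with P.card < M,
      Measure.pi (fun _ => D) (pattern R P) ≤ ENNReal.ofReal (Real.exp (-(M / 4))) := by
  have hR1 : D.real R + D.real Rᶜ = 1 := probReal_add_probReal_compl hR
  have hp' : 1 / 6 ≤ D.real R := by
    rw [Measure.real, ← ENNReal.ofReal_le_iff_le_toReal (measure_ne_top _ _)]
    exact hp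
  have hterm : ∀ P : Finset (Fin (12 * M)), Measure.pi (fun _ => D) (pattern R P) =
      ENNReal.ofReal (D.real R ^ P.card * D.real Rᶜ ^ (12 * M - P.card)) := fun P => by
    rw [measure_pattern, ENNReal.ofReal_mul (by positivity), ENNReal.ofReal_pow (by positivity),
      ENNReal.ofReal_pow (by positivity), ofReal_measureReal, ofReal_measureReal]
  simp_rw [hterm]
  rw [← ENNReal.ofReal_sum_of_nonneg fun P _ => by positivity]
  refine ENNReal.ofReal_le_ofReal ?_
  -- each draw in `R` is discounted by `1/2`; the factor `2 ^ M` compensates for fewer than `M`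
  calc ∑ P : Finset (Fin (12 * M)) with P.card < M,
        D.real R ^ P.card * D.real Rᶜ ^ (12 * M - P.card)
      ≤ ∑ P : Finset (Fin (12 * M)) with P.card < M,
        2 ^ M * ((D.real R / 2) ^ P.card * D.real Rᶜ ^ (12 * M - P.card)) := by
        refine Finset.sum_le_sum fun P hP => ?_
        rw [Finset.mem_filter] at hP
        rw [← mul_assoc, div_pow, mul_div_assoc']
        gcongr
        rw [le_div_iff₀ (by positivity), mul_comm]
        gcongr
        exacts [one_le_two, hP.2.le]
    _ ≤ ∑ P : Finset (Fin (12 * M)),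
        2 ^ M * ((D.real R / 2) ^ P.card * D.real Rᶜ ^ (12 * M - P.card)) :=
        Finset.sum_le_sum_of_subset_of_nonneg (Finset.filter_subset _ _)
          fun _ _ _ => by positivity
    _ = (2 * (D.real R / 2 + D.real Rᶜ) ^ 12) ^ M := by
        rw [← Finset.mul_sum]
        have := Fintype.sum_pow_mul_eq_add_pow (Fin (12 * M)) (D.real R / 2) (D.real Rᶜ)
        rw [Fintype.card_fin] at this
        rw [this, mul_pow, pow_mul]
    _ ≤ (3 / 4) ^ M := by
        gcongr
        calc 2 * (D.real R / 2 + D.real Rᶜ) ^ 12 ≤ 2 * (11 / 12) ^ 12 := by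
              gcongr; linarith
          _ ≤ 3 / 4 := by norm_num
    _ ≤ Real.exp (-(1 / 4)) ^ M := by
        gcongr
        linarith [Real.add_one_le_exp (-(1 / 4) : ℝ)]
    _ = Real.exp (-(M / 4)) := by
        rw [← Real.exp_nat_mul]; congr 1; ring

variable {Y : Type v} {A : Learner.{u, v, w} X Y} {U : X → Set X} {c : X → Y}

/-- A round of `β`-RoBoost fails with probability at most `exp(-M/4)` because too few examples are
accepted, and otherwise it calls the black box on a sample from the conditional distribution. -/
theorem measure_round_le {hs : List (X → Y)} (hR : MeasurableSet (abstainRegion U hs))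
    (hp : ENNReal.ofReal (1 / 6) ≤ D (abstainRegion U hs)) {M mA : ℕ} (hM : 0 < M)
    (hmA : mA ≤ M) (Bad : Set (X → Y)) :
    A.law.prod (Measure.pi fun _ : Fin (12 * M) => D)
      {p | rejectionSampling U hs M (labelled c p.2) = [] ∨
        A.run p.1 ((rejectionSampling U hs M (labelled c p.2)).take mA) ∈ Bad} ≤
    ENNReal.ofReal (Real.exp (-(M / 4))) +
      A.law.prod (Measure.pi fun _ : Fin mA => D[|abstainRegion U hs])
        {p | learned A c p ∈ Bad} := by
  classical
  set R := abstainRegion U hs with hRdef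
  set E := {p : A.Seed × (Fin (12 * M) → X) | rejectionSampling U hs M (labelled c p.2) = [] ∨
        A.run p.1 ((rejectionSampling U hs M (labelled c p.2)).take mA) ∈ Bad} with hE
  set q := A.law.prod (Measure.pi fun _ : Fin mA => D[|R]) {p | learned A c p ∈ Bad} with hq
  have hlen : ∀ P : Finset (Fin (12 * M)),
      ((List.finRange (12 * M)).filter (· ∈ P)).length = P.card := fun P => by
    rw [← List.toFinset_card_of_nodup ((List.nodup_finRange _).filter _)]
    congr 1; ext i; simp
  -- the outcome of rejection sampling on a stream with pattern `P`
  have hrs : ∀ (P : Finset (Fin (12 * M))) (x : Fin (12 * M) → X), x ∈ pattern R P →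
      rejectionSampling U hs M (labelled c x) =
        (if M ≤ P.card then ((List.finRange (12 * M)).filter (· ∈ P)).take M else []).map
          fun i => (x i, c (x i)) := by
    intro P x hx
    rw [labelled, List.ofFn_eq_map, rejectionSampling_map (pt := x)]
    have h1 : ((List.finRange (12 * M)).filter fun i => decide (x i ∈ abstainRegion U hs)) =
        (List.finRange (12 * M)).filter (· ∈ P) :=
      List.filter_congr fun i _ => decide_eq_decide.2 (hx i)
    rw [h1, hlen]
  have hcase : ∀ P : Finset (Fin (12 * M)), ¬ P.card < M →
      A.law.prod (Measure.pi fun _ => D) {p | p.2 ∈ pattern R P ∧ p ∈ E} ≤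
        Measure.pi (fun _ => D) (pattern R P) * q := by
    intro P hP
    rw [not_lt] at hP
    set l := (((List.finRange (12 * M)).filter (· ∈ P)).take M).take mA with hl
    have hll : l.length = mA := by
      rw [hl, List.length_take, List.length_take, hlen]; omega
    have hnd : l.Nodup :=
      ((((List.nodup_finRange _).filter _).sublist (List.take_sublist _ _)).sublist
        (List.take_sublist _ _))
    have hfi : Function.Injective fun q : Fin mA => l.get (q.cast hll.symm) :=
      (List.nodup_iff_injective_get.1 hnd).comp (Fin.cast_injective _)
    refine le_trans (measure_mono fun p hpE => ?_)
      (measure_pattern_inter_le A.law hR P hfi (fun q => ?_) {p | learned A c p ∈ Bad})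
    · refine ⟨hpE.1, ?_⟩
      have h1 := hrs P p.2 hpE.1
      rw [if_pos hP] at h1
      rcases hpE.2 with h | h
      · rw [h1, List.map_eq_nil_iff] at h
        have := congrArg List.length h
        rw [List.length_take, hlen, List.length_nil] at this
        omega
      · rw [h1, ← List.map_take, ← hl] at h
        have h2 : l.map (fun i => (p.2 i, c (p.2 i))) =
            labelled c fun q : Fin mA => p.2 (l.get (q.cast hll.symm)) := by
          clear_value l
          subst hll
          exact (ofFn_get_eq_map _ l).symm
        rw [h2] at h
        exact h
    · have : l.get (q.cast hll.symm) ∈ (List.finRange (12 * M)).filter (· ∈ P) :=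
        List.mem_of_mem_take (List.mem_of_mem_take (List.get_mem l _))
      simpa using this
  have hcover : E ⊆ ⋃ P : Finset (Fin (12 * M)), {p | p.2 ∈ pattern R P ∧ p ∈ E} := by
    intro p hpE
    refine Set.mem_iUnion.2 ⟨Finset.univ.filter fun i => p.2 i ∈ R, fun i => ?_, hpE⟩
    simp
  calc A.law.prod (Measure.pi fun _ : Fin (12 * M) => D) E
      ≤ ∑ P : Finset (Fin (12 * M)),
          A.law.prod (Measure.pi fun _ => D) {p | p.2 ∈ pattern R P ∧ p ∈ E} :=
        (measure_mono hcover).trans (measure_iUnion_fintype_le _ _)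
    _ ≤ ∑ P : Finset (Fin (12 * M)),
          ((if P.card < M then Measure.pi (fun _ => D) (pattern R P) else 0) +
            Measure.pi (fun _ => D) (pattern R P) * q) := by
        refine Finset.sum_le_sum fun P _ => ?_
        split_ifs with hP
        · refine le_add_right (le_trans (measure_mono (t := Set.univ ×ˢ pattern R P)
            fun p hp => ⟨trivial, hp.1⟩) ?_)
          rw [Measure.prod_prod, measure_univ, one_mul]
        · rw [zero_add]; exact hcase P hP
    _ ≤ _ := by
        rw [Finset.sum_add_distrib, ← Finset.sum_mul, sum_measure_pattern hR, one_mul,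
          ← Finset.sum_filter]
        gcongr
        exact sum_measure_pattern_card_lt_le hR hp M

end Rejection

/-! ### Numerical facts about the parameters of `β`-RoBoost -/

section Numbers

theorem log_six_gt : 1.75 < Real.log 6 := by
  have h : Real.exp 7 < 6 ^ 4 := by
    have := Real.exp_one_lt_d9
    calc Real.exp 7 = Real.exp 1 ^ 7 := by rw [← Real.exp_nat_mul]; norm_num
      _ < 2.7182818286 ^ 7 := by gcongr
      _ < 6 ^ 4 := by norm_num
  have h2 := Real.log_lt_log (Real.exp_pos _) h
  rw [Real.log_exp, Real.log_pow] at h2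
  norm_num at h2 ⊢
  linarith

theorem log_six_lt : Real.log 6 < 1.8 := by
  have h : (6 : ℝ) ^ 5 < Real.exp 9 := by
    have := Real.exp_one_gt_d9
    calc (6 : ℝ) ^ 5 < 2.7182818283 ^ 9 := by norm_num
      _ < Real.exp 1 ^ 9 := by gcongr
      _ = Real.exp 9 := by rw [← Real.exp_nat_mul]; norm_num
  have h2 := Real.log_lt_log (by norm_num) h
  rw [Real.log_exp, Real.log_pow] at h2
  norm_num at h2 ⊢
  linarith

theorem log_five_add_lt : Real.log 5 + 0.18 < Real.log 6 := by
  have h : Real.exp 9 < (6 / 5) ^ 50 := by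
    have := Real.exp_one_lt_d9
    calc Real.exp 9 = Real.exp 1 ^ 9 := by rw [← Real.exp_nat_mul]; norm_num
      _ < 2.7182818286 ^ 9 := by gcongr
      _ < (6 / 5) ^ 50 := by norm_num
  have h2 := Real.log_lt_log (Real.exp_pos _) h
  rw [Real.log_exp, Real.log_pow, Real.log_div (by norm_num) (by norm_num)] at h2
  norm_num at h2 ⊢
  linarith

/-- `⌊ln 6 / β⌋` rounds, each of which shrinks a region by the factor `1 - β`, shrink it by the
factor `1/5`.  Rounding down costs a little of the factor `1/6` that `ln 6 / β` rounds would give: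
for small `β` this is compensated by the quadratic term of the logarithm, and for large `β` the
number of rounds is estimated directly. -/
theorem one_sub_pow_floor_le {β : ℝ} (hβ : 0 < β) (hβ1 : β ≤ 1) :
    (1 - β) ^ ⌊Real.log 6 / β⌋₊ ≤ 1 / 5 := by
  have h6 := log_six_gt
  have hq0 : 0 ≤ 1 - β := by linarith
  have hq1 : 1 - β ≤ 1 := by linarith
  have key : ∀ k : ℕ, k * β ≤ 1.75 → (1 - β) ^ ⌊Real.log 6 / β⌋₊ ≤ (1 - β) ^ k := by
    intro k hk
    refine pow_le_pow_of_le_one hq0 hq1 (Nat.le_floor ?_)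
    rw [le_div_iff₀ hβ]
    linarith
  rcases le_or_gt 0.8 β with h | h
  · refine (key 1 (by norm_num; linarith)).trans ?_
    rw [pow_one]; linarith
  rcases le_or_gt 0.56 β with h1 | h1
  · refine (key 2 (by norm_num; linarith)).trans ?_
    calc (1 - β) ^ 2 ≤ 0.44 ^ 2 := by gcongr; linarith
      _ ≤ 1 / 5 := by norm_num
  rcases le_or_gt 0.45 β with h2 | h2
  · refine (key 3 (by norm_num; linarith)).trans ?_
    calc (1 - β) ^ 3 ≤ 0.55 ^ 3 := by gcongr; linarith
      _ ≤ 1 / 5 := by norm_num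
  set n := ⌊Real.log 6 / β⌋₊ with hn
  have hn1 : Real.log 6 - β < n * β := by
    have := Nat.lt_floor_add_one (Real.log 6 / β)
    rw [div_lt_iff₀ hβ] at this
    linarith
  have hlog : β + β ^ 2 / 2 ≤ -Real.log (1 - β) := by
    have hs := Real.hasSum_pow_div_log_of_abs_lt_one (x := β)
      (by rw [abs_lt]; constructor <;> linarith)
    have := sum_le_hasSum (Finset.range 2) (fun i _ => by positivity) hs
    norm_num [Finset.sum_range_succ] at this
    linarith
  have hpos : 0 < 1 - β := by linarith
  rw [← Real.log_le_log_iff (by positivity) (by norm_num), Real.log_pow, one_div, Real.log_inv]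
  have h5 := log_five_add_lt
  have : n * Real.log (1 - β) ≤ -(n * β * (1 + β / 2)) := by
    have := mul_le_mul_of_nonneg_left hlog (Nat.cast_nonneg (α := ℝ) n)
    nlinarith
  nlinarith

theorem roBoostT_third (β : ℝ) : roBoostT β (1 / 3) = Real.log 6 / β := by
  norm_num [roBoostT]

theorem roBoostBudget_third (β δ : ℝ) (mA : ℕ) :
    roBoostBudget β (1 / 3) δ mA = 12 * roBoostM β (1 / 3) δ mA := by
  rw [roBoostBudget, show 4 * (roBoostM β (1 / 3) δ mA : ℝ) / (1 / 3) =
    ((12 * roBoostM β (1 / 3) δ mA : ℕ) : ℝ) by push_cast; ring, Nat.floor_natCast]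

theorem roBoostM_third_ge (β : ℝ) (mA : ℕ) :
    4 * Real.log (6 * Real.log 6 / β) ≤ roBoostM β (1 / 3) (1 / 3) mA := by
  have : 2 * roBoostT β (1 / 3) / (1 / 3) = 6 * Real.log 6 / β := by rw [roBoostT_third]; ring
  rw [roBoostM, this]
  push_cast
  exact le_max_of_le_right (Nat.le_ceil _)

theorem le_roBoostM (β ε δ : ℝ) (mA : ℕ) : mA ≤ roBoostM β ε δ mA := le_max_left _ _

theorem two_lt_log_base {β : ℝ} (hβ : 0 < β) (hβ1 : β ≤ 1) : 2 < Real.log (6 * Real.log 6 / β) := by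
  rw [Real.lt_log_iff_exp_lt (by have := log_six_gt; positivity)]
  have h1 : Real.exp 2 < 10 := by
    have := Real.exp_one_lt_d9
    calc Real.exp 2 = Real.exp 1 ^ 2 := by rw [← Real.exp_nat_mul]; norm_num
      _ < 2.7182818286 ^ 2 := by gcongr
      _ < 10 := by norm_num
  refine h1.trans_le ?_
  rw [le_div_iff₀ hβ]
  have := log_six_gt
  nlinarith

theorem roBoostM_third_pos {β : ℝ} (hβ : 0 < β) (hβ1 : β ≤ 1) (mA : ℕ) :
    0 < roBoostM β (1 / 3) (1 / 3) mA := by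
  have h1 := roBoostM_third_ge β mA
  have h2 := two_lt_log_base hβ hβ1
  have : (0 : ℝ) < roBoostM β (1 / 3) (1 / 3) mA := by linarith
  exact_mod_cast this

theorem exp_neg_roBoostM_le {β : ℝ} (hβ : 0 < β) (mA : ℕ) :
    Real.exp (-(roBoostM β (1 / 3) (1 / 3) mA / 4)) ≤ β / (6 * Real.log 6) := by
  have h6 := log_six_gt
  have h1 := roBoostM_third_ge β mA
  rw [← inv_div (6 * Real.log 6) β, Real.exp_neg]
  refine inv_anti₀ (by positivity) ?_
  rw [← Real.log_le_iff_le_exp (by positivity)]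
  linarith

end Numbers

/-! ### `β`-RoBoost is a weak robust learner -/

section RoBoostAnalysis

open ProbabilityTheory

variable {X : Type u} {Y : Type v} [MeasurableSpace X] {A : Learner.{u, v, w} X Y}
  {U : X → Set X} {c : X → Y} {y₀ : Y} {mA : ℕ}

theorem measurable_measureReal_section {Ω : Type*} [MeasurableSpace Ω] (D : Measure X)
    [IsProbabilityMeasure D] {E : Ω → Set X} (hE : MeasurableSet {p : Ω × X | p.2 ∈ E p.1}) :
    Measurable fun ω => D.real (E ω) :=
  (measurable_measure_prodMk_left hE).ennreal_toReal

/-- The codes of the predictors in the cascade that `β`-RoBoost returns. -/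
theorem exists_codes_roBoost {Ω τ ι : Type*} [MeasurableSpace Ω] [Countable τ] [Countable ι]
    (hM : MeasurableEvents A U c y₀ mA) {sd : τ → Ω → A.Seed} {pt : ι → Ω → X}
    (hsd : ∀ t, Measurable (sd t)) (hpt : ∀ i, Measurable (pt i)) (β ε δ : ℝ)
    (ts : Fin ⌊roBoostT β ε⌋₊ → τ) {I : Ω → List ι} (hI : DMeasurable I) :
    ∃ L : Ω → List (τ × (Fin mA → ι)), DMeasurable L ∧
      (∀ ω, (L ω).length ≤ ⌊roBoostT β ε⌋₊) ∧
      ∀ ω, (roBoost y₀ U β ε δ mA A).run (fun j => sd (ts j) ω)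
        ((I ω).map fun i => (pt i ω, c (pt i ω))) =
          cascade y₀ U (decoded A c (seedSample sd pt) (L ω) ω) := by
  obtain ⟨L, hL, hlen, hLeq⟩ := exists_codes_roBoostRounds hM hsd hpt (le_roBoostM β ε δ mA)
    (roBoostBudget β ε δ mA) (List.ofFn ts) hI (DMeasurable.const [])
  refine ⟨L, hL, fun ω => by simpa using hlen ω, fun ω => ?_⟩
  rw [← hLeq ω, List.map_ofFn]
  rfl

/-- A predictor that does not make the progress expected of a round that starts from the cascade
`hs`, measured on the region where `hs` can be forced to abstain: it is not robust on a fraction `β`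
of this region, or it errs on more than a fraction `β/6` of it. -/
def badNext (D : Measure X) (U : X → Set X) (c : X → Y) (β : ℝ) (hs : List (X → Y)) :
    Set (X → Y) :=
  {h | ¬ (D.real (abstainRegion U (hs ++ [h])) ≤ (1 - β) * D.real (abstainRegion U hs) ∧
    D.real (abstainRegion U hs ∩ {x | h x ≠ c x}) ≤ β / 6 * D.real (abstainRegion U hs))}

/-- The black box, called on a sample from the conditional distribution on the abstention region,
makes the expected progress. -/
theorem measure_badNext_le (hM : MeasurableEvents A U c y₀ mA) {β : ℝ} (hβ : 0 < β)
    {ε' : ℝ} (hA : BarelyRobustlyLearns A U c β (β / 6) ε' mA)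
    (D : Measure X) [IsProbabilityMeasure D] (hD : Realizable U c D) {hs : List (X → Y)}
    (hR : MeasurableSet (abstainRegion U hs)) (hp : 0 < D (abstainRegion U hs)) :
    A.law.prod (Measure.pi fun _ : Fin mA => D[|abstainRegion U hs])
      {p | learned A c p ∈ badNext D U c β hs} ≤ ENNReal.ofReal ε' := by
  set R := abstainRegion U hs with hRdef
  have : IsProbabilityMeasure (D[|R]) := cond_isProbabilityMeasure hp.ne'
  refine le_trans (measure_mono fun p hbad => ?_) (hA (D[|R]) (cond_absolutelyContinuous hD))
  rw [Set.mem_ofPred_eq]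
  intro hgood
  refine hbad ?_
  change ENNReal.ofReal β ≤ D[|R] (robustRegion (invComp U) (learned A c p)) ∧
    D[|R] {x | learned A c p x ≠ c x} ≤ ENNReal.ofReal (β / 6) at hgood
  have hRpos : 0 < D.real R := by
    exact ENNReal.toReal_pos hp.ne' (measure_ne_top _ _)
  have hcond : ∀ E : Set X, (D[|R]).real E = (D.real R)⁻¹ * D.real (R ∩ E) :=
    fun E => by
      rw [Measure.real, cond_apply hR, ENNReal.toReal_mul, ENNReal.toReal_inv]; rfl
  obtain ⟨h1, h2⟩ := hgood
  have hrob : MeasurableSet (robustRegion (invComp U) (learned A c p)) :=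
    hM.mem_robustRegion (Ω := X) (p := fun _ => p) measurable_const measurable_id
  constructor
  · rw [abstainRegion_concat, ← hRdef]
    have h3 : β ≤ (D[|R]).real (robustRegion (invComp U) (learned A c p)) :=
      (ENNReal.ofReal_le_iff_le_toReal (measure_ne_top _ _)).1 h1
    have h4 : (D[|R]).real (robustRegion (invComp U) (learned A c p))ᶜ ≤ 1 - β := by
      rw [probReal_compl_eq_one_sub hrob]; linarith
    rw [hcond, inv_mul_le_iff₀ hRpos] at h4
    linarith
  · have h3 : (D[|R]).real {x | learned A c p x ≠ c x} ≤ β / 6 :=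
      ENNReal.toReal_le_of_le_ofReal (by positivity) h2
    rw [hcond, inv_mul_le_iff₀ hRpos] at h3
    linarith

variable {n b : ℕ}

omit [MeasurableSpace X] in
theorem labelled_blocks (c : X → Y) (x : Fin n → Fin b → X) :
    labelled c (fun p : Fin (n * b) => x p.divNat p.modNat) =
      (List.ofFn fun i => labelled c (x i)).flatten := by
  have key : ∀ (i : Fin n) (q : Fin b) (h : (i : ℕ) * b + q < n * b),
      (⟨i * b + q, h⟩ : Fin (n * b)).divNat = i ∧ (⟨i * b + q, h⟩ : Fin (n * b)).modNat = q := by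
    intro i q h
    constructor
    · ext
      simp only [Fin.coe_divNat]
      rw [mul_comm, Nat.mul_add_div (by have := q.2; omega), Nat.div_eq_of_lt q.2, add_zero]
    · ext
      simp only [Fin.coe_modNat]
      rw [mul_comm, Nat.mul_add_mod, Nat.mod_eq_of_lt q.2]
  rw [labelled, List.ofFn_mul]
  congr 2
  funext i
  rw [labelled]
  congr 1
  funext q
  rw [(key i q _).1, (key i q _).2]

/-- The predictors found in the rounds `js`, when round `j` reads the seed and the block of draws
`z j`. -/
noncomputable def history (A : Learner.{u, v, w} X Y) (U : X → Set X) (c : X → Y) (mA M : ℕ)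
    (js : List (Fin n)) (z : Fin n → A.Seed × (Fin b → X)) : List (X → Y) :=
  roBoostRounds A U mA M b (js.map fun i => (z i).1)
    (js.map fun i => labelled c (z i).2).flatten []

omit [MeasurableSpace X] in
open Classical in
theorem history_concat (M : ℕ) (js : List (Fin n)) (j : Fin n) (z : Fin n → A.Seed × (Fin b → X)) :
    history A U c mA M (js ++ [j]) z =
      let H := history A U c mA M js z
      if H.length = js.length ∧ rejectionSampling U H M (labelled c (z j).2) ≠ [] then
        H ++ [A.run (z j).1 ((rejectionSampling U H M (labelled c (z j).2)).take mA)]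
      else H := by
  have h := roBoostRounds_concat (A := A) (U := U) (mA := mA) (m := M) (b := b)
    (js.map fun i => (z i).1) (z j).1 (js.map fun i => labelled c (z i).2).flatten
    (labelled c (z j).2) (by simp [labelled, Function.comp_def]) (by simp [labelled]) []
  simp only [List.length_nil, zero_add, List.length_map] at h
  rw [history, List.map_append, List.map_append, List.flatten_append]
  simp only [List.map_cons, List.map_nil, List.flatten_cons, List.flatten_nil, List.append_nil]
  exact h

omit [MeasurableSpace X] in
theorem history_congr (M : ℕ) {js : List (Fin n)} {z z' : Fin n → A.Seed × (Fin b → X)}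
    (h : ∀ j ∈ js, z j = z' j) : history A U c mA M js z = history A U c mA M js z' := by
  unfold history
  rw [List.map_congr_left fun j hj => congrArg Prod.fst (h j hj),
    List.map_congr_left fun j hj => congrArg (fun p => labelled c p.2) (h j hj)]

theorem exists_codes_history (hM : MeasurableEvents A U c y₀ mA) {M : ℕ} (hmA : mA ≤ M)
    (js : List (Fin n)) :
    ∃ L : (Fin n → A.Seed × (Fin b → X)) → List (Fin n × (Fin mA → Fin n × Fin b)),
      DMeasurable L ∧ ∀ z, history A U c mA M js z =
        decoded A c (seedSample (fun i z => (z i).1) fun i z => (z i.1).2 i.2) (L z) z := by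
  obtain ⟨L, hL, -, hLeq⟩ := exists_codes_roBoostRounds (ι := Fin n × Fin b)
    (Ω := Fin n → A.Seed × (Fin b → X)) hM
    (sd := fun i z => (z i).1) (pt := fun i z => (z i.1).2 i.2) (by fun_prop) (by fun_prop) hmA b
    js (I := fun _ => js.flatMap fun i => (List.finRange b).map fun q => (i, q))
    (DMeasurable.const _) (DMeasurable.const [])
  refine ⟨L, hL, fun z => (Eq.trans ?_ (hLeq z))⟩
  simp [history, decoded, List.flatMap, List.map_flatten, List.map_map, Function.comp_def, labelled,
    List.ofFn_eq_map]

/-- The event that round `j`, which follows the rounds `js`, takes place while the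
abstention region has mass at least `1/6`, but ends without the expected progress. -/
def badRound (A : Learner.{u, v, w} X Y) (U : X → Set X) (c : X → Y) (mA M : ℕ) (D : Measure X)
    (β : ℝ) (js : List (Fin n)) (j : Fin n) : Set (Fin n → A.Seed × (Fin b → X)) :=
  {z | (history A U c mA M js z).length = js.length ∧
    1 / 6 ≤ D.real (abstainRegion U (history A U c mA M js z)) ∧
    ((history A U c mA M (js ++ [j]) z).length = js.length ∨
      ∃ h ∈ (history A U c mA M (js ++ [j]) z).getLast?,
        h ∈ badNext D U c β (history A U c mA M js z))}

theorem measurableSet_badRound (hM : MeasurableEvents A U c y₀ mA) {M : ℕ} (hmA : mA ≤ M)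
    (D : Measure X) [IsProbabilityMeasure D] (β : ℝ) (js : List (Fin n)) (j : Fin n) :
    MeasurableSet (badRound (b := b) A U c mA M D β js j) := by
  obtain ⟨L, hL, hLeq⟩ := exists_codes_history (b := b) hM hmA js
  obtain ⟨L', hL', hL'eq⟩ := exists_codes_history (b := b) hM hmA (js ++ [j])
  set dec := seedSample (A := A) (k := mA)
    (fun (i : Fin n) (z : Fin n → A.Seed × (Fin b → X)) => (z i).1)
    fun (i : Fin n × Fin b) z => (z i.1).2 i.2 with hdecdef
  have hdec : ∀ a, Measurable (dec a) := measurable_seedSample (by fun_prop) (by fun_prop)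
  have hR : ∀ l, Measurable fun z => D.real (abstainRegion U (decoded A c dec l z)) := fun l =>
    measurable_measureReal_section D (hM.mem_abstainRegion
      (dec := fun a (p : (Fin n → A.Seed × (Fin b → X)) × X) => dec a p.1)
      (fun a => (hdec a).comp measurable_fst) measurable_snd l)
  have hne : ∀ l a, Measurable fun z => D.real (abstainRegion U (decoded A c dec l z) ∩
      {x | learned A c (dec a z) x ≠ c x}) := fun l a =>
    measurable_measureReal_section D ((hM.mem_abstainRegion
      (dec := fun a (p : (Fin n → A.Seed × (Fin b → X)) × X) => dec a p.1)
      (fun a => (hdec a).comp measurable_fst) measurable_snd l).inter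
        (hM.learned_ne (p := fun p : (Fin n → A.Seed × (Fin b → X)) × X => dec a p.1)
          ((hdec a).comp measurable_fst) measurable_snd))
  have hbad : ∀ l a, MeasurableSet {z | learned A c (dec a z) ∈
      badNext D U c β (decoded A c dec l z)} := by
    intro l a
    refine MeasurableSet.compl (MeasurableSet.inter (measurableSet_le ?_ ((hR l).const_mul _))
      (measurableSet_le (hne l a) ((hR l).const_mul _)))
    have := hR (l ++ [a])
    simp only [decoded_append] at this
    exact this
  have hset : badRound (b := b) A U c mA M D β js j = {z | (L z).length = js.length ∧
      1 / 6 ≤ D.real (abstainRegion U (decoded A c dec (L z) z)) ∧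
      ((L' z).length = js.length ∨
        ∃ a ∈ (L' z).getLast?,
          learned A c (dec a z) ∈ badNext D U c β (decoded A c dec (L z) z))} := by
    ext z
    simp only [badRound, Set.mem_ofPred_eq, hLeq, hL'eq, decoded, List.length_map,
      List.getLast?_map, Option.mem_map, exists_exists_and_eq_and]
  rw [hset]
  refine hL.measurableSet_bind (p := fun l z => l.length = js.length ∧
      1 / 6 ≤ D.real (abstainRegion U (decoded A c dec l z)) ∧
      ((L' z).length = js.length ∨
        ∃ a ∈ (L' z).getLast?, learned A c (dec a z) ∈ badNext D U c β (decoded A c dec l z)))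
    fun l => ?_
  refine hL'.measurableSet_bind (p := fun l' z => l.length = js.length ∧
      1 / 6 ≤ D.real (abstainRegion U (decoded A c dec l z)) ∧
      (l'.length = js.length ∨
        ∃ a ∈ l'.getLast?, learned A c (dec a z) ∈ badNext D U c β (decoded A c dec l z)))
    fun l' => ?_
  refine (MeasurableSet.const _).inter ((measurableSet_le measurable_const (hR l)).inter
    ((MeasurableSet.const _).union ?_))
  cases hl : l'.getLast? with
  | none =>
    simp only [Option.mem_def, reduceCtorEq, false_and, exists_false]
    exact MeasurableSet.const False
  | some a =>
    simp only [Option.mem_def, Option.some.injEq, exists_eq_left']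
    exact hbad l a

theorem measure_badRound_le (hM : MeasurableEvents A U c y₀ mA) {β : ℝ} (hβ : 0 < β) {ε' : ℝ}
    (hA : BarelyRobustlyLearns A U c β (β / 6) ε' mA) {M : ℕ} (hM0 : 0 < M) (hmA : mA ≤ M)
    (D : Measure X) [IsProbabilityMeasure D] (hD : Realizable U c D)
    {js : List (Fin n)} {j : Fin n} (hj : j ∉ js) :
    Measure.pi (fun _ : Fin n => A.law.prod (Measure.pi fun _ : Fin (12 * M) => D))
      (badRound A U c mA M D β js j) ≤
        ENNReal.ofReal (Real.exp (-(M / 4))) + ENNReal.ofReal ε' := by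
  classical
  refine pi_le_of_update j (measurableSet_badRound hM hmA D β js j) fun z => ?_
  set H := history A U c mA M js z with hH
  have hupd : ∀ y, history A U c mA M js (Function.update z j y) = H := fun y =>
    history_congr M fun i hi => Function.update_of_ne (by rintro rfl; exact hj hi) _ _
  by_cases hp : 1 / 6 ≤ D.real (abstainRegion U H)
  swap
  · refine le_trans (le_of_eq ?_) zero_le
    convert measure_empty
    · ext y
      simp only [badRound, Set.mem_ofPred_eq, hupd, hp, false_and, and_false]
      exact Iff.rfl
    · infer_instance
  have hp' : ENNReal.ofReal (1 / 6) ≤ D (abstainRegion U H) :=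
    (ENNReal.ofReal_le_iff_le_toReal (measure_ne_top _ _)).2 hp
  have hRm : MeasurableSet (abstainRegion U H) := by
    obtain ⟨L, -, hLeq⟩ := exists_codes_history (b := 12 * M) hM hmA js
    rw [hH, hLeq z]
    exact hM.mem_abstainRegion (Ω := X) (x := id) (dec := fun a _ => seedSample _ _ a z)
      (fun _ => measurable_const) measurable_id (L z)
  refine le_trans (measure_mono ?_) ((measure_round_le (A := A) (c := c) hRm hp' hM0 hmA
    (badNext D U c β H)).trans ?_)
  · rintro y ⟨h1, -, h3⟩
    rw [history_concat] at h3
    simp only [hupd] at h1 h3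
    by_cases hr : rejectionSampling U H M (labelled c y.2) = []
    · exact Or.inl hr
    · rw [Function.update_self, if_pos ⟨h1, hr⟩] at h3
      right
      rcases h3 with h3 | ⟨h, hh, hbad⟩
      · simp only [List.length_append, List.length_cons, List.length_nil] at h3
        omega
      · simp only [List.getLast?_append, List.getLast?_singleton, Option.some_or,
          Option.mem_some_iff] at hh
        exact hh ▸ hbad
  · gcongr
    refine measure_badNext_le hM hβ hA D hD hRm (lt_of_lt_of_le ?_ hp')
    simp

/-- If no round is bad, the final cascade has robust error at most `1/3`: either the abstention
region falls below `1/6` early, or both kinds of errors add up to `1/5 + (1 - 1/5) / 6 = 1/3`. -/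
theorem measureReal_history_le {β : ℝ} (hβ : 0 < β) (hβ1 : β ≤ 1) {M : ℕ}
    (D : Measure X) [IsProbabilityMeasure D] (hn : (1 - β) ^ n ≤ 1 / 5)
    (z : Fin n → A.Seed × (Fin b → X))
    (hz : ∀ t (ht : t < n), z ∉ badRound A U c mA M D β ((List.finRange n).take t) ⟨t, ht⟩) :
    D.real (abstainRegion U (history A U c mA M (List.finRange n) z) ∪
      firstErrors U c (history A U c mA M (List.finRange n) z)) ≤ 1 / 3 := by
  classical
  have hq0 : 0 ≤ 1 - β := by linarith
  -- either the goal is reached early, or mass and error have developed as they should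
  have key : ∀ t ≤ n, ∀ H, H = history A U c mA M ((List.finRange n).take t) z →
      D.real (abstainRegion U H ∪ firstErrors U c H) ≤ 1 / 3 ∨
      (H.length = t ∧ D.real (abstainRegion U H) ≤ (1 - β) ^ t ∧
        D.real (firstErrors U c H) ≤ (1 - (1 - β) ^ t) / 6) := by
    intro t
    induction t with
    | zero =>
      rintro - H rfl
      right
      have : firstErrors U c ([] : List (X → Y)) = ∅ := by
        ext x; simp [firstErrors]
      simp [history, roBoostRounds, this, measureReal_le_one]
    | succ t ih =>
      intro ht H' hH'
      have htn : t < n := ht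
      have htake : (List.finRange n).take (t + 1) = (List.finRange n).take t ++ [⟨t, htn⟩] := by
        rw [List.take_add_one, List.getElem?_eq_getElem (by simpa using htn)]
        simp
      have hlent : ((List.finRange n).take t).length = t := by simp; omega
      have hzt := hz t htn
      simp only [badRound, Set.mem_ofPred_eq, ← htake, ← hH'] at hzt
      obtain ⟨H, hH⟩ : ∃ H, H = history A U c mA M ((List.finRange n).take t) z := ⟨_, rfl⟩
      have hcc := history_concat (U := U) (c := c) (mA := mA) M
        ((List.finRange n).take t) ⟨t, htn⟩ z
      rw [← htake, ← hH'] at hcc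
      simp only [← hH, hlent] at hcc hzt
      rcases ih htn.le H hH with h | ⟨hl, hR, hW⟩
      · left
        refine le_trans ?_ h
        split_ifs at hcc
        · rw [hcc]
          exact measureReal_mono (abstain_union_firstErrors_concat_subset c H _)
        · rw [hcc]
      by_cases hp : 1 / 6 ≤ D.real (abstainRegion U H)
      swap
      · left
        have : D.real (abstainRegion U H ∪ firstErrors U c H) ≤ 1 / 3 := by
          refine (measureReal_union_le _ _).trans ?_
          have : 0 ≤ (1 - β) ^ t := by positivity
          linarith
        refine le_trans ?_ this
        split_ifs at hcc
        · rw [hcc]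
          exact measureReal_mono (abstain_union_firstErrors_concat_subset c H _)
        · rw [hcc]
      right
      by_cases hr : rejectionSampling U H M (labelled c (z ⟨t, htn⟩).2) = []
      · rw [if_neg (by simp [hr])] at hcc
        exact absurd ⟨hl, hp, Or.inl (hcc ▸ hl)⟩ hzt
      rw [if_pos ⟨hl, hr⟩] at hcc
      set h := A.run (z ⟨t, htn⟩).1
        ((rejectionSampling U H M (labelled c (z ⟨t, htn⟩).2)).take mA) with hh
      have hgood : h ∉ badNext D U c β H := fun hbad =>
        hzt ⟨hl, hp, Or.inr ⟨h, by rw [hcc]; simp, hbad⟩⟩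
      simp only [badNext, Set.mem_ofPred_eq, not_not] at hgood
      refine ⟨by rw [hcc]; simp [hl], ?_, ?_⟩
      · rw [hcc, pow_succ, mul_comm]
        exact hgood.1.trans (by gcongr)
      · rw [hcc]
        have h1 := measureReal_mono (μ := D) (firstErrors_concat_subset (U := U) c H h)
        have h2 := measureReal_union_le (μ := D) (firstErrors U c H)
          (abstainRegion U H ∩ {x | h x ≠ c x})
        have h3 : β / 6 * D.real (abstainRegion U H) ≤ β / 6 * (1 - β) ^ t := by gcongr
        have h4 : (1 - β) ^ (t + 1) = (1 - β) ^ t - β * (1 - β) ^ t := by ring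
        rw [h4]
        linarith [hgood.2]
  have hfull : (List.finRange n).take n = List.finRange n :=
    List.take_of_length_le (by simp)
  rcases key n le_rfl _ rfl with h | ⟨-, hR, hW⟩
  · rwa [hfull] at h
  · rw [hfull] at hR hW
    refine (measureReal_union_le _ _).trans ?_
    linarith

/-- `β`-RoBoost turns a barely robust learner into a robust learner with error and failure
probability `1/3`. -/
theorem robustlyLearns_roBoost (hM : MeasurableEvents A U c y₀ mA) {β : ℝ} (hβ : 0 < β)
    (hβ1 : β ≤ 1) (hA : BarelyRobustlyLearns A U c β (β / 6) (β / (6 * Real.log 6)) mA) :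
    RobustlyLearns (roBoost y₀ U β (1 / 3) (1 / 3) mA A).toLearner U c (1 / 3) (1 / 3)
      (roBoostSampleSize β (1 / 3) (1 / 3) mA) := by
  intro D _ hD
  set n := ⌊roBoostT β (1 / 3)⌋₊ with hn
  set M := roBoostM β (1 / 3) (1 / 3) mA with hMdef
  have hb : roBoostBudget β (1 / 3) (1 / 3) mA = 12 * M := roBoostBudget_third _ _ _
  have hk : roBoostSampleSize β (1 / 3) (1 / 3) mA = n * (12 * M) := by
    rw [roBoostSampleSize, hb]
  have hlog6 := log_six_gt
  rw [hk]
  set ν := A.law.prod (Measure.pi fun _ : Fin (12 * M) => D) with hν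
  have hmp : MeasurePreserving (fun z : Fin n → A.Seed × (Fin (12 * M) → X) =>
      ((fun i => (z i).1, fun p : Fin (n * (12 * M)) => (z p.divNat).2 p.modNat) :
        (Fin n → A.Seed) × (Fin (n * (12 * M)) → X)))
      (Measure.pi fun _ => ν)
      ((Measure.pi fun _ => A.law).prod (Measure.pi fun _ => D)) :=
    ((MeasurePreserving.id _).prod (measurePreserving_blocks D n (12 * M))).comp
      (measurePreserving_arrowProdEquivProdArrow A.Seed (Fin (12 * M) → X) (Fin n)
        (fun _ => A.law) fun _ => Measure.pi fun _ => D)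
  have hF : MeasurableSet {p : (Fin n → A.Seed) × (Fin (n * (12 * M)) → X) |
      ¬ (D (robustErrorSet U c ((roBoost y₀ U β (1 / 3) (1 / 3) mA A).run p.1 (labelled c p.2))) ≤
        ENNReal.ofReal (1 / 3))} := by
    obtain ⟨L, hL, -, hLeq⟩ := exists_codes_roBoost (y₀ := y₀) (τ := Fin n)
      (ι := Fin (n * (12 * M)))
      (Ω := (Fin n → A.Seed) × (Fin (n * (12 * M)) → X)) hM (sd := fun i p => p.1 i)
      (pt := fun i p => p.2 i) (by fun_prop) (by fun_prop) β (1 / 3) (1 / 3) id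
      (I := fun _ => List.finRange _) (DMeasurable.const _)
    have hrun : ∀ p : (Fin n → A.Seed) × (Fin (n * (12 * M)) → X),
        (roBoost y₀ U β (1 / 3) (1 / 3) mA A).run p.1 (labelled c p.2) = cascade y₀ U
          (decoded A c (seedSample (fun i p => p.1 i) fun i p => p.2 i) (L p) p) := by
      intro p
      rw [← hLeq p, labelled, List.ofFn_eq_map]
      rfl
    simp_rw [hrun]
    refine MeasurableSet.compl (hL.measurableSet_bind (p := fun l p => D (robustErrorSet U c
      (cascade y₀ U (decoded A c (seedSample (fun i p => p.1 i) fun i p => p.2 i) l p))) ≤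
        ENNReal.ofReal (1 / 3)) fun l => ?_)
    refine measurableSet_le (measurable_measure_prodMk_left
      (hM.mem_robustErrorSet_cascade (Ω := ((Fin n → A.Seed) × (Fin (n * (12 * M)) → X)) × X)
        (dec := fun a p => seedSample (fun i p => p.1 i) (fun i p => p.2 i) a p.1)
        (fun a => (measurable_seedSample (by fun_prop) (by fun_prop) a).comp measurable_fst)
        measurable_snd l)) measurable_const
  change (Measure.pi fun _ => A.law).prod (Measure.pi fun _ => D) _ ≤ _
  refine (hmp.measure_preimage hF.nullMeasurableSet).symm.le.trans ?_
  have hcover : (fun z : Fin n → A.Seed × (Fin (12 * M) → X) =>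
      ((fun i => (z i).1, fun p : Fin (n * (12 * M)) => (z p.divNat).2 p.modNat) :
        (Fin n → A.Seed) × (Fin (n * (12 * M)) → X))) ⁻¹'
      {p : (Fin n → A.Seed) × (Fin (n * (12 * M)) → X) |
      ¬ (D (robustErrorSet U c ((roBoost y₀ U β (1 / 3) (1 / 3) mA A).run p.1 (labelled c p.2))) ≤
        ENNReal.ofReal (1 / 3))} ⊆
      ⋃ t : Fin n, badRound A U c mA M D β ((List.finRange n).take t) t := by
    intro z hz
    by_contra hnot
    simp only [Set.mem_iUnion, not_exists] at hnot
    refine hz ?_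
    have h1 := measureReal_history_le (M := M) (mA := mA) (A := A) (U := U) (c := c) hβ hβ1 D
      (n := n) (by rw [hn, roBoostT_third]; exact one_sub_pow_floor_le hβ hβ1) z
      fun t ht => hnot ⟨t, ht⟩
    have h2 : D (robustErrorSet U c (cascade y₀ U (history A U c mA M (List.finRange n) z))) ≤
        ENNReal.ofReal (1 / 3) := by
      rw [ENNReal.le_ofReal_iff_toReal_le (measure_ne_top _ _) (by norm_num)]
      exact (measureReal_mono (robustErrorSet_cascade_subset y₀ c _)).trans h1
    have h3 : (roBoost y₀ U β (1 / 3) (1 / 3) mA A).run (fun i => (z i).1)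
        (labelled c fun p : Fin (n * (12 * M)) => (z p.divNat).2 p.modNat) =
        cascade y₀ U (history A U c mA M (List.finRange n) z) := by
      change cascade y₀ U (roBoostRounds A U mA M (roBoostBudget β (1 / 3) (1 / 3) mA)
        (List.ofFn fun i => (z i).1) _ []) = _
      rw [hb, history, List.ofFn_eq_map]
      congr 3
      rw [← List.ofFn_eq_map]
      exact labelled_blocks c fun i q => (z i).2 q
    exact h3 ▸ h2
  have hround : ∀ t : Fin n, Measure.pi (fun _ => ν)
      (badRound A U c mA M D β ((List.finRange n).take t) t) ≤
        ENNReal.ofReal (2 * (β / (6 * Real.log 6))) := by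
    intro t
    refine (measure_badRound_le hM hβ hA (roBoostM_third_pos hβ hβ1 mA) (le_roBoostM _ _ _ _)
      D hD ?_).trans ?_
    · intro hmem
      obtain ⟨i, hi, he⟩ := List.mem_take_iff_getElem.1 hmem
      have : i = t := by simpa using congrArg Fin.val he
      omega
    · rw [← ENNReal.ofReal_add (Real.exp_nonneg _) (by positivity)]
      refine ENNReal.ofReal_le_ofReal ?_
      linarith [exp_neg_roBoostM_le hβ mA]
  refine (measure_mono hcover).trans ((measure_iUnion_fintype_le _ _).trans
    ((Finset.sum_le_sum fun t _ => hround t).trans ?_))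
  rw [Finset.sum_const, Finset.card_univ, Fintype.card_fin, nsmul_eq_mul,
    ← ENNReal.ofReal_natCast, ← ENNReal.ofReal_mul (Nat.cast_nonneg _)]
  refine ENNReal.ofReal_le_ofReal ?_
  have hnle : (n : ℝ) ≤ Real.log 6 / β := by
    rw [hn, roBoostT_third]
    exact Nat.floor_le (by positivity)
  calc (n : ℝ) * (2 * (β / (6 * Real.log 6)))
      ≤ Real.log 6 / β * (2 * (β / (6 * Real.log 6))) := by gcongr
    _ = 1 / 3 := by field_simp; norm_num

end RoBoostAnalysis

/-! ### Boosting by majority of weak hypotheses -/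

section Boosting

variable {X : Type u} {Y : Type v} {U : X → Set X} {S : List (X × Y)}

/-- The weights after reweighting for each predictor of a list. -/
noncomputable def weightsAfter (U : X → Set X) (S : List (X × Y)) (w : Fin S.length → ℝ)
    (hs : List (X → Y)) : Fin S.length → ℝ :=
  hs.foldl (reweight U S) w

/-- Each predictor of the list has risk at most `1/3` under the weights of its round. -/
def WeakSequence (U : X → Set X) (S : List (X × Y)) : (Fin S.length → ℝ) → List (X → Y) → Prop
  | _, [] => True
  | w, h :: hs => weightedRisk U S w h ≤ 1 / 3 ∧ WeakSequence U S (reweight U S w h) hs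

theorem weakSequence_concat (w : Fin S.length → ℝ) (hs : List (X → Y)) (h : X → Y) :
    WeakSequence U S w (hs ++ [h]) ↔
      WeakSequence U S w hs ∧ weightedRisk U S (weightsAfter U S w hs) h ≤ 1 / 3 := by
  induction hs generalizing w with
  | nil => simp [WeakSequence, weightsAfter]
  | cons g hs ih => simp [WeakSequence, weightsAfter, ih, and_assoc]

theorem exp_neg_quarter_le : 1 / 3 + 2 / 3 * Real.exp (-2 * (1 / 8)) ≤ Real.exp (-(3 / 20)) := by
  have h1 : Real.exp (-2 * (1 / 8)) ≤ 0.781 := by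
    have h := Real.quadratic_le_exp_of_nonneg (x := 1 / 4) (by norm_num)
    rw [show (-2 * (1 / 8) : ℝ) = -(1 / 4) by norm_num, Real.exp_neg]
    refine (inv_anti₀ (by norm_num) h).trans (by norm_num)
  have h2 : (0.925 : ℝ) ^ 2 ≤ Real.exp (-(3 / 20)) := by
    rw [show (-(3 / 20) : ℝ) = (2 : ℕ) * (-0.075) by norm_num, Real.exp_nat_mul]
    have := Real.add_one_le_exp (-0.075 : ℝ)
    gcongr
    linarith
  norm_num at h2 ⊢
  linarith

section Weights

variable {w : Fin S.length → ℝ} {h : X → Y}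

open Classical in
/-- The normalizing factor of the reweighting step. -/
theorem sum_reweight_eq (hw1 : ∑ i, w i = 1) :
    ∑ i, w i * (if RobustlyCorrect U h (S.get i) then Real.exp (-2 * (1 / 8)) else 1) =
      weightedRisk U S w h + Real.exp (-2 * (1 / 8)) * (1 - weightedRisk U S w h) := by
  rw [show (1 : ℝ) - weightedRisk U S w h = ∑ i, w i - weightedRisk U S w h by rw [hw1],
    weightedRisk, ← Finset.sum_sub_distrib, Finset.mul_sum, ← Finset.sum_add_distrib]
  refine Finset.sum_congr rfl fun i _ => ?_
  split_ifs <;> ring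

open Classical in
theorem sum_reweight_pos (hw : ∀ i, 0 < w i) (hw1 : ∑ i, w i = 1) :
    0 < ∑ i, w i * (if RobustlyCorrect U h (S.get i) then Real.exp (-2 * (1 / 8)) else 1) := by
  have hne : (Finset.univ : Finset (Fin S.length)).Nonempty := by
    by_contra hne
    rw [Finset.not_nonempty_iff_eq_empty] at hne
    rw [hne, Finset.sum_empty] at hw1
    exact zero_ne_one hw1
  refine Finset.sum_pos (fun i _ => mul_pos (hw i) ?_) hne
  split_ifs <;> positivity

theorem reweight_pos (hw : ∀ i, 0 < w i) (hw1 : ∑ i, w i = 1) (i : Fin S.length) :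
    0 < reweight U S w h i := by
  classical
  refine div_pos (mul_pos (hw i) ?_) (sum_reweight_pos hw hw1)
  split_ifs <;> positivity

theorem sum_reweight (hw : ∀ i, 0 < w i) (hw1 : ∑ i, w i = 1) :
    ∑ i, reweight U S w h i = 1 := by
  classical
  unfold reweight
  rw [← Finset.sum_div]
  exact div_self (sum_reweight_pos hw hw1).ne'

theorem weightsAfter_pos_sum (hw : ∀ i, 0 < w i) (hw1 : ∑ i, w i = 1) (hs : List (X → Y)) :
    (∀ i, 0 < weightsAfter U S w hs i) ∧ ∑ i, weightsAfter U S w hs i = 1 := by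
  induction hs generalizing w with
  | nil => exact ⟨hw, hw1⟩
  | cons g hs ih => exact ih (reweight_pos hw hw1) (sum_reweight hw hw1)

end Weights

open Classical in
/-- The weight of an example decreases by `e^{-1/4}` whenever it is robustly correct, while each
round with risk at most `1/3` decreases the total weight by the factor `e^{-3/20}`. -/
theorem weight_mul_exp_le {w : Fin S.length → ℝ} (hw : ∀ i, 0 < w i) (hw1 : ∑ i, w i = 1)
    {hs : List (X → Y)} (hweak : WeakSequence U S w hs) (i : Fin S.length) :
    w i * Real.exp (-(1 / 4)) ^ (hs.countP fun h => decide (RobustlyCorrect U h (S.get i))) ≤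
      Real.exp (-(3 / 20)) ^ hs.length := by
  induction hs generalizing w with
  | nil =>
    simp only [List.countP_nil, pow_zero, mul_one, List.length_nil]
    rw [← hw1]
    exact Finset.single_le_sum (f := w) (fun j _ => (hw j).le) (Finset.mem_univ i)
  | cons h hs ih =>
    obtain ⟨hr, hrest⟩ := hweak
    have h1 := ih (reweight_pos hw hw1) (sum_reweight hw hw1) hrest
    have hZ := sum_reweight_pos (U := U) (h := h) hw hw1
    have hZle : ∑ j, w j * (if RobustlyCorrect U h (S.get j) then Real.exp (-2 * (1 / 8)) else 1) ≤
        Real.exp (-(3 / 20)) := by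
      rw [sum_reweight_eq hw1]
      have h2 := exp_neg_quarter_le
      have h3 : Real.exp (-2 * (1 / 8)) ≤ 1 := Real.exp_le_one_iff.2 (by norm_num)
      nlinarith
    set c := hs.countP fun h => decide (RobustlyCorrect U h (S.get i)) with hc
    have h4 : w i * (if RobustlyCorrect U h (S.get i) then Real.exp (-2 * (1 / 8)) else 1) *
        Real.exp (-(1 / 4)) ^ c ≤ Real.exp (-(3 / 20)) ^ (hs.length + 1) := by
      have h5 : w i * (if RobustlyCorrect U h (S.get i) then Real.exp (-2 * (1 / 8)) else 1) =
          (∑ j, w j * (if RobustlyCorrect U h (S.get j) then Real.exp (-2 * (1 / 8)) else 1)) *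
            reweight U S w h i := by
        unfold reweight
        rw [mul_div_cancel₀ _ hZ.ne']
      rw [h5, pow_succ', mul_assoc]
      exact mul_le_mul hZle h1 (mul_nonneg (reweight_pos hw hw1 i).le (by positivity))
        (Real.exp_nonneg _)
    rw [List.countP_cons, List.length_cons, ← hc]
    refine le_trans (le_of_eq ?_) h4
    by_cases hcor : RobustlyCorrect U h (S.get i)
    · simp only [hcor, decide_true, if_true]
      rw [pow_succ, show (-2 * (1 / 8) : ℝ) = -(1 / 4) by norm_num]
      ring
    · simp only [hcor, decide_false, Bool.false_eq_true, if_false, add_zero, mul_one]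

/-- The majority vote of `⌊1 + 48 ln m⌋` weak predictors is robustly correct on the whole
sample. -/
theorem robustlyCorrect_majority (y₀ : Y) (hm : 2 ≤ S.length) {hs : List (X → Y)}
    (hlen : hs.length = alphaT S.length)
    (hweak : WeakSequence U S (fun _ => 1 / (S.length : ℝ)) hs) (i : Fin S.length) :
    RobustlyCorrect U (majority y₀ hs) (S.get i) := by
  classical
  have hmpos : (0 : ℝ) < S.length := by exact_mod_cast (by omega : 0 < S.length)
  have hlog : 0 < Real.log S.length := Real.log_pos (by exact_mod_cast hm)
  have hT : 48 * Real.log S.length < hs.length := by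
    rw [hlen, alphaT]
    have := Nat.lt_floor_add_one (1 + 48 * Real.log S.length)
    linarith
  set k := hs.countP fun h => decide (RobustlyCorrect U h (S.get i)) with hk
  have hkey : hs.length < 2 * k := by
    by_contra hle
    have hle' : (2 : ℝ) * k ≤ hs.length := by exact_mod_cast not_lt.1 hle
    have h1 := weight_mul_exp_le (U := U) (S := S) (w := fun _ => 1 / (S.length : ℝ))
      (fun _ => by positivity) (by simp; field_simp) hweak i
    -- otherwise `exp(-log m - T/8) ≤ exp(-3T/20)`, that is, `T ≤ 40 log m`
    rw [← hk, ← Real.exp_nat_mul, ← Real.exp_nat_mul, one_div, ← Real.exp_log hmpos,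
      ← Real.exp_neg, ← Real.exp_add, Real.exp_le_exp] at h1
    nlinarith
  intro z hz
  refine majority_eq y₀ (hkey.trans_le (Nat.mul_le_mul_left 2 (List.countP_mono_left ?_)))
  intro h _ hh
  simp only [decide_eq_true_eq] at hh ⊢
  exact hh z hz

end Boosting

section AlphaRecursion

variable {X : Type u} {Y : Type v} {B : OracleLearner.{u, v, w} X Y} {U : X → Set X} {k : ℕ}
  {S : List (X × Y)} {y₀ : Y}

theorem alphaRounds_concat (w : Fin S.length → ℝ)
    (ss : List (List ((Fin k → unitInterval) × B.Seed)))
    (s : List ((Fin k → unitInterval) × B.Seed)) :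
    (alphaRounds y₀ B U S w (ss ++ [s])).1 = (alphaRounds y₀ B U S w ss).1 ++
      [(alphaRound B U S (weightsAfter U S w (alphaRounds y₀ B U S w ss).1) (fun _ => y₀) s).1] := by
  induction ss generalizing w with
  | nil => simp [alphaRounds, weightsAfter]
  | cons s' ss ih =>
    rw [List.cons_append, alphaRounds, alphaRounds]
    simp only [ih, List.cons_append]
    rfl

theorem length_alphaRounds (w : Fin S.length → ℝ)
    (ss : List (List ((Fin k → unitInterval) × B.Seed))) :
    (alphaRounds y₀ B U S w ss).1.length = ss.length := by
  induction ss generalizing w with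
  | nil => rfl
  | cons s ss ih => simp [alphaRounds, ih]

/-- The examples drawn from the distribution with weights `w`. -/
noncomputable def drawn (S : List (X × Y)) (w : Fin S.length → ℝ) (r : Fin k → unitInterval) :
    List (X × Y) :=
  (List.ofFn r).filterMap fun a : unitInterval => draw S w a

open Classical in
theorem alphaRound_cons (w : Fin S.length → ℝ) (h₀ : X → Y)
    (s : (Fin k → unitInterval) × B.Seed) (ss : List ((Fin k → unitInterval) × B.Seed)) :
    alphaRound B U S w h₀ (s :: ss) =
      if weightedRisk U S w (B.run s.2 (drawn S w s.1)) ≤ 1 / 3 then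
        (B.run s.2 (drawn S w s.1), B.calls s.2 (drawn S w s.1))
      else ((alphaRound B U S w (B.run s.2 (drawn S w s.1)) ss).1,
        B.calls s.2 (drawn S w s.1) + (alphaRound B U S w (B.run s.2 (drawn S w s.1)) ss).2) := by
  -- the coercion of a list from `unitInterval` to `ℝ` is elaborated as a monadic map
  have h : List.filterMap (fun r => draw S w r)
      (do let a ← List.ofFn s.1; pure (a : ℝ) : List ℝ) = drawn S w s.1 := by
    rw [drawn]
    generalize List.ofFn s.1 = l
    change List.filterMap _ (l.flatMap fun a : unitInterval => [(a : ℝ)]) = _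
    rw [← List.map_eq_flatMap, List.filterMap_map]
    rfl
  rw [alphaRound]
  simp only [h]

/-- A round whose result is not weak has failed in every repetition. -/
theorem weightedRisk_of_alphaRound {w : Fin S.length → ℝ} {h₀ : X → Y}
    {ss : List ((Fin k → unitInterval) × B.Seed)} (hss : ss ≠ [])
    (h : ¬ weightedRisk U S w (alphaRound B U S w h₀ ss).1 ≤ 1 / 3) :
    ∀ s ∈ ss, ¬ weightedRisk U S w
      (B.run s.2 (drawn S w s.1)) ≤ 1 / 3 := by
  induction ss generalizing h₀ with
  | nil => exact absurd rfl hss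
  | cons s ss ih =>
    rw [alphaRound_cons] at h
    by_cases hs : weightedRisk U S w
        (B.run s.2 (drawn S w s.1)) ≤ 1 / 3
    · rw [if_pos hs] at h
      exact absurd hs h
    · rw [if_neg hs] at h
      intro s' hs'
      rcases List.mem_cons.1 hs' with rfl | hs'
      · exact hs
      · exact ih (List.ne_nil_of_mem hs') h s' hs'

theorem alphaRound_calls_le {n : ℕ} (hB : ∀ s S, B.calls s S ≤ n) (w : Fin S.length → ℝ)
    (h₀ : X → Y) (ss : List ((Fin k → unitInterval) × B.Seed)) :
    (alphaRound B U S w h₀ ss).2 ≤ ss.length * n := by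
  induction ss generalizing h₀ with
  | nil => simp [alphaRound]
  | cons s ss ih =>
    rw [alphaRound]
    dsimp only
    rw [List.length_cons, Nat.add_mul, one_mul]
    split_ifs
    · exact (hB _ _).trans (Nat.le_add_left _ _)
    · rw [add_comm]
      exact Nat.add_le_add (ih _) (hB _ _)

theorem alphaRounds_calls_le {n N : ℕ} (hB : ∀ s S, B.calls s S ≤ n) (w : Fin S.length → ℝ)
    (ss : List (List ((Fin k → unitInterval) × B.Seed))) (hN : ∀ s ∈ ss, s.length ≤ N) :
    (alphaRounds y₀ B U S w ss).2 ≤ ss.length * (N * n) := by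
  induction ss generalizing w with
  | nil => simp [alphaRounds]
  | cons s ss ih =>
    rw [alphaRounds]
    dsimp only
    rw [List.length_cons, Nat.add_mul, one_mul, add_comm]
    refine Nat.add_le_add (ih _ fun s' hs' => hN s' (List.mem_cons_of_mem _ hs')) ?_
    exact (alphaRound_calls_le hB _ _ _).trans
      (Nat.mul_le_mul_right _ (hN s List.mem_cons_self))

end AlphaRecursion

/-! ### `α`-Boost on a labelled sample -/

section SampleWeights

variable {X : Type u} {Y : Type v} {U : X → Set X} {c : X → Y} {m : ℕ}

theorem length_labelled (c : X → Y) (x : Fin m → X) : (labelled c x).length = m := by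
  simp [labelled]

theorem get_labelled (x : Fin m → X) (i : Fin (labelled c x).length) :
    (labelled c x).get i =
      (x (i.cast (length_labelled c x)), c (x (i.cast (length_labelled c x)))) :=
  List.get_ofFn _ i

/-- Weights on `m` examples as weights on the positions of a sample of size `m`. -/
def onSample (c : X → Y) (x : Fin m → X) (W : Fin m → ℝ) : Fin (labelled c x).length → ℝ :=
  fun i => W (i.cast (length_labelled c x))

open Classical in
/-- The number of the example that is drawn by `r` from the distribution with weights `W`. -/
noncomputable def drawIndex (W : Fin m → ℝ) (r : ℝ) : Option (Fin m) :=
  (List.finRange m).find? fun i => decide (r < ∑ j ∈ Finset.univ.filter (· ≤ i), W j)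

open Classical in
/-- The examples of `x` at which `h` is not robustly correct for `c`. -/
noncomputable def errorBits (U : X → Set X) (c : X → Y) (x : Fin m → X) (h : X → Y) :
    Fin m → Bool := fun i => decide (x i ∈ robustErrorSet U c h)

/-- The total weight of the examples marked by `e`. -/
def bitRisk (W : Fin m → ℝ) (e : Fin m → Bool) : ℝ := ∑ i, if e i then W i else 0

/-- The reweighting step for a predictor that errs on the examples marked by `e`. -/
noncomputable def bitReweight (W : Fin m → ℝ) (e : Fin m → Bool) : Fin m → ℝ :=
  let v : Fin m → ℝ := fun i => W i * if e i then 1 else Real.exp (-2 * (1 / 8))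
  fun i => v i / ∑ j, v j

theorem sum_onSample (x : Fin m → X) (W : Fin m → ℝ) :
    ∑ i, onSample c x W i = ∑ i, W i :=
  (finCongr (length_labelled c x)).sum_comp W

theorem draw_labelled (x : Fin m → X) (W : Fin m → ℝ) (r : ℝ) :
    draw (labelled c x) (onSample c x W) r = (drawIndex W r).map fun i => (x i, c (x i)) := by
  have key : ∀ (S : List (X × Y)) (h : S.length = m), draw S (fun i => W (i.cast h)) r =
      (drawIndex W r).map fun i => S.get (i.cast h.symm) := by
    rintro S rfl
    rfl
  refine (key _ (length_labelled c x)).trans ?_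
  simp only [get_labelled]
  rfl

theorem drawn_labelled {k : ℕ} (x : Fin m → X) (W : Fin m → ℝ) (r : Fin k → unitInterval) :
    drawn (labelled c x) (onSample c x W) r =
      ((List.ofFn r).filterMap fun a : unitInterval => drawIndex W a).map
        fun i => (x i, c (x i)) := by
  rw [drawn, List.map_filterMap]
  simp only [draw_labelled]

theorem robustlyCorrect_iff {h : X → Y} {x : X} :
    RobustlyCorrect U h (x, c x) ↔ x ∉ robustErrorSet U c h := by
  simp [RobustlyCorrect, robustErrorSet]

theorem weightedRisk_labelled (x : Fin m → X) (W : Fin m → ℝ) (h : X → Y) :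
    weightedRisk U (labelled c x) (onSample c x W) h = bitRisk W (errorBits U c x h) := by
  classical
  rw [weightedRisk, bitRisk, ← (finCongr (length_labelled c x)).sum_comp]
  refine Finset.sum_congr rfl fun i _ => ?_
  rw [get_labelled, robustlyCorrect_iff]
  by_cases he : x (i.cast (length_labelled c x)) ∈ robustErrorSet U c h <;>
    simp [he, errorBits, onSample]

theorem reweight_labelled (x : Fin m → X) (W : Fin m → ℝ) (h : X → Y) :
    reweight U (labelled c x) (onSample c x W) h =
      onSample c x (bitReweight W (errorBits U c x h)) := by
  classical
  have hv : ∀ i, (onSample c x W i * if RobustlyCorrect U h ((labelled c x).get i) then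
      Real.exp (-2 * (1 / 8)) else 1) = onSample c x (fun i => W i *
        if errorBits U c x h i then 1 else Real.exp (-2 * (1 / 8))) i := by
    intro i
    rw [get_labelled, robustlyCorrect_iff]
    by_cases he : x (i.cast (length_labelled c x)) ∈ robustErrorSet U c h <;>
      simp [he, errorBits, onSample]
  funext i
  unfold reweight
  simp only [hv]
  rw [sum_onSample]
  rfl

theorem weightsAfter_labelled (x : Fin m → X) (W : Fin m → ℝ) (hs : List (X → Y)) :
    weightsAfter U (labelled c x) (onSample c x W) hs =
      onSample c x ((hs.map (errorBits U c x)).foldl bitReweight W) := by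
  induction hs generalizing W with
  | nil => rfl
  | cons h hs ih =>
    rw [weightsAfter, List.foldl_cons, reweight_labelled, ← weightsAfter, ih]
    rfl

end SampleWeights

/-! ### The law of the draws -/

section Draws

variable {m : ℕ} {W : Fin m → ℝ}

theorem drawIndex_eq_some_iff (hW : ∀ i, 0 ≤ W i) {r : ℝ} (hr : 0 ≤ r) {i : Fin m} :
    drawIndex W r = some i ↔ r ∈ Set.Ico (∑ j ∈ Finset.univ.filter (· < i), W j)
      (∑ j ∈ Finset.univ.filter (· ≤ i), W j) := by
  classical
  rw [drawIndex, List.find?_eq_some_iff_getElem]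
  simp only [decide_eq_true_eq, List.getElem_finRange, Bool.not_eq_true', decide_eq_false_iff_not,
    not_lt, List.length_finRange, Set.mem_Ico]
  rw [and_comm]
  refine and_congr_left fun _ => ?_
  constructor
  · rintro ⟨a, ha, rfl, hj⟩
    rcases Nat.eq_zero_or_pos a with rfl | hpos
    · refine le_trans (le_of_eq (Finset.sum_eq_zero fun j hj => ?_)) hr
      rw [Finset.mem_filter, Fin.lt_def] at hj
      exact absurd hj.2 (Nat.not_lt_zero _)
    · refine le_trans (le_of_eq ?_) (hj (a - 1) (by omega))
      congr 1
      ext j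
      simp only [Finset.mem_filter, Finset.mem_univ, true_and, Fin.lt_def, Fin.le_def, Fin.val_cast]
      omega
  · refine fun h => ⟨i, i.2, rfl, fun j hj => le_trans ?_ h⟩
    refine Finset.sum_le_sum_of_subset_of_nonneg (fun a ha => ?_) fun a _ _ => hW a
    simp only [Finset.mem_filter, Finset.mem_univ, true_and, Fin.lt_def, Fin.le_def,
      Fin.val_cast] at ha ⊢
    omega

theorem volume_drawIndex_eq_some (hW : ∀ i, 0 ≤ W i) (hW1 : ∑ i, W i = 1) (i : Fin m) :
    volume {r : unitInterval | drawIndex W r = some i} = ENNReal.ofReal (W i) := by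
  classical
  set a := ∑ j ∈ Finset.univ.filter (· < i), W j with ha
  set b := ∑ j ∈ Finset.univ.filter (· ≤ i), W j with hb
  have ha0 : 0 ≤ a := Finset.sum_nonneg fun j _ => hW j
  have hb1 : b ≤ 1 := by
    rw [← hW1]
    exact Finset.sum_le_sum_of_subset_of_nonneg (Finset.filter_subset _ _) fun j _ _ => hW j
  have hab : b = a + W i := by
    have : Finset.univ.filter (· ≤ i) = insert i (Finset.univ.filter (· < i)) := by
      ext j; simp [le_iff_eq_or_lt]
    rw [hb, this, Finset.sum_insert (by simp), add_comm]
  have hset : {r : unitInterval | drawIndex W r = some i} =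
      (fun r : unitInterval => (r : ℝ)) ⁻¹' Set.Ico a b := by
    ext r
    exact drawIndex_eq_some_iff hW r.2.1
  have hsub : Set.Ico a b ⊆ unitInterval := fun r hr => ⟨ha0.trans hr.1, hr.2.le.trans hb1⟩
  rw [hset, unitInterval.measurePreserving_coe.measure_preimage
    measurableSet_Ico.nullMeasurableSet, Measure.restrict_apply measurableSet_Ico,
    Set.inter_eq_left.2 hsub, Real.volume_Ico, hab,
    add_sub_cancel_left]

theorem drawIndex_ne_none (hW1 : ∑ i, W i = 1) {r : ℝ} (hr : r < 1) : drawIndex W r ≠ none := by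
  classical
  intro h
  rw [drawIndex, List.find?_eq_none] at h
  rcases Nat.eq_zero_or_pos m with rfl | hm
  · simp at hW1
  have := h ⟨m - 1, by omega⟩ (List.mem_finRange _)
  simp only [decide_eq_true_eq, not_lt] at this
  have hu : Finset.univ.filter (fun j : Fin m => j ≤ ⟨m - 1, by omega⟩) = Finset.univ := by
    ext j
    simp only [Finset.mem_filter, Finset.mem_univ, true_and, Fin.le_def, iff_true]
    omega
  rw [hu, hW1] at this
  linarith

theorem dmeasurable_drawIndex {Ω : Type*} [MeasurableSpace Ω] {r : Ω → ℝ} (hr : Measurable r) :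
    DMeasurable fun ω => drawIndex W (r ω) := by
  classical
  have h : DMeasurable fun ω => fun i : Fin m =>
      decide (r ω < ∑ j ∈ Finset.univ.filter (· ≤ i), W j) :=
    DMeasurable.pi fun i => dmeasurable_decide (measurableSet_lt hr measurable_const)
  exact h.map fun e => (List.finRange m).find? e

variable {X : Type u} {Y : Type v} [MeasurableSpace X] {U : X → Set X} {c : X → Y}

/-- The distribution on the points `x` with weights `W`. -/
noncomputable def weightedLaw (x : Fin m → X) (W : Fin m → ℝ) : Measure X :=
  ∑ i, ENNReal.ofReal (W i) • Measure.dirac (x i)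

theorem weightedLaw_apply (x : Fin m → X) (W : Fin m → ℝ) (E : Set X) :
    weightedLaw x W E = ∑ i, ENNReal.ofReal (W i) * Measure.dirac (x i) E := by
  simp [weightedLaw]

theorem isProbabilityMeasure_weightedLaw (x : Fin m → X) (hW : ∀ i, 0 ≤ W i)
    (hW1 : ∑ i, W i = 1) : IsProbabilityMeasure (weightedLaw x W) := by
  refine ⟨?_⟩
  simp only [weightedLaw_apply, measure_univ, mul_one]
  rw [← ENNReal.ofReal_sum_of_nonneg fun i _ => hW i, hW1, ENNReal.ofReal_one]

open Classical in
/-- The outer measure of an arbitrary set is at least the weight of the points in it. -/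
theorem ofReal_bitRisk_le (x : Fin m → X) (hW : ∀ i, 0 ≤ W i) (h : X → Y) :
    ENNReal.ofReal (bitRisk W (errorBits U c x h)) ≤ weightedLaw x W (robustErrorSet U c h) := by
  rw [bitRisk, weightedLaw_apply, ENNReal.ofReal_sum_of_nonneg
    fun i _ => by split_ifs; exacts [hW i, le_rfl]]
  refine Finset.sum_le_sum fun i _ => ?_
  by_cases he : x i ∈ robustErrorSet U c h
  · have := Measure.le_dirac_apply (s := robustErrorSet U c h) (a := x i)
    simp only [errorBits, he, decide_true, if_true, Set.indicator_of_mem, Pi.one_apply] at this ⊢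
    exact le_mul_of_one_le_right' this
  · simp [errorBits, he]

/-- The point drawn by `r`; the point `x₀` serves for the null event that there is none. -/
noncomputable def drawPoint (x : Fin m → X) (W : Fin m → ℝ) (x₀ : X) (r : unitInterval) : X :=
  ((drawIndex W r).map x).getD x₀

theorem measurePreserving_drawPoint (x : Fin m → X) (hW : ∀ i, 0 ≤ W i) (hW1 : ∑ i, W i = 1)
    (x₀ : X) : MeasurePreserving (drawPoint x W x₀) volume (weightedLaw x W) := by
  classical
  have hmeas : Measurable (drawPoint x W x₀) := fun E _ =>
    ((dmeasurable_drawIndex (W := W) measurable_subtype_coe).map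
      (fun o : Option (Fin m) => (o.map x).getD x₀)) E
  refine ⟨hmeas, ?_⟩
  have := isProbabilityMeasure_weightedLaw x hW hW1
  have : IsProbabilityMeasure (Measure.map (drawPoint x W x₀) volume) :=
    Measure.isProbabilityMeasure_map hmeas.aemeasurable
  refine Measure.eq_of_le_of_isProbabilityMeasure (Measure.le_iff.2 fun E hE => ?_)
  rw [Measure.map_apply hmeas hE, weightedLaw_apply]
  have hcover : drawPoint x W x₀ ⁻¹' E ⊆
      {1} ∪ ⋃ i, {r | drawIndex W (r : unitInterval) = some i ∧ x i ∈ E} := by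
    intro r hr
    by_cases h1 : r = 1
    · exact Or.inl h1
    right
    have hlt : (r : ℝ) < 1 := lt_of_le_of_ne r.2.2 fun h => h1 (Subtype.ext h)
    obtain ⟨i, hi⟩ := Option.ne_none_iff_exists'.1 (drawIndex_ne_none hW1 hlt)
    rw [Set.mem_preimage, drawPoint, hi] at hr
    exact Set.mem_iUnion.2 ⟨i, hi, hr⟩
  refine (measure_mono hcover).trans ((measure_union_le _ _).trans ?_)
  rw [measure_singleton, zero_add]
  refine (measure_iUnion_fintype_le _ _).trans (Finset.sum_le_sum fun i _ => ?_)
  rw [Measure.dirac_apply' _ hE]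
  by_cases hi : x i ∈ E
  · simp [hi, volume_drawIndex_eq_some hW hW1]
  · simp [hi]

/-- A repetition within a round of `α`-Boost fails with probability at most `1/3`: it runs the weak
learner on a sample from the weighted distribution, which is robustly realizable because the sample
avoids a measurable hull `N` of the error set of `c`. -/
theorem measure_repetition_le {B : OracleLearner.{u, v, w} X Y} {k : ℕ}
    (hB : RobustlyLearns B.toLearner U c (1 / 3) (1 / 3) k) (x : Fin m → X) {N : Set X}
    (hN : MeasurableSet N) (hNc : robustErrorSet U c c ⊆ N) (hx : ∀ i, x i ∉ N)
    {w : Fin (labelled c x).length → ℝ} (hw : ∀ i, 0 ≤ w i) (hw1 : ∑ i, w i = 1) :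
    (Measure.pi fun _ : Fin k => (volume : Measure unitInterval)).prod B.law
      {p | ¬ weightedRisk U (labelled c x) w (B.run p.2 (drawn (labelled c x) w p.1)) ≤ 1 / 3} ≤
        ENNReal.ofReal (1 / 3) := by
  classical
  obtain ⟨W, rfl⟩ : ∃ W, w = onSample c x W := ⟨fun i => w (i.cast (length_labelled c x).symm), rfl⟩
  have hW : ∀ i, 0 ≤ W i := fun i => hw (i.cast (length_labelled c x).symm)
  have hW1 : ∑ i, W i = 1 := by rw [← hw1, sum_onSample]
  have hm : 0 < m := by
    rcases Nat.eq_zero_or_pos m with rfl | hm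
    · simp at hW1
    · exact hm
  set x₀ := x ⟨0, hm⟩
  have hprob := isProbabilityMeasure_weightedLaw x hW hW1
  have hreal : Realizable U c (weightedLaw x W) := by
    refine measure_mono_null hNc ?_
    rw [weightedLaw_apply]
    refine Finset.sum_eq_zero fun i _ => ?_
    rw [Measure.dirac_apply' _ hN, Set.indicator_of_notMem (hx i), mul_zero]
  have hmp : MeasurePreserving (fun p : (Fin k → unitInterval) × B.Seed =>
      (p.2, fun q => drawPoint x W x₀ (p.1 q)))
      ((Measure.pi fun _ : Fin k => (volume : Measure unitInterval)).prod B.law)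
      (B.law.prod (Measure.pi fun _ : Fin k => weightedLaw x W)) :=
    ((MeasurePreserving.id B.law).prod (measurePreserving_pi (fun _ : Fin k =>
      (volume : Measure unitInterval)) (fun _ => weightedLaw x W)
        fun _ => measurePreserving_drawPoint x hW hW1 x₀)).comp Measure.measurePreserving_swap
  have hbound := (Measure.le_map_apply hmp.measurable.aemeasurable _).trans
    (hmp.map_eq ▸ hB (weightedLaw x W) hreal)
  refine le_trans ?_ hbound
  have hnull : (Measure.pi fun _ : Fin k => (volume : Measure unitInterval)).prod B.law
      {p | ∃ q, p.1 q = 1} = 0 := by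
    have h1 : ∀ q, (Measure.pi fun _ : Fin k => (volume : Measure unitInterval)).prod B.law
        {p | p.1 q = 1} = 0 := by
      intro q
      have h2 := ((measurePreserving_eval (fun _ : Fin k => (volume : Measure unitInterval)) q).comp
        (measurePreserving_fst (μ := Measure.pi fun _ : Fin k => (volume : Measure unitInterval))
          (ν := B.law))).measure_preimage (measurableSet_singleton 1).nullMeasurableSet
      rw [measure_singleton] at h2
      exact h2
    have h3 : {p : (Fin k → unitInterval) × B.Seed | ∃ q, p.1 q = 1} = ⋃ q, {p | p.1 q = 1} := by
      ext p; simp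
    rw [h3]
    exact measure_iUnion_null h1
  rw [← measure_sdiff_null hnull]
  refine measure_mono ?_
  rintro ⟨r, s⟩ ⟨hfail, hr⟩
  simp only [Set.mem_ofPred_eq, not_exists] at hr
  have hlt : ∀ q, (r q : ℝ) < 1 := fun q =>
    lt_of_le_of_ne (r q).2.2 fun h => hr q (Subtype.ext h)
  have hdrawn : drawn (labelled c x) (onSample c x W) r =
      labelled c fun q => drawPoint x W x₀ (r q) := by
    have h1 : ∀ q, drawIndex W (r q) = some ((drawIndex W (r q)).getD ⟨0, hm⟩) := fun q => by
      obtain ⟨i, hi⟩ := Option.ne_none_iff_exists'.1 (drawIndex_ne_none hW1 (hlt q))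
      simp [hi]
    rw [drawn_labelled, labelled]
    have h2 : (List.ofFn r).filterMap (fun a : unitInterval => drawIndex W a) =
        List.ofFn fun q => (drawIndex W (r q)).getD ⟨0, hm⟩ := by
      rw [List.ofFn_eq_map, List.filterMap_map, List.ofFn_eq_map, ← List.filterMap_eq_map]
      congr 1
      funext q
      exact h1 q
    rw [h2, List.map_ofFn]
    congr 1
    funext q
    simp only [Function.comp_apply, drawPoint]
    rw [h1 q]
    rfl
  simp only [Set.mem_ofPred_eq, Set.mem_preimage, not_le] at hfail ⊢
  rw [weightedRisk_labelled, hdrawn] at hfail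
  exact (ENNReal.ofReal_lt_ofReal_iff (by linarith)).2 hfail |>.trans_le
    (ofReal_bitRisk_le x hW _)

end Draws

/-! ### The rounds of `α`-Boost succeed -/

section AlphaAnalysis

variable {X : Type u} {Y : Type v} [MeasurableSpace X] {A : Learner.{u, v, w} X Y}
  {U : X → Set X} {c : X → Y} {y₀ : Y} {mA : ℕ} {T N k m n : ℕ}

/-- The seeds of `α`-Boost, with the sample. -/
abbrev Outcome (X : Type u) (Seed : Type*) (T N k m : ℕ) : Type _ :=
  (Fin T → Fin N → (Fin k → unitInterval) × Seed) × (Fin m → X)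

variable {B : OracleLearner.{u, v, w} X Y} {κ : Type*}
  {dec : κ → Outcome X B.Seed T N k m → A.Seed × (Fin mA → X)}

/-- The predictor that `B` returns in any repetition of `α`-Boost, on examples chosen from the
sample by measurable indices, is the cascade of at most `n` predictors with measurable codes. -/
def HasCodes (A : Learner.{u, v, w} X Y) (B : OracleLearner.{u, v, w} X Y) (U : X → Set X)
    (c : X → Y) (y₀ : Y) (n : ℕ)
    (dec : κ → Outcome X B.Seed T N k m → A.Seed × (Fin mA → X)) : Prop :=
  ∀ (t : Fin T) (q : Fin N) (I : Outcome X B.Seed T N k m → List (Fin m)), DMeasurable I →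
    ∃ L : Outcome X B.Seed T N k m → List κ, DMeasurable L ∧ (∀ ω, (L ω).length ≤ n) ∧
      ∀ ω, B.run (ω.1 t q).2 ((I ω).map fun i => (ω.2 i, c (ω.2 i))) =
        cascade y₀ U (decoded A c dec (L ω) ω)

theorem dmeasurable_errorBits (hM : MeasurableEvents A U c y₀ mA)
    (hdec : ∀ a, Measurable (dec a)) (l : List κ) :
    DMeasurable fun ω : Outcome X B.Seed T N k m =>
      errorBits U c ω.2 (cascade y₀ U (decoded A c dec l ω)) := by
  classical
  exact DMeasurable.pi fun i => dmeasurable_decide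
    (hM.mem_robustErrorSet_cascade hdec (x := fun ω => ω.2 i) (by fun_prop) l)

theorem exists_codes_alphaRound [Countable κ] (hM : MeasurableEvents A U c y₀ mA)
    (hdec : ∀ a, Measurable (dec a)) (hB : HasCodes A B U c y₀ n dec) (W : Fin m → ℝ)
    (t : Fin T) (qs : List (Fin N)) {L₀ : Outcome X B.Seed T N k m → List κ}
    (hL₀ : DMeasurable L₀) (hlen₀ : ∀ ω, (L₀ ω).length ≤ n) :
    ∃ L : Outcome X B.Seed T N k m → List κ, DMeasurable L ∧ (∀ ω, (L ω).length ≤ n) ∧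
      ∀ ω, (alphaRound B U (labelled c ω.2) (onSample c ω.2 W)
        (cascade y₀ U (decoded A c dec (L₀ ω) ω)) (qs.map fun q => ω.1 t q)).1 =
          cascade y₀ U (decoded A c dec (L ω) ω) := by
  classical
  induction qs generalizing L₀ with
  | nil => exact ⟨L₀, hL₀, hlen₀, fun ω => rfl⟩
  | cons q qs ih =>
    have hI : DMeasurable fun ω : Outcome X B.Seed T N k m =>
        (List.ofFn (ω.1 t q).1).filterMap fun a : unitInterval => drawIndex W a := by
      have h1 : DMeasurable fun ω : Outcome X B.Seed T N k m =>
          fun p => drawIndex W ((ω.1 t q).1 p : ℝ) :=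
        DMeasurable.pi fun p => dmeasurable_drawIndex (by fun_prop)
      have h2 := h1.map fun f => (List.ofFn f).filterMap id
      convert h2 using 2 with ω
      rw [List.ofFn_eq_map, List.ofFn_eq_map, List.filterMap_map, List.filterMap_map]
      rfl
    obtain ⟨L₁, hL₁, hlen₁, hL₁eq⟩ := hB t q _ hI
    obtain ⟨L₂, hL₂, hlen₂, hL₂eq⟩ := ih hL₁ hlen₁
    have hrisk : MeasurableSet {ω : Outcome X B.Seed T N k m |
        bitRisk W (errorBits U c ω.2 (cascade y₀ U (decoded A c dec (L₁ ω) ω))) ≤ 1 / 3} :=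
      hL₁.measurableSet_bind (p := fun l ω =>
        bitRisk W (errorBits U c ω.2 (cascade y₀ U (decoded A c dec l ω))) ≤ 1 / 3)
        fun l => dmeasurable_errorBits hM hdec l {e | bitRisk W e ≤ 1 / 3}
    refine ⟨fun ω => if bitRisk W (errorBits U c ω.2 (cascade y₀ U (decoded A c dec (L₁ ω) ω))) ≤
      1 / 3 then L₁ ω else L₂ ω, DMeasurable.ite hrisk hL₁ hL₂, fun ω => ?_, fun ω => ?_⟩
    · dsimp only
      split_ifs
      exacts [hlen₁ ω, hlen₂ ω]
    · rw [List.map_cons, alphaRound_cons, drawn_labelled, hL₁eq ω, weightedRisk_labelled]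
      dsimp only
      split_ifs
      · rfl
      · exact hL₂eq ω

/-- The predictors that `α`-Boost finds in the rounds `js`. -/
noncomputable def alphaHistory (B : OracleLearner.{u, v, w} X Y) (U : X → Set X) (c : X → Y)
    (y₀ : Y) (js : List (Fin T)) (ω : Outcome X B.Seed T N k m) : List (X → Y) :=
  (alphaRounds y₀ B U (labelled c ω.2) (onSample c ω.2 fun _ => 1 / (m : ℝ))
    (js.map fun t => List.ofFn (ω.1 t))).1

/-- The weights of `α`-Boost after the rounds `js`. -/
noncomputable def alphaWeights (B : OracleLearner.{u, v, w} X Y) (U : X → Set X) (c : X → Y)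
    (y₀ : Y) (js : List (Fin T)) (ω : Outcome X B.Seed T N k m) :
    Fin (labelled c ω.2).length → ℝ :=
  weightsAfter U (labelled c ω.2) (onSample c ω.2 fun _ => 1 / (m : ℝ))
    (alphaHistory B U c y₀ js ω)

omit [MeasurableSpace X] in
theorem alphaHistory_concat (js : List (Fin T)) (t : Fin T) (ω : Outcome X B.Seed T N k m) :
    alphaHistory B U c y₀ (js ++ [t]) ω = alphaHistory B U c y₀ js ω ++
      [(alphaRound B U (labelled c ω.2) (alphaWeights B U c y₀ js ω) (fun _ => y₀)
        (List.ofFn (ω.1 t))).1] := by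
  rw [alphaHistory, List.map_append, List.map_singleton, alphaRounds_concat]
  rfl

theorem exists_codes_alphaHistory [Countable κ] (hM : MeasurableEvents A U c y₀ mA)
    (hdec : ∀ a, Measurable (dec a)) (hB : HasCodes A B U c y₀ n dec) (js : List (Fin T)) :
    ∃ Ls : Outcome X B.Seed T N k m → List (List κ), DMeasurable Ls ∧
      (∀ ω, ∀ l ∈ Ls ω, l.length ≤ n) ∧
      ∀ ω, alphaHistory B U c y₀ js ω =
        (Ls ω).map fun l => cascade y₀ U (decoded A c dec l ω) := by
  classical
  induction js using List.reverseRecOn with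
  | nil =>
    exact ⟨fun _ => [], DMeasurable.const _, by simp, fun ω => by simp [alphaHistory, alphaRounds]⟩
  | append_singleton js t ih =>
    obtain ⟨Ls, hLs, hlen, hLseq⟩ := ih
    have hround : ∀ W : Fin m → ℝ, ∃ L : Outcome X B.Seed T N k m → List κ, DMeasurable L ∧
        (∀ ω, (L ω).length ≤ n) ∧
        ∀ ω, (alphaRound B U (labelled c ω.2) (onSample c ω.2 W) (fun _ => y₀)
          (List.ofFn (ω.1 t))).1 = cascade y₀ U (decoded A c dec (L ω) ω) := by
      intro W
      obtain ⟨L, hL, hl, hLeq⟩ := exists_codes_alphaRound hM hdec hB W t (List.finRange N)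
        (L₀ := fun _ => []) (DMeasurable.const _) (by simp)
      refine ⟨L, hL, hl, fun ω => ?_⟩
      rw [← hLeq ω, List.ofFn_eq_map]
      rfl
    choose L hL hl hLeq using hround
    have hbits : DMeasurable fun ω : Outcome X B.Seed T N k m =>
        (Ls ω).map fun l => errorBits U c ω.2 (cascade y₀ U (decoded A c dec l ω)) :=
      hLs.bind (g := fun ls ω =>
        ls.map fun l => errorBits U c ω.2 (cascade y₀ U (decoded A c dec l ω)))
        fun ls => DMeasurable.list_map fun l => dmeasurable_errorBits hM hdec l
    have hnew : DMeasurable fun ω : Outcome X B.Seed T N k m =>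
        L (((Ls ω).map fun l => errorBits U c ω.2 (cascade y₀ U (decoded A c dec l ω))).foldl
          bitReweight fun _ => 1 / (m : ℝ)) ω :=
      hbits.bind (g := fun e ω => L (e.foldl bitReweight fun _ => 1 / (m : ℝ)) ω) fun e => hL _
    refine ⟨_, hLs.bind (g := fun ls ω => ls ++ [L (((Ls ω).map fun l => errorBits U c ω.2
      (cascade y₀ U (decoded A c dec l ω))).foldl bitReweight fun _ => 1 / (m : ℝ)) ω])
      fun ls => hnew.map fun l => ls ++ [l], fun ω l h => ?_, fun ω => ?_⟩
    · rcases List.mem_append.1 h with h | h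
      · exact hlen ω l h
      · rw [List.mem_singleton.1 h]
        exact hl _ ω
    · rw [alphaHistory_concat, List.map_append, hLseq, List.map_singleton, ← hLeq, alphaWeights,
        hLseq, weightsAfter_labelled, List.map_map]
      rfl

/-- The event that the predictor found in round `t`, which follows the rounds `js`, is not weak. -/
def failedRound (B : OracleLearner.{u, v, w} X Y) (U : X → Set X) (c : X → Y) (y₀ : Y)
    (js : List (Fin T)) (t : Fin T) : Set (Outcome X B.Seed T N k m) :=
  {ω | ¬ weightedRisk U (labelled c ω.2) (alphaWeights B U c y₀ js ω)
    (alphaRound B U (labelled c ω.2) (alphaWeights B U c y₀ js ω) (fun _ => y₀)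
      (List.ofFn (ω.1 t))).1 ≤ 1 / 3}

theorem measurableSet_failedRound [Countable κ] (hM : MeasurableEvents A U c y₀ mA)
    (hdec : ∀ a, Measurable (dec a)) (hB : HasCodes A B U c y₀ n dec) (js : List (Fin T))
    (t : Fin T) : MeasurableSet (failedRound B U c y₀ js t : Set (Outcome X B.Seed T N k m)) := by
  classical
  obtain ⟨Ls, hLs, -, hLseq⟩ := exists_codes_alphaHistory hM hdec hB (js ++ [t])
  have hbits : DMeasurable fun ω : Outcome X B.Seed T N k m =>
      (alphaHistory B U c y₀ (js ++ [t]) ω).map (errorBits U c ω.2) := by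
    have := hLs.bind (g := fun ls ω =>
        ls.map fun l => errorBits U c ω.2 (cascade y₀ U (decoded A c dec l ω)))
        fun ls => DMeasurable.list_map fun l => dmeasurable_errorBits hM hdec l
    convert this using 2 with ω
    rw [hLseq, List.map_map]
    rfl
  convert hbits {e | ¬ bitRisk (e.dropLast.foldl bitReweight fun _ => 1 / (m : ℝ))
    (e.getLastD fun _ => false) ≤ 1 / 3} using 1
  ext ω
  rw [Set.mem_preimage, alphaHistory_concat, List.map_append, List.map_singleton]
  simp only [failedRound, Set.mem_ofPred_eq, List.dropLast_concat]
  rw [List.getLastD_eq_getLast?, List.getLast?_concat, Option.getD_some]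
  conv_lhs => rw [alphaWeights, weightsAfter_labelled, weightedRisk_labelled]
  rw [alphaWeights, weightsAfter_labelled]

/-- A round of `α`-Boost fails with probability at most `3^{-N}`, since its `N` repetitions fail
independently of each other. -/
theorem measure_failedRound_le [Countable κ] (hM : MeasurableEvents A U c y₀ mA)
    (hdec : ∀ a, Measurable (dec a)) (hB : HasCodes A B U c y₀ n dec)
    (hweak : RobustlyLearns B.toLearner U c (1 / 3) (1 / 3) k) (hm : 0 < m) (hN : 0 < N)
    (D : Measure X) [IsProbabilityMeasure D] (hD : Realizable U c D)
    {js : List (Fin T)} {t : Fin T} (ht : t ∉ js) :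
    (Measure.pi fun _ : Fin T => Measure.pi fun _ : Fin N =>
      (Measure.pi fun _ : Fin k => (volume : Measure unitInterval)).prod B.law).prod
        (Measure.pi fun _ : Fin m => D) (failedRound B U c y₀ js t) ≤
          ENNReal.ofReal (1 / 3) ^ N := by
  classical
  have hmeas := measurableSet_failedRound hM hdec hB js t
  -- the error set of `c` itself need not be measurable
  set E := toMeasurable D (robustErrorSet U c c) with hE
  have hE0 : D E = 0 := (measure_toMeasurable _).trans hD
  have hae : ∀ᵐ x ∂Measure.pi fun _ : Fin m => D, ∀ i, x i ∉ E := by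
    rw [ae_all_iff]
    intro i
    have := (measurePreserving_eval (fun _ : Fin m => D) i).measure_preimage
      (measurableSet_toMeasurable D (robustErrorSet U c c)).nullMeasurableSet
    rw [← hE, hE0] at this
    rw [ae_iff]
    simp only [not_not]
    exact this
  rw [Measure.prod_apply_symm hmeas]
  have hsec : ∀ᵐ x ∂Measure.pi fun _ : Fin m => D,
      (Measure.pi fun _ : Fin T => Measure.pi fun _ : Fin N =>
        (Measure.pi fun _ : Fin k => (volume : Measure unitInterval)).prod B.law)
        ((fun s => (s, x)) ⁻¹' failedRound B U c y₀ js t) ≤ ENNReal.ofReal (1 / 3) ^ N := by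
    filter_upwards [hae] with x hx
    refine pi_le_of_update t (measurable_prodMk_right hmeas) fun s => ?_
    have hhist : ∀ y, alphaHistory B U c y₀ js (Function.update s t y, x) =
        alphaHistory B U c y₀ js (s, x) := by
      intro y
      unfold alphaHistory
      have : (js.map fun j => List.ofFn (Function.update s t y j)) =
          js.map fun j => List.ofFn (s j) :=
        List.map_congr_left fun j hj => by
          rw [Function.update_of_ne (by rintro rfl; exact ht hj)]
      simp only [this]
    have hweights : ∀ y, alphaWeights B U c y₀ js (Function.update s t y, x) =
        alphaWeights B U c y₀ js (s, x) := fun y => by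
      unfold alphaWeights
      rw [hhist]
    obtain ⟨hpos, hsum⟩ := weightsAfter_pos_sum (U := U) (S := labelled c x)
      (w := onSample c x fun _ => 1 / (m : ℝ)) (fun i => by unfold onSample; positivity)
      (by rw [sum_onSample]; simp; field_simp) (alphaHistory B U c y₀ js (s, x))
    refine le_trans (measure_mono (t := Set.univ.pi fun _ : Fin N =>
      {p | ¬ weightedRisk U (labelled c x) (alphaWeights B U c y₀ js (s, x))
        (B.run p.2 (drawn (labelled c x) (alphaWeights B U c y₀ js (s, x)) p.1)) ≤ 1 / 3}) ?_) ?_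
    · intro y hy q _
      simp only [failedRound, Set.mem_ofPred_eq, Set.mem_preimage, hweights,
        Function.update_self] at hy
      have hne : List.ofFn y ≠ [] := by
        intro h
        have := congrArg List.length h
        simp at this
        omega
      exact weightedRisk_of_alphaRound hne hy (y q) (List.mem_ofFn.2 ⟨q, rfl⟩)
    · rw [Measure.pi_pi]
      refine (Finset.prod_le_prod' fun q _ => measure_repetition_le hweak x
        (measurableSet_toMeasurable D (robustErrorSet U c c)) (subset_toMeasurable _ _) hx
        (fun i => (hpos i).le) hsum).trans ?_
      simp
  refine (lintegral_mono_ae hsec).trans ?_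
  simp

omit [MeasurableSpace X] in
/-- If no round fails, the vote of `α`-Boost is robustly correct on the sample. -/
theorem notMem_robustErrorSet_of_rounds (hm : 2 ≤ m) (hT : T = alphaT m)
    (ω : Outcome X B.Seed T N k m)
    (h : ∀ t : Fin T, ω ∉ failedRound B U c y₀ ((List.finRange T).take t) t) (i : Fin m) :
    ω.2 i ∉ robustErrorSet U c (majority y₀ (alphaHistory B U c y₀ (List.finRange T) ω)) := by
  have hlab := length_labelled c ω.2
  have hweak : ∀ t ≤ T, WeakSequence U (labelled c ω.2) (onSample c ω.2 fun _ => 1 / (m : ℝ))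
      (alphaHistory B U c y₀ ((List.finRange T).take t) ω) := by
    intro t
    induction t with
    | zero => intro; simp [alphaHistory, alphaRounds, WeakSequence]
    | succ t ih =>
      intro ht
      have htake : (List.finRange T).take (t + 1) =
          (List.finRange T).take t ++ [⟨t, ht⟩] := by
        rw [List.take_add_one, List.getElem?_eq_getElem (by simpa using ht)]
        simp
      rw [htake, alphaHistory_concat, weakSequence_concat]
      exact ⟨ih (by omega), not_not.1 (h ⟨t, ht⟩)⟩
  have hfull := hweak T le_rfl
  rw [List.take_of_length_le (by simp)] at hfull
  have hcor := robustlyCorrect_majority (U := U) (S := labelled c ω.2) y₀ (by omega)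
    (hs := alphaHistory B U c y₀ (List.finRange T) ω)
    (by rw [alphaHistory, length_alphaRounds, hlab]; simp [hT])
    (by
      have : (fun _ => 1 / ((labelled c ω.2).length : ℝ)) =
          onSample c ω.2 fun _ => 1 / (m : ℝ) := by
        funext j; rw [hlab]; rfl
      rw [this]
      exact hfull) (i.cast hlab.symm)
  rw [get_labelled] at hcor
  exact robustlyCorrect_iff.1 hcor

end AlphaAnalysis

/-! ### Generalization by sample compression -/

section Compression

variable {X : Type u} {Y : Type v} [MeasurableSpace X] {A : Learner.{u, v, w} X Y}
  {U : X → Set X} {c : X → Y} {y₀ : Y} {mA m n T : ℕ} {τ : Type*}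

/-- The vote of cascades that is described by a list of lists of codes. -/
noncomputable def codedVote {Ω κ : Type*} (A : Learner.{u, v, w} X Y) (U : X → Set X) (c : X → Y)
    (y₀ : Y) (dec : κ → Ω → A.Seed × (Fin mA → X)) (Ls : List (List κ)) (ω : Ω) : X → Y :=
  majority y₀ (Ls.map fun l => cascade y₀ U (decoded A c dec l ω))

open Classical in
/-- The positions of the sample that a list of lists of codes refers to. -/
noncomputable def usedPositions (Ls : List (List (τ × (Fin mA → Fin m)))) : Finset (Fin m) :=
  Ls.flatten.toFinset.biUnion fun a => Finset.univ.image a.2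

theorem card_usedPositions_le (Ls : List (List (τ × (Fin mA → Fin m)))) :
    (usedPositions Ls).card ≤ Ls.flatten.length * mA := by
  classical
  refine Finset.card_biUnion_le.trans ((Finset.sum_le_card_nsmul _ _ mA fun a _ => ?_).trans ?_)
  · exact Finset.card_image_le.trans (by simp)
  · rw [smul_eq_mul]
    exact Nat.mul_le_mul_right _ (List.toFinset_card_le _)

/-- A predictor that is determined by the sample points in some fixed positions, and is robustly
correct on the points in the other positions, has robust risk more than `ε` only with exponentially
small probability, because the other points are independent of it. -/
theorem measure_codedVote_le {S₀ : Type*} [MeasurableSpace S₀] (P : Measure S₀)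
    [IsProbabilityMeasure P] (hM : MeasurableEvents A U c y₀ mA) {sd : τ → S₀ → A.Seed}
    (hsd : ∀ t, Measurable (sd t)) (D : Measure X) [IsProbabilityMeasure D] {ε : ℝ} (hε : 0 ≤ ε)
    (Ls : List (List (τ × (Fin mA → Fin m)))) :
    P.prod (Measure.pi fun _ : Fin m => D)
      {ω | ¬ D (robustErrorSet U c (codedVote A U c y₀
          (seedSample (fun t (ω : S₀ × (Fin m → X)) => sd t ω.1) fun i ω => ω.2 i) Ls ω)) ≤
            ENNReal.ofReal ε ∧
        ∀ i, ω.2 i ∉ robustErrorSet U c (codedVote A U c y₀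
          (seedSample (fun t (ω : S₀ × (Fin m → X)) => sd t ω.1) fun i ω => ω.2 i) Ls ω)} ≤
      ENNReal.ofReal (1 - ε) ^ (m - (usedPositions Ls).card) := by
  classical
  set dec : τ × (Fin mA → Fin m) → S₀ × (Fin m → X) → A.Seed × (Fin mA → X) :=
    seedSample (fun t (ω : S₀ × (Fin m → X)) => sd t ω.1) fun i ω => ω.2 i with hdecdef
  have hdec : ∀ a, Measurable (dec a) := measurable_seedSample (by fun_prop) (by fun_prop)
  have hpoint : ∀ ω, MeasurableSet (robustErrorSet U c (codedVote A U c y₀ dec Ls ω)) := fun ω =>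
    hM.mem_robustErrorSet_majority (Ω := X) (x := id) (dec := fun a _ => dec a ω)
      (fun _ => measurable_const) measurable_id Ls
  set G := {ω | ¬ D (robustErrorSet U c (codedVote A U c y₀ dec Ls ω)) ≤ ENNReal.ofReal ε ∧
    ∀ i, ω.2 i ∉ robustErrorSet U c (codedVote A U c y₀ dec Ls ω)} with hG
  have hGm : MeasurableSet G := by
    have hinter : {ω : S₀ × (Fin m → X) |
        ∀ i, ω.2 i ∉ robustErrorSet U c (codedVote A U c y₀ dec Ls ω)} =
        ⋂ i, {ω | ω.2 i ∈ robustErrorSet U c (codedVote A U c y₀ dec Ls ω)}ᶜ := by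
      ext ω; simp
    have hcor : MeasurableSet {ω : S₀ × (Fin m → X) |
        ∀ i, ω.2 i ∉ robustErrorSet U c (codedVote A U c y₀ dec Ls ω)} := by
      rw [hinter]
      exact MeasurableSet.iInter fun i => MeasurableSet.compl
        (hM.mem_robustErrorSet_majority hdec (x := fun ω => ω.2 i) (by fun_prop) Ls)
    exact (MeasurableSet.compl (measurableSet_le
      (measurable_measure_prodMk_left (hM.mem_robustErrorSet_majority
        (Ω := (S₀ × (Fin m → X)) × X) (dec := fun a p => dec a p.1)
        (fun a => (hdec a).comp measurable_fst) measurable_snd Ls)) measurable_const)).inter hcor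
  rw [Measure.prod_apply hGm]
  refine (lintegral_mono
    (g := fun _ => ENNReal.ofReal (1 - ε) ^ (m - (usedPositions Ls).card)) fun s => ?_).trans
      (by simp)
  refine pi_le_of_updateFinset (usedPositions Ls)ᶜ (measurable_prodMk_left hGm) fun x => ?_
  have hsame : ∀ y, codedVote A U c y₀ dec Ls
      (s, Function.updateFinset x (usedPositions Ls)ᶜ y) = codedVote A U c y₀ dec Ls (s, x) := by
    intro y
    unfold codedVote decoded
    congr 1
    refine List.map_congr_left fun l hl => ?_
    congr 1
    refine List.map_congr_left fun a ha => ?_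
    congr 1
    refine Prod.ext rfl (funext fun q => ?_)
    have hmem : a.2 q ∉ (usedPositions Ls)ᶜ := by
      rw [Finset.mem_compl, not_not, usedPositions, Finset.mem_biUnion]
      exact ⟨a, List.mem_toFinset.2 (List.mem_flatten.2 ⟨l, hl, ha⟩),
        Finset.mem_image_of_mem _ (Finset.mem_univ q)⟩
    simp only [hdecdef, seedSample, Function.updateFinset_def, dif_neg hmem]
  by_cases hbad : D (robustErrorSet U c (codedVote A U c y₀ dec Ls (s, x))) ≤ ENNReal.ofReal ε
  · refine le_trans (le_of_eq ?_) zero_le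
    convert measure_empty
    · ext y
      simp only [hG, Set.mem_ofPred_eq, Set.mem_preimage, hsame, hbad, not_true_eq_false, false_and]
      exact Iff.rfl
    · infer_instance
  refine (measure_mono (t := Set.univ.pi fun _ : ((usedPositions Ls)ᶜ : Finset (Fin m)) =>
    (robustErrorSet U c (codedVote A U c y₀ dec Ls (s, x)))ᶜ) ?_).trans ?_
  · intro y hy i _
    have h1 := hy.2 i
    simp only [hsame] at h1
    have h2 : Function.updateFinset x (usedPositions Ls)ᶜ y i = y i := by
      rw [Function.updateFinset_def]
      simp only [dif_pos i.2]
    rw [h2] at h1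
    exact h1
  · rw [Measure.pi_pi, Finset.prod_const, Finset.card_univ, Fintype.card_coe, Finset.card_compl,
      Fintype.card_fin]
    refine pow_le_pow_left₀ zero_le ?_ _
    rw [prob_compl_eq_one_sub (hpoint _), ENNReal.ofReal_sub _ hε, ENNReal.ofReal_one]
    exact tsub_le_tsub_left (not_le.1 hbad).le _

/-- The list of lists of codes that is written in a table with `T` rows and `n` columns, of which
only an initial segment of each row is used. -/
def tableLists {κ : Type*} (f : Fin T → Fin (n + 1) × (Fin n → κ)) : List (List κ) :=
  List.ofFn fun t => (List.ofFn (f t).2).take (f t).1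

theorem exists_tableLists_eq {κ : Type*} [Nonempty κ] {Ls : List (List κ)} (hT : Ls.length = T)
    (hn : ∀ l ∈ Ls, l.length ≤ n) :
    ∃ f : Fin T → Fin (n + 1) × (Fin n → κ), tableLists f = Ls := by
  subst hT
  refine ⟨fun t => (⟨(Ls.get t).length, Nat.lt_succ_of_le (hn _ (List.get_mem _ _))⟩,
    fun j => (Ls.get t).getD j (Classical.arbitrary κ)), ?_⟩
  unfold tableLists
  conv_rhs => rw [← List.ofFn_get Ls]
  congr 1
  funext t
  have := hn _ (List.get_mem Ls t)
  refine List.ext_getElem ?_ fun i h1 h2 => ?_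
  · simp only [List.length_take, List.length_ofFn]
    omega
  · simp only [List.getElem_take, List.getElem_ofFn]
    exact List.getD_eq_getElem _ _ h2

theorem length_flatten_tableLists_le {κ : Type*} (f : Fin T → Fin (n + 1) × (Fin n → κ)) :
    (tableLists f).flatten.length ≤ T * n := by
  rw [List.length_flatten]
  refine (List.sum_le_card_nsmul _ n fun a ha => ?_).trans (by simp [tableLists])
  obtain ⟨l, hl, rfl⟩ := List.mem_map.1 ha
  obtain ⟨t, rfl⟩ := List.mem_ofFn.1 hl
  simp

/-- The vote of `α`-Boost has risk more than `ε` only if one of the rounds fails, or if one of the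
finitely many votes described by codes is correct on the sample by accident. -/
theorem measure_alphaHistory_le [Fintype τ] [Nonempty τ] (hM : MeasurableEvents A U c y₀ mA)
    {B : OracleLearner.{u, v, w} X Y} {k N : ℕ} {ε : ℝ} (hε : 0 ≤ ε) (hε1 : ε ≤ 1)
    {sd : τ → (Fin T → Fin N → (Fin k → unitInterval) × B.Seed) → A.Seed}
    (hsd : ∀ t, Measurable (sd t))
    (hB : HasCodes A B U c y₀ n (mA := mA) (m := m) (seedSample
      (fun t (ω : Outcome X B.Seed T N k m) => sd t ω.1) fun i ω => ω.2 i))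
    (hweak : RobustlyLearns B.toLearner U c (1 / 3) (1 / 3) k) (hm : 2 ≤ m) (hT : T = alphaT m)
    (hN : 0 < N) (D : Measure X) [IsProbabilityMeasure D] (hD : Realizable U c D) :
    (Measure.pi fun _ : Fin T => Measure.pi fun _ : Fin N =>
      (Measure.pi fun _ : Fin k => (volume : Measure unitInterval)).prod B.law).prod
        (Measure.pi fun _ : Fin m => D)
      {ω | ¬ (D (robustErrorSet U c (majority y₀ (alphaHistory B U c y₀ (List.finRange T) ω))) ≤
        ENNReal.ofReal ε)} ≤
      ENNReal.ofReal (T * (1 / 3) ^ N + ((n + 1) * (Fintype.card τ * m ^ mA) ^ n) ^ T *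
        (1 - ε) ^ (m - T * n * mA)) := by
  classical
  set P := Measure.pi fun _ : Fin T => Measure.pi fun _ : Fin N =>
      (Measure.pi fun _ : Fin k => (volume : Measure unitInterval)).prod B.law with hP
  set dec : τ × (Fin mA → Fin m) → Outcome X B.Seed T N k m → A.Seed × (Fin mA → X) :=
    seedSample (fun t ω => sd t ω.1) fun i ω => ω.2 i with hdecdef
  have hdec : ∀ a, Measurable (dec a) := measurable_seedSample (by fun_prop) (by fun_prop)
  have : Nonempty (Fin m) := ⟨⟨0, by omega⟩⟩
  set G : (Fin T → Fin (n + 1) × (Fin n → τ × (Fin mA → Fin m))) →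
      Set (Outcome X B.Seed T N k m) := fun f =>
    {ω | ¬ D (robustErrorSet U c (codedVote A U c y₀ dec (tableLists f) ω)) ≤ ENNReal.ofReal ε ∧
      ∀ i, ω.2 i ∉ robustErrorSet U c (codedVote A U c y₀ dec (tableLists f) ω)} with hG
  set F : Fin T → Set (Outcome X B.Seed T N k m) :=
    fun t => failedRound B U c y₀ ((List.finRange T).take t) t with hF
  have hcover : {ω : Outcome X B.Seed T N k m | ¬ (D (robustErrorSet U c
      (majority y₀ (alphaHistory B U c y₀ (List.finRange T) ω))) ≤ ENNReal.ofReal ε)} ⊆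
      (⋃ t, F t) ∪ ⋃ f, G f := by
    intro ω hω
    by_cases hfail : ∃ t, ω ∈ F t
    · exact Or.inl (Set.mem_iUnion.2 hfail)
    right
    push Not at hfail
    have hcor := notMem_robustErrorSet_of_rounds (y₀ := y₀) hm hT ω hfail
    obtain ⟨Ls, -, hlen, hLseq⟩ := exists_codes_alphaHistory hM hdec hB (List.finRange T)
    have hLlen : (Ls ω).length = T := by
      have h1 := congrArg List.length (hLseq ω)
      rw [List.length_map] at h1
      rw [← h1, alphaHistory, length_alphaRounds]
      simp
    obtain ⟨f, hf⟩ := exists_tableLists_eq hLlen (hlen ω)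
    refine Set.mem_iUnion.2 ⟨f, ?_⟩
    have hvote : codedVote A U c y₀ dec (tableLists f) ω =
        majority y₀ (alphaHistory B U c y₀ (List.finRange T) ω) := by
      rw [hf, hLseq]; rfl
    simp only [hG, Set.mem_ofPred_eq, hvote]
    exact ⟨hω, hcor⟩
  have hq : 0 ≤ 1 - ε := by linarith
  have hFle : ∀ t, P.prod (Measure.pi fun _ : Fin m => D) (F t) ≤ ENNReal.ofReal (1 / 3) ^ N :=
    fun t => measure_failedRound_le hM hdec hB hweak (by omega) hN D hD fun hmem => by
      obtain ⟨i, hi, he⟩ := List.mem_take_iff_getElem.1 hmem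
      have : i = t := by simpa using congrArg Fin.val he
      omega
  have hGle : ∀ f, P.prod (Measure.pi fun _ : Fin m => D) (G f) ≤
      ENNReal.ofReal (1 - ε) ^ (m - T * n * mA) := fun f => by
    refine (measure_codedVote_le P hM hsd D hε (tableLists f)).trans ?_
    refine pow_le_pow_of_le_one zero_le (by simpa using hε) (Nat.sub_le_sub_left ?_ m)
    exact (card_usedPositions_le _).trans
      (Nat.mul_le_mul_right _ (length_flatten_tableLists_le f))
  calc _ ≤ P.prod (Measure.pi fun _ : Fin m => D) ((⋃ t, F t) ∪ ⋃ f, G f) := measure_mono hcover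
    _ ≤ ∑ t, P.prod (Measure.pi fun _ : Fin m => D) (F t) +
        ∑ f, P.prod (Measure.pi fun _ : Fin m => D) (G f) :=
      (measure_union_le _ _).trans
        (add_le_add (measure_iUnion_fintype_le _ _) (measure_iUnion_fintype_le _ _))
    _ ≤ ∑ _t : Fin T, ENNReal.ofReal (1 / 3) ^ N +
        ∑ _f : Fin T → Fin (n + 1) × (Fin n → τ × (Fin mA → Fin m)),
          ENNReal.ofReal (1 - ε) ^ (m - T * n * mA) :=
      add_le_add (Finset.sum_le_sum fun t _ => hFle t) (Finset.sum_le_sum fun f _ => hGle f)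
    _ = _ := by
      rw [Finset.sum_const, Finset.sum_const, Finset.card_univ, Finset.card_univ,
        ENNReal.ofReal_add (by positivity) (by positivity), ENNReal.ofReal_mul (by positivity),
        ENNReal.ofReal_mul (by positivity), ENNReal.ofReal_pow (by norm_num),
        ENNReal.ofReal_pow hq, nsmul_eq_mul, nsmul_eq_mul, ENNReal.ofReal_natCast,
        Fintype.card_fin]
      congr 2
      rw [← ENNReal.ofReal_natCast]
      congr 1
      simp

omit [MeasurableSpace X] in
theorem alphaBoost_run (B : OracleLearner.{u, v, w} X Y) {k : ℕ} (δ : ℝ)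
    (ω : Outcome X B.Seed (alphaT m) (alphaN m δ) k m) :
    (alphaBoost y₀ U δ m k B).run ω.1 (labelled c ω.2) =
      majority y₀ (alphaHistory B U c y₀ (List.finRange (alphaT m)) ω) := by
  change majority y₀ (alphaRounds y₀ B U (labelled c ω.2)
    (fun _ => 1 / ((labelled c ω.2).length : ℝ)) (List.ofFn fun t => List.ofFn (ω.1 t))).1 = _
  have : (fun _ => 1 / ((labelled c ω.2).length : ℝ)) =
      onSample c ω.2 fun _ => 1 / (m : ℝ) := by
    funext j; rw [length_labelled]; rfl
  rw [this, alphaHistory, List.ofFn_eq_map]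

/-- `α`-Boost on top of `β`-RoBoost learns robustly as soon as the sample is large enough for the
union bound over failing rounds and over codes. -/
theorem robustlyLearns_boosted (hM : MeasurableEvents A U c y₀ mA) {β ε δ : ℝ} (hβ : 0 < β)
    (hβ1 : β ≤ 1) (hA : BarelyRobustlyLearns A U c β (β / 6) (β / (6 * Real.log 6)) mA)
    (hε : 0 ≤ ε) (hε1 : ε ≤ 1) (hm : 2 ≤ m) (hn : n = ⌊Real.log 6 / β⌋₊) (hT : 0 < alphaT m)
    (hN : 0 < alphaN m δ)
    (hδ : alphaT m * (1 / 3) ^ alphaN m δ +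
      ((n + 1) * ((alphaT m * alphaN m δ * n : ℕ) * m ^ mA) ^ n) ^ alphaT m *
        (1 - ε) ^ (m - alphaT m * n * mA) ≤ δ) :
    RobustlyLearns (boosted y₀ U β δ mA m A).toLearner U c ε δ m := by
  intro D _ hD
  have hn' : n = ⌊roBoostT β (1 / 3)⌋₊ := by rw [hn, roBoostT_third]
  subst hn'
  have hnpos : 0 < ⌊roBoostT β (1 / 3)⌋₊ := by
    rw [roBoostT_third, Nat.floor_pos, le_div_iff₀ hβ]
    have := log_six_gt
    linarith
  have : Nonempty (Fin (alphaT m) × Fin (alphaN m δ) × Fin ⌊roBoostT β (1 / 3)⌋₊) :=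
    ⟨⟨0, hT⟩, ⟨0, hN⟩, ⟨0, hnpos⟩⟩
  set B := roBoost y₀ U β (1 / 3) (1 / 3) mA A with hB
  set k := roBoostSampleSize β (1 / 3) (1 / 3) mA with hk
  have hproj : ∀ j : Fin ⌊roBoostT β (1 / 3)⌋₊,
      Measurable (fun s : B.Seed => (s : Fin ⌊roBoostT β (1 / 3)⌋₊ → A.Seed) j) :=
    fun j => measurable_pi_apply (X := fun _ : Fin ⌊roBoostT β (1 / 3)⌋₊ => A.Seed) j
  have hsd : ∀ a : Fin (alphaT m) × Fin (alphaN m δ) × Fin ⌊roBoostT β (1 / 3)⌋₊,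
      Measurable fun s : Fin (alphaT m) → Fin (alphaN m δ) → (Fin k → unitInterval) × B.Seed =>
        ((s a.1 a.2.1).2 : Fin ⌊roBoostT β (1 / 3)⌋₊ → A.Seed) a.2.2 := fun a =>
    (hproj a.2.2).comp (by fun_prop)
  have hcodes : HasCodes A B U c y₀ ⌊roBoostT β (1 / 3)⌋₊ (mA := mA) (m := m) (seedSample
      (fun (a : Fin (alphaT m) × Fin (alphaN m δ) × Fin ⌊roBoostT β (1 / 3)⌋₊)
        (ω : Outcome X B.Seed (alphaT m) (alphaN m δ) k m) =>
          ((ω.1 a.1 a.2.1).2 : Fin ⌊roBoostT β (1 / 3)⌋₊ → A.Seed) a.2.2) fun i ω => ω.2 i) := by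
    intro t q I hI
    exact exists_codes_roBoost hM (fun a => (hsd a).comp measurable_fst) (by fun_prop)
      β (1 / 3) (1 / 3) (fun j => (t, q, j)) hI
  have h := measure_alphaHistory_le hM hε hε1 hsd hcodes
    (robustlyLearns_roBoost hM hβ hβ1 hA) hm rfl hN D hD
  simp only [← alphaBoost_run B δ] at h
  refine h.trans (ENNReal.ofReal_le_ofReal ?_)
  simp only [Fintype.card_prod, Fintype.card_fin]
  rwa [← mul_assoc]

end Compression

/-! ### The sample size -/

section SampleSize

/-- Solving `m ≥ 226 P ln² m + Q` for `m`.  The constant `226` is what `card_codes_mul_pow_le`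
requires. -/
theorem exists_sampleSize {P Q : ℝ} (hP : 8 ≤ P) (hQ : 0 ≤ Q) :
    ∃ m : ℕ, (m : ℝ) ≤ 2 * 10 ^ 6 * (P * Real.log P ^ 2 + Q) ∧
      226 * P * Real.log m ^ 2 + Q ≤ m ∧ P + 1 ≤ m ∧ Real.exp 3 ≤ m := by
  have hPpos : 0 < P := by linarith
  have he := Real.exp_one_lt_d9
  have hlogP : 2 ≤ Real.log P := by
    rw [Real.le_log_iff_exp_le hPpos]
    calc Real.exp 2 = Real.exp 1 ^ 2 := by rw [← Real.exp_nat_mul]; norm_num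
      _ ≤ 2.7182818286 ^ 2 := by gcongr
      _ ≤ P := by norm_num; linarith
  set R := P * Real.log P ^ 2 with hR
  have hPR : 4 * P ≤ R := by
    have : (4 : ℝ) ≤ Real.log P ^ 2 := by nlinarith
    nlinarith
  set V := 10 ^ 6 * (R + Q) with hV
  have hV1 : 1 ≤ V := by rw [hV]; nlinarith
  have hceil := Nat.le_ceil V
  have hceil2 : (⌈V⌉₊ : ℝ) ≤ 2 * V := by
    have := Nat.ceil_lt_add_one (by linarith : 0 ≤ V)
    linarith
  have hmpos : (0 : ℝ) < ⌈V⌉₊ := by linarith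
  have hmlog0 : 0 ≤ Real.log ⌈V⌉₊ := Real.log_nonneg (by linarith)
  refine ⟨⌈V⌉₊, ?_, ?_, ?_, ?_⟩
  · refine hceil2.trans (le_of_eq ?_)
    rw [hV]; ring
  · refine le_trans ?_ hceil
    have h17 : Real.log (10 ^ 7) ≤ 17 := by
      rw [Real.log_le_iff_le_exp (by norm_num)]
      have := Real.exp_one_gt_d9
      calc (10 : ℝ) ^ 7 ≤ 2.7182818283 ^ 17 := by norm_num
        _ ≤ Real.exp 1 ^ 17 := by gcongr
        _ = Real.exp 17 := by rw [← Real.exp_nat_mul]; norm_num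
    -- for moderate `Q` the logarithm of `m` is comparable to that of `P`;
    -- for large `Q` the first summand is dominated by `Q`
    rcases le_or_gt Q (P ^ 2) with hQP | hQP
    · have hlog1 : Real.log P ≤ P := (Real.log_le_sub_one_of_pos hPpos).trans (by linarith)
      have hR3 : R ≤ P ^ 3 := by
        rw [hR, pow_succ' P 2]
        gcongr
      have hle : (⌈V⌉₊ : ℝ) ≤ 10 ^ 7 * P ^ 3 := by
        have : P ^ 2 ≤ P ^ 3 := pow_le_pow_right₀ (by linarith) (by norm_num)
        refine hceil2.trans ?_
        rw [hV]
        nlinarith [pow_pos hPpos 3]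
      have hlog : Real.log ⌈V⌉₊ ≤ 12 * Real.log P := by
        refine (Real.log_le_log hmpos hle).trans ?_
        rw [Real.log_mul (by norm_num) (by positivity), Real.log_pow (x := P)]
        push_cast
        linarith
      have hsq : Real.log ⌈V⌉₊ ^ 2 ≤ 144 * Real.log P ^ 2 := by nlinarith
      calc 226 * P * Real.log ⌈V⌉₊ ^ 2 + Q ≤ 226 * P * (144 * Real.log P ^ 2) + Q := by gcongr
        _ = 226 * 144 * R + Q := by rw [hR]; ring
        _ ≤ V := by rw [hV]; nlinarith
    · have hQ1 : 1 ≤ Q := by nlinarith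
      have hQpos : 0 < Q := by linarith
      set s := Real.sqrt (Real.sqrt Q) with hs
      have hs4 : s ^ 4 = Q := by
        rw [show 4 = 2 * 2 by norm_num, pow_mul, hs, Real.sq_sqrt (Real.sqrt_nonneg _),
          Real.sq_sqrt hQ]
      have hs0 : 0 ≤ s := Real.sqrt_nonneg _
      have hs1 : 1 ≤ s := by
        by_contra h
        have : s ^ 4 < 1 := pow_lt_one₀ hs0 (not_le.1 h) (by norm_num)
        linarith
      have hPs : P ≤ s ^ 2 := by
        have : P ^ 2 ≤ (s ^ 2) ^ 2 := by rw [← pow_mul, hs4]; exact hQP.le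
        exact (sq_le_sq₀ hPpos.le (by positivity)).1 this
      have hlogP2 : Real.log P ≤ 2 * s := by
        calc Real.log P ≤ Real.log (s ^ 2) := Real.log_le_log hPpos hPs
          _ = 2 * Real.log s := by rw [Real.log_pow]; norm_num
          _ ≤ 2 * s := by
            have := Real.log_le_sub_one_of_pos (by linarith : 0 < s)
            linarith
      have hRQ : R ≤ 4 * Q := by
        calc R ≤ s ^ 2 * (2 * s) ^ 2 := by rw [hR]; gcongr
          _ = 4 * s ^ 4 := by ring
          _ = 4 * Q := by rw [hs4]
      have hle : (⌈V⌉₊ : ℝ) ≤ 10 ^ 7 * s ^ 4 := by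
        refine hceil2.trans ?_
        rw [hV, hs4]
        linarith
      have hlog : Real.log ⌈V⌉₊ ≤ 21 * s := by
        refine (Real.log_le_log hmpos hle).trans ?_
        rw [Real.log_mul (by norm_num) (by positivity), Real.log_pow (x := s)]
        have := Real.log_le_sub_one_of_pos (by linarith : 0 < s)
        push_cast
        linarith
      have hsq : Real.log ⌈V⌉₊ ^ 2 ≤ 441 * s ^ 2 := by nlinarith
      calc 226 * P * Real.log ⌈V⌉₊ ^ 2 + Q ≤ 226 * s ^ 2 * (441 * s ^ 2) + Q := by gcongr
        _ = 226 * 441 * s ^ 4 + Q := by ring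
        _ = 226 * 441 * Q + Q := by rw [hs4]
        _ ≤ V := by rw [hV]; nlinarith
  · refine le_trans ?_ hceil
    rw [hV]; nlinarith
  · refine le_trans ?_ hceil
    calc Real.exp 3 = Real.exp 1 ^ 3 := by rw [← Real.exp_nat_mul]; norm_num
      _ ≤ 2.7182818286 ^ 3 := by gcongr
      _ ≤ V := by rw [hV]; norm_num; nlinarith

variable {m : ℕ} {δ : ℝ}

theorem alphaT_le (hL : 1 ≤ Real.log m) : (alphaT m : ℝ) ≤ 49 * Real.log m := by
  rw [alphaT]
  have := Nat.floor_le (show (0 : ℝ) ≤ 1 + 48 * Real.log m by linarith)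
  linarith

theorem alphaT_pos (hL : 1 ≤ Real.log m) : 0 < alphaT m :=
  Nat.floor_pos.2 (by linarith)

theorem log_two_mul_alphaT_div_pos (hL : 1 ≤ Real.log m) (hδ : 0 < δ) (hδ1 : δ < 1) :
    0 < Real.log (2 * alphaT m / δ) := by
  have hT : (1 : ℝ) ≤ alphaT m := by exact_mod_cast alphaT_pos hL
  refine Real.log_pos ?_
  rw [lt_div_iff₀ hδ]
  linarith

theorem alphaN_pos (hL : 1 ≤ Real.log m) (hδ : 0 < δ) (hδ1 : δ < 1) : 0 < alphaN m δ :=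
  Nat.ceil_pos.2 (log_two_mul_alphaT_div_pos hL hδ hδ1)

theorem alphaN_le (hL : 1 ≤ Real.log m) (hδ : 0 < δ) (hδ1 : δ < 1) :
    (alphaN m δ : ℝ) ≤ 6 + Real.log (Real.log m) + Real.log (1 / δ) := by
  have hTpos : (0 : ℝ) < alphaT m := by exact_mod_cast alphaT_pos hL
  have h1 : (alphaN m δ : ℝ) < Real.log (2 * alphaT m / δ) + 1 :=
    Nat.ceil_lt_add_one (log_two_mul_alphaT_div_pos hL hδ hδ1).le
  have h2 : Real.log (2 * alphaT m / δ) =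
      Real.log (2 * alphaT m) + Real.log (1 / δ) := by
    rw [← Real.log_mul (by positivity) (by positivity), mul_one_div]
  have h3 : Real.log (2 * alphaT m) ≤ Real.log (100 * Real.log m) :=
    Real.log_le_log (by positivity) (by linarith [alphaT_le hL])
  have h4 : Real.log 100 ≤ 5 := by
    rw [Real.log_le_iff_le_exp (by norm_num)]
    have := Real.exp_one_gt_d9
    calc (100 : ℝ) ≤ 2.7182818283 ^ 5 := by norm_num
      _ ≤ Real.exp 1 ^ 5 := by gcongr
      _ = Real.exp 5 := by rw [← Real.exp_nat_mul]; norm_num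
  have h5 : Real.log (100 * Real.log m) = Real.log 100 + Real.log (Real.log m) :=
    Real.log_mul (by norm_num) (by linarith)
  linarith

/-- The expected number of the `alphaT m` rounds in which all `alphaN m δ` repetitions fail is at
most `δ/2` when each repetition fails with probability at most `1/3`. -/
theorem alphaT_mul_pow_le (hL : 1 ≤ Real.log m) (hδ : 0 < δ) :
    (alphaT m : ℝ) * (1 / 3) ^ alphaN m δ ≤ δ / 2 := by
  have hTpos : (0 : ℝ) < alphaT m := by exact_mod_cast alphaT_pos hL
  have h1 : Real.log (2 * alphaT m / δ) ≤ alphaN m δ := Nat.le_ceil _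
  have h2 : (1 / 3 : ℝ) ≤ Real.exp (-1) := by
    rw [Real.exp_neg, one_div]
    have := Real.exp_one_lt_d9
    exact inv_anti₀ (Real.exp_pos _) (by linarith)
  have h3 : (1 / 3 : ℝ) ^ alphaN m δ ≤ δ / (2 * alphaT m) := by
    calc (1 / 3 : ℝ) ^ alphaN m δ ≤ Real.exp (-1) ^ alphaN m δ := by gcongr
      _ = Real.exp (-alphaN m δ) := by rw [← Real.exp_nat_mul]; congr 1; ring
      _ ≤ Real.exp (-Real.log (2 * alphaT m / δ)) := by gcongr
      _ = δ / (2 * alphaT m) := by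
        rw [Real.exp_neg, Real.exp_log (by positivity), inv_div]
  calc (alphaT m : ℝ) * (1 / 3) ^ alphaN m δ ≤ alphaT m * (δ / (2 * alphaT m)) := by gcongr
    _ = δ / 2 := by field_simp

/-- The bound of `measure_alphaHistory_le` for votes of high risk that are correct on the sample by
accident is at most `δ/2`. -/
theorem card_codes_mul_pow_le {β ε b : ℝ} {mA n : ℕ} (hβ : 0 < β) (hβ1 : β ≤ 1) (hε : 0 < ε)
    (hε1 : ε < 1) (hδ : 0 < δ) (hδ1 : δ < 1) (hb : 8 ≤ b) (hmA : (mA : ℝ) ≤ b)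
    (hn : n = ⌊Real.log 6 / β⌋₊) (hL : 1 ≤ Real.log m) (hPm : b / (β * ε) + 1 ≤ m)
    (hm : 226 * (b / (β * ε)) * Real.log m ^ 2 + Real.log (1 / δ) / ε ≤ m) :
    ((n + 1 : ℝ) * ((alphaT m * alphaN m δ * n : ℕ) * (m : ℝ) ^ mA) ^ n) ^ alphaT m *
        (1 - ε) ^ (m - alphaT m * n * mA) ≤ δ / 2 := by
  set L := Real.log m with hLdef
  set T := alphaT m with hT
  set N := alphaN m δ with hN
  have hlogδ : 0 ≤ Real.log (1 / δ) := Real.log_nonneg (by rw [le_div_iff₀ hδ]; linarith)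
  have hQ : Real.log (1 / δ) ≤ Real.log (1 / δ) / ε := by
    rw [le_div_iff₀ hε]; nlinarith
  have hP8 : 8 ≤ b / (β * ε) := by
    rw [le_div_iff₀ (by positivity)]
    have : β * ε ≤ 1 := mul_le_one₀ hβ1 hε.le hε1.le
    nlinarith
  have hLL : L ≤ L ^ 2 := by nlinarith
  have hTle := alphaT_le (m := m) hL
  have hnle : (n : ℝ) ≤ 1.8 / β := by
    rw [hn]
    refine (Nat.floor_le (by have := log_six_gt; positivity)).trans ?_
    have := log_six_lt
    gcongr
  have hn1 : 1 ≤ n := by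
    rw [hn, Nat.one_le_floor_iff, le_div_iff₀ hβ]
    have := log_six_gt
    linarith
  have hmpos : (0 : ℝ) < m := by linarith
  have hTm : T ≤ m := by
    have : (T : ℝ) ≤ m := by nlinarith
    exact_mod_cast this
  have hNm : N ≤ m := by
    have h1 := alphaN_le (m := m) hL hδ hδ1
    have h2 : Real.log L ≤ L := (Real.log_le_sub_one_of_pos (by linarith)).trans (by linarith)
    have : (N : ℝ) ≤ m := by nlinarith
    exact_mod_cast this
  have hnm : n + 1 ≤ m := by
    have h1 : 1.8 / β ≤ b / (β * ε) := by
      rw [div_le_div_iff₀ hβ (by positivity)]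
      have : 1.8 * ε ≤ b := by nlinarith
      nlinarith
    have : (n : ℝ) + 1 ≤ m := by linarith
    exact_mod_cast this
  have hcard : (n + 1) * ((T * N * n) * m ^ mA) ^ n ≤ m ^ ((mA + 4) * n) := by
    calc (n + 1) * ((T * N * n) * m ^ mA) ^ n ≤ m ^ n * ((m * m * m) * m ^ mA) ^ n := by
          gcongr
          · exact hnm.trans (Nat.le_self_pow (by omega) m)
          · exact (Nat.le_succ n).trans hnm
      _ = m ^ ((mA + 4) * n) := by rw [← mul_pow, pow_mul]; congr 1; ring
  have hcard' : ((n + 1 : ℝ) * ((T * N * n : ℕ) * (m : ℝ) ^ mA) ^ n) ^ T ≤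
      Real.exp ((mA + 4) * n * T * L) := by
    have h1 : ((n + 1 : ℝ) * ((T * N * n : ℕ) * (m : ℝ) ^ mA) ^ n) ≤ (m : ℝ) ^ ((mA + 4) * n) := by
      exact_mod_cast hcard
    calc _ ≤ ((m : ℝ) ^ ((mA + 4) * n)) ^ T := by gcongr
      _ = Real.exp L ^ ((mA + 4) * n * T) := by rw [hLdef, Real.exp_log hmpos, ← pow_mul]
      _ = _ := by rw [← Real.exp_nat_mul]; push_cast; ring_nf
  have hsub : (m : ℝ) - T * n * mA ≤ (m - T * n * mA : ℕ) := by
    rw [sub_le_iff_le_add]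
    exact_mod_cast (by omega : m ≤ m - T * n * mA + T * n * mA)
  have hpow : (1 - ε) ^ (m - T * n * mA) ≤ Real.exp (-(ε * (m - T * n * mA))) := by
    calc (1 - ε) ^ (m - T * n * mA) ≤ Real.exp (-ε) ^ (m - T * n * mA) := by
          have := Real.one_sub_le_exp_neg ε
          gcongr
      _ = Real.exp (-(ε * (m - T * n * mA : ℕ))) := by rw [← Real.exp_nat_mul]; congr 1; ring
      _ ≤ _ := by gcongr
  have hnT : (n : ℝ) * T ≤ 1.8 / β * (49 * L) := by gcongr
  have hbβ : 0 ≤ b / β := by positivity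
  have hA : ((mA : ℝ) + 4) * n * T * L ≤ 135 * (b / β) * L ^ 2 := by
    calc ((mA : ℝ) + 4) * n * T * L = (mA + 4) * (n * T) * L := by ring
      _ ≤ (1.5 * b) * (1.8 / β * (49 * L)) * L := by gcongr; linarith
      _ = 132.3 * (b / β) * L ^ 2 := by ring
      _ ≤ 135 * (b / β) * L ^ 2 := by gcongr; norm_num
  have hB : ε * (T * n * mA) ≤ 90 * (b / β) * L ^ 2 := by
    calc ε * (T * n * mA) ≤ 1 * (T * n * mA) := by gcongr
      _ = (n * T) * mA := by ring
      _ ≤ (1.8 / β * (49 * L)) * b := by gcongr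
      _ = 88.2 * (b / β) * L := by ring
      _ ≤ 90 * (b / β) * L ^ 2 := by gcongr; norm_num
  have hC : 226 * (b / β) * L ^ 2 + Real.log (1 / δ) ≤ ε * m := by
    have := mul_le_mul_of_nonneg_left hm hε.le
    refine le_trans (le_of_eq ?_) this
    field_simp
  have hD : Real.log 2 ≤ (b / β) * L ^ 2 := by
    have h1 := Real.log_two_lt_d9
    have h2 : 8 ≤ b / β := by rw [le_div_iff₀ hβ]; nlinarith
    nlinarith
  calc _ ≤ Real.exp ((mA + 4) * n * T * L) * Real.exp (-(ε * (m - T * n * mA))) := by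
        gcongr
    _ = Real.exp ((mA + 4) * n * T * L - ε * m + ε * (T * n * mA)) := by
        rw [← Real.exp_add]; congr 1; ring
    -- `226 = 135 + 90 + 1`: the codes, the positions used by the codes, and `log 2`
    _ ≤ Real.exp (-(Real.log 2 + Real.log (1 / δ))) := by
        gcongr
        linarith
    _ = δ / 2 := by
        rw [← Real.log_mul (by norm_num) (by positivity), Real.exp_neg,
          Real.exp_log (by positivity)]
        field_simp

end SampleSize

/-- The number of calls to the black box in a run of `α`-Boost on top of `β`-RoBoost. -/
theorem calls_boosted_le {X : Type u} {Y : Type v} (y₀ : Y) (U : X → Set X) (β δ : ℝ) (mA m : ℕ)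
    (A : Learner.{u, v, w} X Y) (s : (boosted y₀ U β δ mA m A).Seed) (S : List (X × Y)) :
    (boosted y₀ U β δ mA m A).calls s S ≤
      alphaT m * (alphaN m δ * ⌊Real.log 6 / β⌋₊) := by
  have hB : ∀ ω S', (roBoost y₀ U β (1 / 3) (1 / 3) mA A).calls ω S' ≤ ⌊Real.log 6 / β⌋₊ := by
    intro ω S'
    refine (length_roBoostRounds_le _ _ _).trans ?_
    rw [List.length_nil, zero_add]
    refine le_of_eq (List.length_ofFn.trans ?_)
    rw [roBoostT_third]
  refine (alphaRounds_calls_le hB (N := alphaN m δ) _ _ fun l hl => ?_).trans ?_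
  · obtain ⟨t, rfl⟩ := List.mem_ofFn.1 hl
    simp
  · rw [List.length_ofFn]

end RobustBoost

theorem mainTheorem6 :
    ∃ C : ℝ, 0 < C ∧
      ∀ (β ε δ : ℝ) (mA : ℕ), 0 < β → β ≤ 1 → 0 < ε → ε < 1 → 0 < δ → δ < 1 →
        ∃ m : ℕ,
          (m : ℝ) ≤ C * (RobustBoost.baseSize β mA / (β * ε) *
              Real.log (RobustBoost.baseSize β mA / (β * ε)) ^ 2 + Real.log (1 / δ) / ε) ∧
          ∀ (X : Type u) [MeasurableSpace X] (Y : Type v) (U : X → Set X) (c : X → Y) (y₀ : Y)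
            (A : RobustBoost.Learner.{u, v, w} X Y),
            RobustBoost.MeasurableEvents A U c y₀ mA →
            RobustBoost.BarelyRobustlyLearns A U c β (β / 6) (β / (6 * Real.log 6)) mA →
            RobustBoost.RobustlyLearns (RobustBoost.boosted y₀ U β δ mA m A).toLearner U c ε δ m ∧
            ∀ (s : (RobustBoost.boosted y₀ U β δ mA m A).Seed) (S : List (X × Y)), S.length = m →
              ((RobustBoost.boosted y₀ U β δ mA m A).calls s S : ℝ) ≤
                C * (Real.log m * (Real.log (1 / δ) + Real.log (Real.log m))) * (1 / β) := by
  refine ⟨2 * 10 ^ 6, by norm_num, fun β ε δ mA hβ hβ1 hε hε1 hδ hδ1 => ?_⟩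
  have hlog6 := RobustBoost.log_six_gt
  have hb : 8 ≤ RobustBoost.baseSize β mA :=
    le_max_of_le_right (by linarith [RobustBoost.two_lt_log_base hβ hβ1])
  have hlogδ : 0 ≤ Real.log (1 / δ) := Real.log_nonneg (by rw [le_div_iff₀ hδ]; linarith)
  have hP : 8 ≤ RobustBoost.baseSize β mA / (β * ε) := by
    rw [le_div_iff₀ (by positivity)]
    have : β * ε ≤ 1 := mul_le_one₀ hβ1 hε.le hε1.le
    nlinarith
  obtain ⟨m, hmle, hm, hPm, hexp⟩ := RobustBoost.exists_sampleSize hP (div_nonneg hlogδ hε.le)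
  have hmpos : (0 : ℝ) < m := (Real.exp_pos 3).trans_le hexp
  have hL3 : 3 ≤ Real.log m := (Real.le_log_iff_exp_le hmpos).2 hexp
  have hL : 1 ≤ Real.log m := by linarith
  refine ⟨m, hmle, fun X _ Y U c y₀ A hM hA => ⟨?_, fun s S _ => ?_⟩⟩
  · refine RobustBoost.robustlyLearns_boosted hM hβ hβ1 hA hε.le hε1.le ?_ rfl
      (RobustBoost.alphaT_pos hL) (RobustBoost.alphaN_pos hL hδ hδ1) ?_
    · have : (2 : ℝ) ≤ m := by linarith
      exact_mod_cast this
    · have h1 := RobustBoost.alphaT_mul_pow_le (m := m) hL hδ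
      have h2 := RobustBoost.card_codes_mul_pow_le hβ hβ1 hε hε1 hδ hδ1 hb
        (le_max_left (mA : ℝ) _) rfl hL hPm hm
      linarith
  · have h1 : ((RobustBoost.boosted y₀ U β δ mA m A).calls s S : ℝ) ≤
        RobustBoost.alphaT m * (RobustBoost.alphaN m δ * (⌊Real.log 6 / β⌋₊ : ℝ)) := by
      exact_mod_cast RobustBoost.calls_boosted_le y₀ U β δ mA m A s S
    have hT := RobustBoost.alphaT_le hL
    have hN := RobustBoost.alphaN_le hL hδ hδ1
    have hn : (⌊Real.log 6 / β⌋₊ : ℝ) ≤ 1.8 * (1 / β) := by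
      refine (Nat.floor_le (by positivity)).trans ?_
      rw [mul_one_div]
      have := RobustBoost.log_six_lt
      gcongr
    have hLL : 1 ≤ Real.log (Real.log m) := by
      rw [Real.le_log_iff_exp_le (by linarith)]
      linarith [Real.exp_one_lt_d9]
    have hN' : (RobustBoost.alphaN m δ : ℝ) ≤
        7 * (Real.log (1 / δ) + Real.log (Real.log m)) := by linarith
    calc ((RobustBoost.boosted y₀ U β δ mA m A).calls s S : ℝ)
        ≤ RobustBoost.alphaT m * (RobustBoost.alphaN m δ * (⌊Real.log 6 / β⌋₊ : ℝ)) := h1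
      _ ≤ (49 * Real.log m) *
          ((7 * (Real.log (1 / δ) + Real.log (Real.log m))) * (1.8 * (1 / β))) := by
        gcongr
      _ = 617.4 * (Real.log m * (Real.log (1 / δ) + Real.log (Real.log m))) * (1 / β) := by ring
      _ ≤ 2 * 10 ^ 6 * (Real.log m * (Real.log (1 / δ) + Real.log (Real.log m))) * (1 / β) := by
        gcongr
        norm_num
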